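/- **Conventions.** Let $k$ be a perfect field. An *algebraic $k$-scheme* is a scheme of finite type over $k$; all schemes and morphisms below are algebraic $k$-schemes and $k$-morphisms. Point and set dimensions are Krull dimensions of closures. A morphism $f:X'\to X$ is *equidimensional of dimension $m$* if every fibre is empty or has all irreducible components of dimension $m$. **Twisted Poincaré duality theory (Bloch–Ogus).** It consists of the following data. *Cohomology.* For each $j\in\mathbb Z$, a contravariant functor $(Y\subset X)\mapsto\bigoplus_{i\in\mathbb Z} H^i_Y(X,j)$ from closed immersions, with cartesian squares as morphisms, to graded abelian groups, with - for closed $Z\subset Y\subset X$ a long exact sequence $\cdots\to H^i_Z(X,j)\to H^i_Y(X,j)\to H^i_{Y\setminus Z}(X\setminus Z,j)\to H^{i+1}_Z(X,j)\to\cdots$, functorial for morphisms of triples whose squares are cartesian; - excision: $H^i_Z(X,j)\cong H^i_Z(U,j)$ if $Z$ is closed in $X$ and $U\supset Z$ is open in $X$. Write $H^i(X,j)=H^i_X(X,j)$. *Homology.* For each $b\in\mathbb Z$, a functor $X\mapsto\bigoplus_{a\in\mathbb Z} H_a(X,b)$ to graded abelian groups, covariant for proper morphisms ($f_*$), with - contravariant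 pull-backs $\alpha^*:H_a(X,b)\to H_a(X',b)$ for étale $\alpha:X'\to X$, $(\alpha\alpha')^*=\alpha'^*\alpha^*$, and $\alpha^*f_*=g_*\beta^*$ for every cartesian square with $f:X\to Y$ proper, $\alpha:Y'\to Y$ étale, and base changes $g:X'\to Y'$, $\beta:X'\to X$; - for $i:Z\hookrightarrow X$ closed with open complement $j:U\hookrightarrow X$, a long exact sequence $\cdots\to H_a(Z,b)\xrightarrow{i_*}H_a(X,b)\xrightarrow{j^*}H_a(U,b)\xrightarrow{\partial}H_{a-1}(Z,b)\to\cdots$; - if $f:X'\to X$ is proper and restricts to $f':Z'\to Z$ for closed $Z'\subset X'$, $Z\subset X$ with complements $U',U$, then $f'_*\partial=\partial f_*\alpha^*$ on $H_a(U',b)$, where $\alpha:f^{-1}(U)\hookrightarrow U'$; - if $\alpha:X'\to X$ is étale and $Z'$, $U'$ are the preimages of $Z$, $U$, then $\alpha^*\partial=\partial\alpha^*$ on $H_a(U,b)$. *Duality.* - For closed $Y\subset X$ a bilinear cap product $H_a(X,b)\times H^i_Y(X,j)\to H_{a-i}(Y,b-j)$ compatible with étale pull-back, and satisfying the projection formula: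 if $f:X'\to X$ is proper and $Y'=Y\times_XX'$, then $f_*(x)\cap y=f_*(x\cap f^*y)$ for $x\in H_a(X',b)$, $y\in H^i_Y(X,j)$. - For $X$ irreducible of dimension $d$ a class $\eta_X\in H_{2d}(X,d)$, with $\alpha^*\eta_X=\eta_{X'}$ for $\alpha:X'\to X$ étale, $X'$ irreducible. For $X$ smooth of pure dimension $d$, $\eta_X\in H_{2d}(X,d)$ denotes the class that restricts to $\eta_V$ on every irreducible open $V\subset X$. - Poincaré duality: for $X$ smooth of pure dimension $d$ and $Y\subset X$ closed, $\eta_X\cap -:H^i_Y(X,j)\to H_{2d-i}(Y,d-j)$ is an isomorphism. - Principal triviality: if $X$ is smooth and $i:W\hookrightarrow X$ is a smooth closed subscheme, of pure dimension, whose ideal sheaf is generated by a global function that is everywhere a non-zero-divisor, then $i_*\eta_W=0$. **Extended Poincaré duality theory.** This is a twisted Poincaré duality theory together with maps $f^*:H_a(X,b)\to H_{a+2m}(X',b+m)$ for every flat $f:X'\to X$ that is equidimensional of dimension $m$, functorial in $f$, agreeing with the étale pull-backs if $f$ is étale and $m=0$, and such that - $f^*\eta_X=\eta_{X'}$ if $X$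 and $X'$ are irreducible; - for closed $Z\subset X$ and $Z'=Z\times_XX'$, $f^*(x\cap y)=f^*x\cap f^*y$ for $x\in H_a(X,b)$, $y\in H^i_Z(X,j)$; - for closed $Z\subset X$ with open complement $U$, $Z'=Z\times_XX'$ and $U'=f^{-1}(U)$, the maps $f^*$ commute with all maps of the long exact homology sequences of $(X,Z,U)$ and $(X',Z',U')$. It is *homotopy invariant* if for every smooth $k$-scheme $X$ the projection $p:\mathbb A^1_X\to X$ induces isomorphisms $p^*:H^i(X,j)\to H^i(\mathbb A^1_X,j)$ for all $i,j\in\mathbb Z$. **Niveau spectral sequence.** Let $X_{(p)}$ be the set of points of $X$ of dimension $p$. Closed and locally closed subsets carry the reduced structure. Put $H_a(x,b)=\varinjlim_W H_a(W,b)$ over the non-empty open $W\subset\overline{\{x\}}$, and $H_a(Z_p(X),b)=\varinjlim_Z H_a(Z,b)$ over the closed $Z\subset X$ of dimension $\le p$. Let $$E^1_{p,q}(X,b)=\bigoplus_{x\in X_{(p)}}H_{p+q}(x,b).$$ The differential $d^1:E^1_{p,q}(X,b)\to E^1_{p-1,q}(X,b)$ is the composition $$E^1_{p,q}(X,b)\to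 H_{p+q-1}(Z_{p-1}(X),b)\to E^1_{p-1,q}(X,b)$$ of the map given by the boundary maps $\partial:H_{p+q}(W,b)\to H_{p+q-1}(\overline{\{x\}}\setminus W,b)$ and the map given by restriction to the generic points of dimension $p-1$. Let $E^2_{p,q}(X,b)$ be the homology of $(E^1_{\bullet,q}(X,b),d^1)$ at $E^1_{p,q}(X,b)$. For $p:\mathbb A^1_X\to X$, the pull-back maps $H_a(W,b)\to H_{a+2}(\mathbb A^1_W,b+1)$, followed by restriction to the generic point of $\mathbb A^1_W$, induce maps $p^*:E^1_{p,q}(X,b)\to E^1_{p+1,q+1}(\mathbb A^1_X,b+1)$. **Lemma.** Let $k$ be a perfect field, let $(H^\ast_\bullet(-,\ast),H_\ast(-,\ast))$ be a homotopy invariant extended Poincaré duality theory on algebraic $k$-schemes, let $X$ be any algebraic $k$-scheme (not necessarily smooth), and let $p:\mathbb A^1_X\to X$ be the affine line over $X$. (i) The flat pull-back $p^*:H_a(X,b)\to H_{a+2}(\mathbb A^1_X,b+1)$ is an isomorphism for all $a,b\in\mathbb Z$. (ii) The maps $p^*$ on $E^1$-terms commute with the differentials $d^1$, and the induced maps $p^*:E^2_{p,q}(X,b)\to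 E^2_{p+1,q+1}(\mathbb A^1_X,b+1)$ are isomorphisms for all $p,q,b\in\mathbb Z$. -/

import Mathlib

open CategoryTheory CategoryTheory.Limits AlgebraicGeometry TopologicalSpace

universe u v

namespace BlochOgus

section Schemes

/-- The reduced induced structure is reduced. -/
theorem isReduced_vanishing (X : Scheme.{u}) (Z : Closeds X) :
    IsReduced (Scheme.IdealSheafData.vanishingIdeal Z).subscheme := by
  let I := Scheme.IdealSheafData.vanishingIdeal Z
  have : ∀ i, IsReduced (I.subschemeCover.openCover.X i) := by
    intro U
    have : _root_.IsReduced (Γ(X, U.1) ⧸ I.ideal U) := by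
      rw [← Ideal.isRadical_iff_quotient_reduced]
      exact PrimeSpectrum.isRadical_vanishingIdeal _
    exact inferInstanceAs (IsReduced (Spec (.of (Γ(X, U.1) ⧸ I.ideal U))))
  exact IsReduced.of_openCover _ I.subschemeCover.openCover

theorem vanishing_le_ker {X Y : Scheme.{u}} (f : X ⟶ Y) [QuasiCompact f] [IsReduced X]
    (Z : Closeds Y) (h : Set.range f ⊆ Z) :
    Scheme.IdealSheafData.vanishingIdeal Z ≤ f.ker := by
  have h1 : f.ker.support ≤ Z := by
    intro x hx
    have h2 : x ∈ (f.ker.support : Set Y) := hx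
    rw [Scheme.Hom.support_ker] at h2
    exact closure_minimal h Z.isClosed h2
  refine (Scheme.IdealSheafData.vanishingIdeal_antimono h1).trans ?_
  rw [Scheme.IdealSheafData.vanishingIdeal_support]
  intro U x hx
  simp only [Scheme.IdealSheafData.radical_ideal, Scheme.Hom.ker_apply] at hx ⊢
  obtain ⟨n, hn⟩ := hx
  rw [RingHom.mem_ker] at hn ⊢
  rw [map_pow] at hn
  exact eq_zero_of_pow_eq_zero hn

theorem isIso_of_isImmersion_surjective {X Y : Scheme.{u}} (f : X ⟶ Y) [IsImmersion f]
    [Surjective f] [IsReduced Y] : IsIso f := by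
  have : IsClosedImmersion f := .of_isPreimmersion f (by
    rw [f.surjective.range_eq]; exact isClosed_univ)
  exact isIso_of_isClosedImmersion_of_surjective f

theorem isOpenImmersion_of_isImmersion {X Y : Scheme.{u}} (f : X ⟶ Y) [IsImmersion f]
    [IsReduced Y] (h : IsOpen (Set.range f)) : IsOpenImmersion f := by
  let U : Y.Opens := ⟨Set.range f, h⟩
  let g : X ⟶ U := IsOpenImmersion.lift U.ι f (by simp [U])
  have hg : g ≫ U.ι = f := IsOpenImmersion.lift_fac _ _ _
  have : IsImmersion (g ≫ U.ι) := by rw [hg]; infer_instance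
  have : IsImmersion g := .of_comp g U.ι
  have : Surjective g := ⟨by
    rintro ⟨y, x, rfl⟩
    refine ⟨x, Subtype.ext ?_⟩
    have := congr($hg x)
    exact this⟩
  have := isIso_of_isImmersion_surjective g
  rw [← hg]; infer_instance

/-- `f` is flat and equidimensional of dimension `m`: every irreducible component of every
fibre has dimension `m` (in particular a fibre may be empty). -/
def IsFlatEquidim {X Y : Scheme.{u}} (f : X ⟶ Y) (m : ℕ) : Prop :=
  Flat f ∧ ∀ y : Y, ∀ C ∈ irreducibleComponents (f.fiber y), topologicalKrullDim C = m

theorem flat_affineSpace (n : Type u) (S : Scheme.{u}) : Flat (𝔸(n; S) ↘ S) := by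
  let R : CommRingCat.{u} := .of (ULift.{u} ℤ)
  have h : Flat (𝔸(n; Spec R) ↘ Spec R) := by
    have h1 : Flat (Spec.map (CommRingCat.ofHom (MvPolynomial.C (σ := n) (R := R)))) := by
      rw [Flat.SpecMap_iff]
      change RingHom.Flat (algebraMap (ULift.{u} ℤ) (MvPolynomial n (ULift.{u} ℤ)))
      rw [RingHom.flat_algebraMap_iff]
      infer_instance
    have h2 : (AffineSpace.SpecIso n R).hom ≫ Spec.map (CommRingCat.ofHom MvPolynomial.C) =
        𝔸(n; Spec R) ↘ Spec R := by
      rw [← AffineSpace.SpecIso_inv_over, Iso.hom_inv_id_assoc]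
    rw [← h2]
    infer_instance
  exact MorphismProperty.of_isPullback (P := @Flat)
    (AffineSpace.isPullback_map (n := n) (specULiftZIsTerminal.from S)) h

theorem isFlatEquidim_affineLine (S : Scheme.{u}) :
    IsFlatEquidim (𝔸(PUnit.{u+1}; S) ↘ S) 1 := by
  refine ⟨flat_affineSpace _ _, fun y C hC => ?_⟩
  let e : (𝔸(PUnit.{u+1}; S) ↘ S).fiber y ≅
      Spec (.of (MvPolynomial PUnit.{u+1} (S.residueField y))) :=
    (AffineSpace.isPullback_map (n := PUnit.{u+1}) (S.fromSpecResidueField y)).isoPullback.symm ≪≫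
      AffineSpace.SpecIso PUnit.{u+1} (S.residueField y)
  have h1 := e.hom.homeomorph.isHomeomorph.topologicalKrullDim_eq
  have h2 : topologicalKrullDim
      (Spec (.of (MvPolynomial PUnit.{u+1} (S.residueField y)))) = 1 := by
    refine (PrimeSpectrum.topologicalKrullDim_eq_ringKrullDim
      (MvPolynomial PUnit.{u+1} (S.residueField y))).trans ?_
    rw [MvPolynomial.ringKrullDim_of_isNoetherianRing]
    simp
  have : IrreducibleSpace ((𝔸(PUnit.{u+1}; S) ↘ S).fiber y) := by
    infer_instance
  rw [irreducibleComponents_eq_singleton] at hC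
  obtain rfl := hC
  rw [(Homeomorph.Set.univ _).isHomeomorph.topologicalKrullDim_eq, h1, h2]
  simp

theorem IsFlatEquidim.iso_comp {X X' Y : Scheme.{u}} {f : X ⟶ Y} {m : ℕ}
    (hf : IsFlatEquidim f m) (e : X' ⟶ X) [IsIso e] : IsFlatEquidim (e ≫ f) m := by
  have := hf.1
  refine ⟨inferInstance, fun y C hC => ?_⟩
  let i : (e ≫ f).fiber y ⟶ f.fiber y :=
    pullback.map _ _ _ _ e (𝟙 _) (𝟙 _) (by simp) (by simp)
  have hi : IsIso i := pullback.map_isIso _ _ _ _ _ _ _ _ _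
  let h := i.homeomorph
  have hC' : h '' C ∈ irreducibleComponents (f.fiber y) := by
    rw [h.image_eq_preimage_symm]
    exact preimage_mem_irreducibleComponents hC h.symm.isOpenEmbedding
      ⟨hC.1.1.some, hC.1.1.some_mem, h hC.1.1.some, by simp⟩
  rw [← hf.2 y _ hC']
  exact (h.image C).isHomeomorph.topologicalKrullDim_eq

theorem isPullback_of_reduced {P A B D : Scheme.{u}} {fst : P ⟶ A} {snd : P ⟶ B} {f : A ⟶ D}
    {g : B ⟶ D} (w : fst ≫ f = snd ≫ g) [IsImmersion fst] [IsImmersion g]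
    [IsReduced (pullback f g)] (h : ∀ a : A, f a ∈ Set.range g → a ∈ Set.range fst) :
    IsPullback fst snd f g := by
  let l : P ⟶ pullback f g := pullback.lift fst snd w
  have hl : l ≫ pullback.fst f g = fst := pullback.lift_fst _ _ _
  have : IsImmersion (l ≫ pullback.fst f g) := by rw [hl]; infer_instance
  have : IsImmersion l := .of_comp l (pullback.fst f g)
  have : Surjective l := ⟨fun z => by
    obtain ⟨p, hp⟩ := h (pullback.fst f g z) ⟨pullback.snd f g z, by
      have := congr($(pullback.condition (f := f) (g := g)) z)
      exact this.symm⟩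
    refine ⟨p, (pullback.fst f g).isEmbedding.injective ?_⟩
    rw [← hp, ← hl]; rfl⟩
  have := isIso_of_isImmersion_surjective l
  exact .of_iso_pullback ⟨w⟩ (asIso l) hl (pullback.lift_snd _ _ _)

end Schemes

variable {k : Type u} [Field k]

/-- An algebraic `k`-scheme: a scheme of finite type over `k`. -/
structure AlgSch (k : Type u) [Field k] where
  sch : Scheme.{u}
  str : sch ⟶ Spec (.of k)
  [ft : LocallyOfFiniteType str]
  [qc : QuasiCompact str]

namespace AlgSch

attribute [instance] ft qc

/-- A morphism of `k`-schemes. -/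
@[ext]
structure Hom (X Y : AlgSch k) where
  hom : X.sch ⟶ Y.sch
  w : hom ≫ Y.str = X.str

attribute [simp] Hom.w

instance : Category (AlgSch k) where
  Hom := Hom
  id X := ⟨𝟙 _, by simp⟩
  comp f g := ⟨f.hom ≫ g.hom, by simp⟩
  id_comp f := Hom.ext (Category.id_comp _)
  comp_id f := Hom.ext (Category.comp_id _)
  assoc f g h := Hom.ext (Category.assoc _ _ _)

@[simp] theorem id_hom (X : AlgSch k) : Hom.hom (𝟙 X) = 𝟙 X.sch := rfl

@[simp] theorem comp_hom {X Y Z : AlgSch k} (f : X ⟶ Y) (g : Y ⟶ Z) :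
    (f ≫ g).hom = f.hom ≫ g.hom := rfl

@[ext] theorem hom_ext {X Y : AlgSch k} {f g : X ⟶ Y} (h : f.hom = g.hom) : f = g := Hom.ext h

instance (X : AlgSch k) : IsNoetherian X.sch := by
  have := LocallyOfFiniteType.isLocallyNoetherian X.str
  have : CompactSpace X.sch := by
    have := QuasiCompact.isCompact_preimage (f := X.str) Set.univ isOpen_univ
      (isCompact_univ (X := Spec (.of k)))
    exact ⟨by simpa using this⟩
  exact { }

/-- A `k`-scheme that is of finite type over an algebraic `k`-scheme. -/
@[reducible]
noncomputable def ofHom (X : AlgSch k) {W : Scheme.{u}} (f : W ⟶ X.sch) [LocallyOfFiniteType f]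
    [QuasiCompact f] : AlgSch k where
  sch := W
  str := f ≫ X.str

/-- The affine line over `X`. -/
@[reducible]
noncomputable def line (X : AlgSch k) : AlgSch k := X.ofHom (𝔸(PUnit.{u+1}; X.sch) ↘ X.sch)

/-- The projection of the affine line over `X`. -/
noncomputable def lineProj (X : AlgSch k) : X.line ⟶ X :=
  ⟨𝔸(PUnit.{u+1}; X.sch) ↘ X.sch, rfl⟩

theorem isFlatEquidim_lineProj (X : AlgSch k) : IsFlatEquidim X.lineProj.hom 1 :=
  isFlatEquidim_affineLine X.sch

/-- The locally closed subsets of `X`. -/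
def LC (X : AlgSch k) : Type u := {S : Set X.sch // IsLocallyClosed S}

variable {X : AlgSch k}

namespace LC

instance : PartialOrder (LC X) := inferInstanceAs (PartialOrder {S : Set X.sch // IsLocallyClosed S})

/-- The largest open subset of `X` in which `S` is closed. -/
def nhd (S : LC X) : X.sch.Opens := ⟨coborder S.1, S.2.isOpen_coborder⟩

/-- `S` as a closed subset of `S.nhd`. -/
def closeds (S : LC X) : Closeds S.nhd.toScheme :=
  ⟨S.nhd.ι ⁻¹' S.1, isClosed_preimage_val_coborder⟩

/-- The reduced scheme structure on the locally closed subset `S`. -/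
@[reducible]
noncomputable def redSch (S : LC X) : Scheme.{u} :=
  (Scheme.IdealSheafData.vanishingIdeal S.closeds).subscheme

/-- The immersion of `S`, with its reduced structure, into `X`. -/
noncomputable def redι (S : LC X) : S.redSch ⟶ X.sch :=
  (Scheme.IdealSheafData.vanishingIdeal S.closeds).subschemeι ≫ S.nhd.ι

instance (S : LC X) : IsReduced S.redSch := isReduced_vanishing _ _

instance (S : LC X) : IsImmersion S.redι := by unfold redι; infer_instance

instance (S : LC X) : QuasiCompact S.redι := by unfold redι; infer_instance

theorem range_redι (S : LC X) : Set.range S.redι = S.1 := by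
  have h : (S.redι : S.redSch → X.sch) = S.nhd.ι ∘
    (Scheme.IdealSheafData.vanishingIdeal S.closeds).subschemeι := rfl
  rw [h, Set.range_comp, Scheme.IdealSheafData.range_subschemeι,
    Scheme.IdealSheafData.coe_support_vanishingIdeal]
  change S.nhd.ι '' (S.nhd.ι ⁻¹' S.1) = S.1
  rw [Set.image_preimage_eq_inter_range, Scheme.Opens.range_ι]
  exact Set.inter_eq_left.mpr subset_coborder

/-- The locally closed subset `S` of `X` as a reduced algebraic `k`-scheme. -/
@[reducible]
noncomputable def red (S : LC X) : AlgSch k := X.ofHom S.redι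

instance (S : LC X) : IsReduced S.red.sch := inferInstanceAs (IsReduced S.redSch)

/-- The immersion `S.red ⟶ X`. -/
noncomputable def ι (S : LC X) : S.red ⟶ X := ⟨S.redι, rfl⟩

instance (S : LC X) : IsImmersion S.ι.hom := inferInstanceAs (IsImmersion S.redι)

theorem range_ι (S : LC X) : Set.range S.ι.hom = S.1 := S.range_redι

theorem exists_lift (S : LC X) {W : AlgSch k} [IsReduced W.sch] (f : W ⟶ X)
    (h : Set.range f.hom ⊆ S.1) : ∃ g : W ⟶ S.red, g ≫ S.ι = f := by
  let f₁ : W.sch ⟶ S.nhd := IsOpenImmersion.lift S.nhd.ι f.hom (by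
    simpa using! h.trans subset_coborder)
  have hf₁ : f₁ ≫ S.nhd.ι = f.hom := IsOpenImmersion.lift_fac _ _ _
  have h₁ : Set.range f₁ ⊆ S.closeds := by
    rintro _ ⟨w, rfl⟩
    have : S.nhd.ι (f₁ w) = f.hom w := congr($hf₁ w)
    have h2 : f.hom w ∈ S.1 := h ⟨w, rfl⟩
    rw [← this] at h2
    exact h2
  let g : W.sch ⟶ S.redSch := IsClosedImmersion.lift
    (Scheme.IdealSheafData.vanishingIdeal S.closeds).subschemeι f₁ (by
      rw [Scheme.IdealSheafData.ker_subschemeι]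
      exact vanishing_le_ker _ _ h₁)
  have hg : g ≫ S.redι = f.hom := by
    simp only [redι, g, IsClosedImmersion.lift_fac_assoc, hf₁]
  exact ⟨⟨g, by change g ≫ S.redι ≫ X.str = _; rw [reassoc_of% hg, f.w]⟩, hom_ext hg⟩

/-- A morphism from a reduced scheme into `X` with image in `S` factors through `S.red`. -/
noncomputable def lift (S : LC X) {W : AlgSch k} [IsReduced W.sch] (f : W ⟶ X)
    (h : Set.range f.hom ⊆ S.1) : W ⟶ S.red := (S.exists_lift f h).choose

@[simp]
theorem lift_ι (S : LC X) {W : AlgSch k} [IsReduced W.sch] (f : W ⟶ X)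
    (h : Set.range f.hom ⊆ S.1) : S.lift f h ≫ S.ι = f := (S.exists_lift f h).choose_spec


@[ext] theorem ext {S T : LC X} (h : S.1 = T.1) : S = T := Subtype.ext h

instance (S : LC X) : Mono S.ι := ⟨fun f g h => hom_ext (by
  have : f.hom ≫ S.ι.hom = g.hom ≫ S.ι.hom := congr($(h).hom)
  rwa [cancel_mono] at this)⟩

/-- The inclusion of locally closed subsets, as a morphism of reduced schemes. -/
noncomputable def incl {S T : LC X} (h : S ≤ T) : S.red ⟶ T.red :=
  T.lift S.ι (S.range_ι.trans_subset h)

@[simp]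
theorem incl_ι {S T : LC X} (h : S ≤ T) : incl h ≫ T.ι = S.ι := lift_ι _ _ _

@[simp]
theorem incl_ι_assoc {S T : LC X} (h : S ≤ T) {W : AlgSch k} (f : X ⟶ W) :
    incl h ≫ T.ι ≫ f = S.ι ≫ f := by
  rw [← Category.assoc, incl_ι]

@[simp]
theorem incl_hom_ι {S T : LC X} (h : S ≤ T) : (incl h).hom ≫ T.ι.hom = S.ι.hom :=
  congr($(incl_ι h).hom)

@[simp] theorem incl_refl (S : LC X) : incl (le_refl S) = 𝟙 S.red := by
  rw [← cancel_mono S.ι]; simp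

@[simp] theorem incl_comp {S T R : LC X} (h : S ≤ T) (h' : T ≤ R) :
    incl h ≫ incl h' = incl (h.trans h') := by
  rw [← cancel_mono R.ι]; simp

instance {S T : LC X} (h : S ≤ T) : IsImmersion (incl h).hom := by
  have : IsImmersion ((incl h).hom ≫ T.ι.hom) := by rw [incl_hom_ι]; infer_instance
  exact .of_comp _ T.ι.hom

theorem mem_range_incl {S T : LC X} (h : S ≤ T) (t : T.red.sch) :
    t ∈ Set.range (incl h).hom ↔ T.ι.hom t ∈ S.1 := by
  constructor
  · rintro ⟨s, rfl⟩
    rw [← S.range_ι]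
    exact ⟨s, congr($(incl_hom_ι h) s).symm⟩
  · intro ht
    rw [← S.range_ι] at ht
    obtain ⟨s, hs⟩ := ht
    refine ⟨s, T.ι.hom.isEmbedding.injective ?_⟩
    rw [← hs]
    exact congr($(incl_hom_ι h) s)

theorem range_incl {S T : LC X} (h : S ≤ T) : Set.range (incl h).hom = T.ι.hom ⁻¹' S.1 :=
  Set.ext (mem_range_incl h)

/-- `S` is an open subset of `T`. -/
def OpenIn (S T : LC X) : Prop := ∃ U : Set X.sch, IsOpen U ∧ S.1 = U ∩ T.1

theorem OpenIn.le {S T : LC X} (h : S.OpenIn T) : S ≤ T := by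
  obtain ⟨U, -, hU⟩ := h
  exact hU.trans_subset Set.inter_subset_right

theorem OpenIn.trans {S T R : LC X} (h : S.OpenIn T) (h' : T.OpenIn R) : S.OpenIn R := by
  obtain ⟨U, hU, e⟩ := h
  obtain ⟨V, hV, e'⟩ := h'
  exact ⟨U ∩ V, hU.inter hV, by rw [e, e', Set.inter_assoc]⟩

theorem OpenIn.of_le {S T R : LC X} (h : S.OpenIn R) (h₁ : S ≤ T) (h₂ : T ≤ R) : S.OpenIn T := by
  obtain ⟨U, hU, e⟩ := h
  refine ⟨U, hU, Set.Subset.antisymm (fun x hx => ⟨(e ▸ hx : x ∈ U ∩ R.1).1, h₁ hx⟩) ?_⟩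
  rintro x ⟨hx, hx'⟩
  rw [e]
  exact ⟨hx, h₂ hx'⟩

theorem OpenIn.isOpenImmersion {S T : LC X} (h : S.OpenIn T) : IsOpenImmersion (incl h.le).hom := by
  refine isOpenImmersion_of_isImmersion _ ?_
  obtain ⟨U, hU, e⟩ := id h
  rw [range_incl, e, Set.preimage_inter]
  have : T.ι.hom ⁻¹' T.1 = Set.univ := by
    rw [← T.range_ι]; exact Set.preimage_range _
  rw [this, Set.inter_univ]
  exact hU.preimage T.ι.hom.continuous

theorem OpenIn.etale {S T : LC X} (h : S.OpenIn T) : Etale (incl h.le).hom := by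
  have := h.isOpenImmersion
  infer_instance

/-- The intersection of two locally closed subsets. -/
def inter (S T : LC X) : LC X := ⟨S.1 ∩ T.1, S.2.inter T.2⟩

theorem inter_le_left (S T : LC X) : S.inter T ≤ S := Set.inter_subset_left
theorem inter_le_right (S T : LC X) : S.inter T ≤ T := Set.inter_subset_right

/-- The complement in `T` of an open subset `W` of `T`. -/
def diff (T W : LC X) (h : W.OpenIn T) : LC X := ⟨T.1 \ W.1, by
  obtain ⟨U, hU, e⟩ := h
  have : T.1 \ W.1 = T.1 ∩ Uᶜ := by
    ext x; simp only [e, Set.mem_sdiff, Set.mem_inter_iff, Set.mem_compl_iff]; tauto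
  rw [this]
  exact T.2.inter hU.isClosed_compl.isLocallyClosed⟩

theorem diff_le (T W : LC X) (h : W.OpenIn T) : T.diff W h ≤ T := Set.sdiff_subset

theorem isPullback_incl {S V T R : LC X} (hS : S ≤ T) (hV : V.OpenIn T) (hRS : R ≤ S) (hRV : R ≤ V)
    (hR : S.1 ∩ V.1 ⊆ R.1) :
    IsPullback (incl hRS).hom (incl hRV).hom (incl hS).hom (incl hV.le).hom := by
  have := hV.isOpenImmersion
  have : IsReduced (pullback (incl hS).hom (incl hV.le).hom) :=
    isReduced_of_isOpenImmersion (pullback.fst (incl hS).hom (incl hV.le).hom)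
  refine isPullback_of_reduced (by simp only [← comp_hom, incl_comp]) fun a ha => ?_
  rw [mem_range_incl] at ha ⊢
  have h : T.ι.hom ((incl hS).hom a) = S.ι.hom a := congr($(incl_hom_ι hS) a)
  rw [h] at ha
  exact hR ⟨by rw [← S.range_ι]; exact ⟨a, rfl⟩, ha⟩

/-- The preimage of a locally closed subset in the affine line. -/
def line (S : LC X) : LC X.line :=
  ⟨X.lineProj.hom ⁻¹' S.1, S.2.preimage X.lineProj.hom.continuous⟩

theorem line_mono {S T : LC X} (h : S ≤ T) : S.line ≤ T.line := Set.preimage_mono h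

theorem OpenIn.line {S T : LC X} (h : S.OpenIn T) : S.line.OpenIn T.line := by
  obtain ⟨U, hU, e⟩ := h
  exact ⟨_, hU.preimage X.lineProj.hom.continuous, congr(X.lineProj.hom ⁻¹' $e)⟩

/-- The projection of the affine line over `X` restricted to the part over `S`. -/
noncomputable def lineRes (S : LC X) : S.line.red ⟶ S.red :=
  S.lift (S.line.ι ≫ X.lineProj) (by
    have h : (S.line.ι ≫ X.lineProj).hom = S.line.ι.hom ≫ X.lineProj.hom := rfl
    rintro _ ⟨z, rfl⟩
    have : S.line.ι.hom z ∈ S.line.1 := by rw [← S.line.range_ι]; exact ⟨z, rfl⟩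
    exact this)

theorem lineRes_ι (S : LC X) : S.lineRes ≫ S.ι = S.line.ι ≫ X.lineProj := lift_ι _ _ _

theorem lineRes_hom_ι (S : LC X) : S.lineRes.hom ≫ S.ι.hom = S.line.ι.hom ≫ X.lineProj.hom :=
  congr($(S.lineRes_ι).hom)

theorem isPullback_lineRes (S : LC X) :
    IsPullback S.line.ι.hom S.lineRes.hom X.lineProj.hom S.ι.hom := by
  let e : pullback X.lineProj.hom S.ι.hom ≅ 𝔸(PUnit.{u+1}; S.red.sch) :=
    (AffineSpace.isPullback_map (n := PUnit.{u+1}) S.ι.hom).isoPullback.symm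
  have : IsReduced (pullback X.lineProj.hom S.ι.hom) := isReduced_of_isOpenImmersion e.hom
  refine isPullback_of_reduced S.lineRes_hom_ι.symm fun a ha => ?_
  rw [S.range_ι] at ha
  rw [S.line.range_ι]
  exact ha

theorem isFlatEquidim_lineRes (S : LC X) : IsFlatEquidim S.lineRes.hom 1 := by
  let e := S.isPullback_lineRes.isoIsPullback _ _
    (AffineSpace.isPullback_map (n := PUnit.{u+1}) S.ι.hom)
  have h : S.lineRes.hom = e.hom ≫ (𝔸(PUnit.{u+1}; S.red.sch) ↘ S.red.sch) :=
    (S.isPullback_lineRes.isoIsPullback_hom_snd _ _ _).symm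
  rw [h]
  exact (isFlatEquidim_affineLine S.red.sch).iso_comp e.hom

theorem incl_lineRes {S T : LC X} (h : S ≤ T) :
    incl (line_mono h) ≫ T.lineRes = S.lineRes ≫ incl h := by
  rw [← cancel_mono T.ι]
  simp [lineRes_ι]

theorem isPullback_line_incl {S T : LC X} (h : S ≤ T) :
    IsPullback (incl (line_mono h)).hom S.lineRes.hom T.lineRes.hom (incl h).hom := by
  refine .of_right (h₁₂ := T.line.ι.hom) (h₂₂ := T.ι.hom) (v₁₃ := X.lineProj.hom) ?_
    congr($(incl_lineRes h).hom) T.isPullback_lineRes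
  simpa using S.isPullback_lineRes

end LC

/-- `i` is a closed immersion and `j` is an open immersion onto the complement of its image. -/
structure IsClosedOpenPair {Z X U : AlgSch k} (i : Z ⟶ X) (j : U ⟶ X) : Prop where
  closed : IsClosedImmersion i.hom
  opn : IsOpenImmersion j.hom
  compl : Set.range j.hom = (Set.range i.hom)ᶜ

theorem IsClosedOpenPair.proper {Z X U : AlgSch k} {i : Z ⟶ X} {j : U ⟶ X}
    (h : IsClosedOpenPair i j) : IsProper i.hom := by
  have := h.closed
  infer_instance

theorem IsClosedOpenPair.etale {Z X U : AlgSch k} {i : Z ⟶ X} {j : U ⟶ X}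
    (h : IsClosedOpenPair i j) : Etale j.hom := by
  have := h.opn
  infer_instance

namespace LC

theorem isClosedImmersion_incl {S T : LC X} (h : S ≤ T) (hS : IsClosed (T.ι.hom ⁻¹' S.1)) :
    IsClosedImmersion (incl h).hom :=
  .of_isPreimmersion _ (by rwa [range_incl])

theorem isClosedOpenPair {C W T : LC X} (hC : C ≤ T) (hW : W.OpenIn T) (h : C.1 = T.1 \ W.1) :
    IsClosedOpenPair (incl hC) (incl hW.le) := by
  have h1 := hW.isOpenImmersion
  have h2 : T.ι.hom ⁻¹' C.1 = (T.ι.hom ⁻¹' W.1)ᶜ := by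
    ext t
    have : T.ι.hom t ∈ T.1 := by rw [← T.range_ι]; exact ⟨t, rfl⟩
    simp [h, this]
  refine ⟨isClosedImmersion_incl _ ?_, h1, ?_⟩
  · rw [h2, isClosed_compl_iff, ← range_incl hW.le]
    exact (incl hW.le).hom.isOpenEmbedding.isOpen_range
  · rw [range_incl, range_incl, h2, compl_compl]

theorem proper_incl {S T : LC X} (h : S ≤ T) (hS : IsClosed S.1) : IsProper (incl h).hom := by
  have := isClosedImmersion_incl h (hS.preimage T.ι.hom.continuous)
  infer_instance

end LC

/-- The closed subset `Z` has dimension at most `p` (the empty set has dimension `-∞`). -/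
def DimLE (Z : Set X.sch) (p : ℤ) : Prop :=
  ∀ n : ℕ, (n : WithBot ℕ∞) ≤ topologicalKrullDim Z → (n : ℤ) ≤ p

/-- The point `x` has dimension `p`, that is, its closure has dimension `p`. -/
def HasDim (x : X.sch) (p : ℤ) : Prop :=
  ∃ n : ℕ, (n : ℤ) = p ∧ topologicalKrullDim (closure {x} : Set X.sch) = n

theorem succ_le_dim {α : Type u} [TopologicalSpace α] {C Z : Set α} (hC : IsClosed C)
    (hZ : IsIrreducible Z) (h : C ⊆ Z) (hne : C ≠ Z) (n : ℕ)
    (hn : (n : WithBot ℕ∞) ≤ topologicalKrullDim C) :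
    ((n + 1 : ℕ) : WithBot ℕ∞) ≤ topologicalKrullDim Z := by
  obtain ⟨l, rfl⟩ := Order.le_krullDim_iff.mp hn
  have hi : Topology.IsInducing (Set.inclusion h) := (Topology.IsEmbedding.inclusion h).isInducing
  let l' := l.map _ (IrreducibleCloseds.map_strictMono_of_isInducing hi)
  have : IrreducibleSpace Z := isIrreducible_iff_irreducibleSpace.mp hZ
  let t : IrreducibleCloseds Z := ⟨Set.univ, IrreducibleSpace.isIrreducible_univ _, isClosed_univ⟩
  have hlt : l'.last < t := by
    refine lt_of_le_of_ne (fun x _ => Set.mem_univ x) fun he => hne ?_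
    refine h.antisymm fun x hx => ?_
    have h1 : (⟨x, hx⟩ : Z) ∈ (l'.last : Set Z) := by rw [he]; exact Set.mem_univ _
    have h2 : (l'.last : Set Z) ⊆ Subtype.val ⁻¹' C := by
      change closure _ ⊆ _
      refine closure_minimal ?_ (hC.preimage continuous_subtype_val)
      rintro _ ⟨c, -, rfl⟩
      exact c.2
    exact h2 h1
  exact Order.le_krullDim_iff.mpr ⟨l'.snoc t hlt, rfl⟩

theorem exists_nhd_of_hasDim {Z : Set X.sch} (hZ : IsClosed Z) {p : ℤ} (hp : DimLE Z p)
    {y : X.sch} (hy : y ∈ Z) (hyp : HasDim y p) :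
    ∃ U : Set X.sch, IsOpen U ∧ y ∈ U ∧ U ∩ Z ⊆ closure {y} := by
  have hyZ : closure {y} ⊆ Z := closure_minimal (by simpa using hy) hZ
  have key : ∀ K : Set X.sch, IsIrreducible K → K ⊆ Z → y ∈ K → IsClosed K → K = closure {y} := by
    intro K hK hKZ hyK hKc
    by_contra hne
    obtain ⟨n, hn, hdim⟩ := hyp
    have h1 := succ_le_dim isClosed_closure hK (closure_minimal (by simpa using hyK) hKc)
      (Ne.symm hne) n hdim.ge
    have h2 : topologicalKrullDim K ≤ topologicalKrullDim Z :=
      (Topology.IsEmbedding.inclusion hKZ).isInducing.topologicalKrullDim_le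
    have := hp _ (h1.trans h2)
    omega
  have hfin : (irreducibleComponents Z).Finite := NoetherianSpace.finite_irreducibleComponents
  let s : Set (Set Z) := {K ∈ irreducibleComponents Z | (⟨y, hy⟩ : Z) ∉ K}
  have hs : s.Finite := hfin.subset fun _ h => h.1
  refine ⟨(⋃ K ∈ s, Subtype.val '' K)ᶜ, ?_, ?_, ?_⟩
  · rw [isOpen_compl_iff]
    exact hs.isClosed_biUnion fun K hK =>
      hZ.isClosedEmbedding_subtypeVal.isClosedMap _ (isClosed_of_mem_irreducibleComponents K hK.1)
  · simp only [Set.mem_compl_iff, Set.mem_iUnion, not_exists]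
    rintro K hK ⟨z, hz, rfl⟩
    exact hK.2 hz
  · rintro z ⟨hz, hzZ⟩
    let K := irreducibleComponent (⟨z, hzZ⟩ : Z)
    have hK := irreducibleComponent_mem_irreducibleComponents (⟨z, hzZ⟩ : Z)
    have hzK : (⟨z, hzZ⟩ : Z) ∈ K := mem_irreducibleComponent
    by_cases hyK : (⟨y, hy⟩ : Z) ∈ K
    · rw [← key (Subtype.val '' K) (hK.1.image _ continuous_subtype_val.continuousOn)
        (by rintro _ ⟨w, -, rfl⟩; exact w.2) ⟨_, hyK, rfl⟩
        (hZ.isClosedEmbedding_subtypeVal.isClosedMap _ (isClosed_of_mem_irreducibleComponents K hK))]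
      exact ⟨_, hzK, rfl⟩
    · exact (hz (Set.mem_biUnion (show K ∈ s from ⟨hK, hyK⟩) ⟨_, hzK, rfl⟩)).elim

/-- The nonempty open subsets `W` of the closure of `x`, ordered by reverse inclusion. -/
structure Nbd (x : X.sch) where
  carrier : Set X.sch
  mem : x ∈ carrier
  exists_open : ∃ U : Set X.sch, IsOpen U ∧ carrier = U ∩ closure {x}

namespace Nbd

variable {x : X.sch}

/-- A neighbourhood of `x` in its closure, as a locally closed subset of `X`. -/
def lc (W : Nbd x) : LC X := ⟨W.carrier, by
  obtain ⟨U, hU, e⟩ := W.exists_open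
  rw [e]
  exact hU.isLocallyClosed.inter isClosed_closure.isLocallyClosed⟩

instance : Preorder (Nbd x) where
  le W W' := W'.carrier ⊆ W.carrier
  le_refl _ := subset_rfl
  le_trans _ _ _ h h' := h'.trans h

theorem subset_closure (W : Nbd x) : W.carrier ⊆ closure {x} := by
  obtain ⟨U, -, e⟩ := W.exists_open
  exact e.trans_subset Set.inter_subset_right

theorem openIn {W W' : Nbd x} (h : W ≤ W') : W'.lc.OpenIn W.lc := by
  obtain ⟨U, hU, e⟩ := W'.exists_open
  refine ⟨U, hU, Set.Subset.antisymm (fun z hz => ⟨?_, h hz⟩) ?_⟩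
  · change z ∈ W'.carrier at hz
    rw [e] at hz
    exact hz.1
  · rintro z ⟨hz, hz'⟩
    change z ∈ W'.carrier
    rw [e]
    exact ⟨hz, W.subset_closure hz'⟩

/-- The intersection of two neighbourhoods. -/
def inter (W W' : Nbd x) : Nbd x := ⟨W.carrier ∩ W'.carrier, ⟨W.mem, W'.mem⟩, by
  obtain ⟨U, hU, e⟩ := W.exists_open
  obtain ⟨U', hU', e'⟩ := W'.exists_open
  exact ⟨U ∩ U', hU.inter hU', by rw [e, e', ← Set.inter_inter_distrib_right]⟩⟩

theorem le_inter_left (W W' : Nbd x) : W ≤ W.inter W' := Set.inter_subset_left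
theorem le_inter_right (W W' : Nbd x) : W' ≤ W.inter W' := Set.inter_subset_right

instance : IsDirectedOrder (Nbd x) :=
  ⟨fun W W' => ⟨W.inter W', le_inter_left W W', le_inter_right W W'⟩⟩

instance : Nonempty (Nbd x) :=
  ⟨⟨closure {x}, _root_.subset_closure rfl, Set.univ, isOpen_univ, by simp⟩⟩

end Nbd

/-- The closure of a point, as a locally closed subset. -/
def cl (x : X.sch) : LC X := ⟨closure {x}, isClosed_closure.isLocallyClosed⟩

theorem Nbd.openIn_cl {x : X.sch} (W : Nbd x) : W.lc.OpenIn (cl x) := W.exists_open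

/-- `y` is the generic point of an irreducible component of `S`. -/
def LC.IsGen (S : LC X) (y : X.sch) : Prop := ∃ W : Nbd y, W.lc.OpenIn S

namespace LC

theorem IsGen.mem {S : LC X} {y : X.sch} (h : S.IsGen y) : y ∈ S.1 := by
  obtain ⟨W, hW⟩ := h
  exact hW.le W.mem

theorem IsGen.mono {S S' : LC X} {y : X.sch} (h : S'.IsGen y) (hS : S'.OpenIn S) : S.IsGen y := by
  obtain ⟨W, hW⟩ := h
  exact ⟨W, hW.trans hS⟩

theorem IsGen.restrict {S S' : LC X} {y : X.sch} (h : S.IsGen y) (hS : S'.OpenIn S)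
    (hy : y ∈ S'.1) : ∃ W : Nbd y, W.lc.OpenIn S' := by
  obtain ⟨W, hW⟩ := h
  obtain ⟨U, hU, e⟩ := id hS
  obtain ⟨V, hV, e'⟩ := W.exists_open
  have hWS : W.carrier ⊆ S.1 := hW.le
  have hyU : y ∈ U := (e ▸ hy : y ∈ U ∩ S.1).1
  let W' : Nbd y := ⟨U ∩ W.carrier, ⟨hyU, W.mem⟩, U ∩ V, hU.inter hV, by
    rw [e', Set.inter_assoc]⟩
  have h1 : W ≤ W' := Set.inter_subset_right
  refine ⟨W', ((Nbd.openIn h1).trans hW).of_le ?_ hS.le⟩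
  change U ∩ W.carrier ⊆ S'.1
  rw [e]
  exact Set.inter_subset_inter_right _ hWS

theorem finite_isGen (S : LC X) : {y | S.IsGen y}.Finite := by
  have h : ∀ y : {y | S.IsGen y}, ∃ U : Set X.sch, IsOpen U ∧ y.1 ∈ U ∧ U ∩ S.1 ⊆ closure {y.1} := by
    rintro ⟨y, W, U, hU, e⟩
    have hy : y ∈ U ∩ S.1 := e ▸ W.mem
    exact ⟨U, hU, hy.1, fun z hz => W.subset_closure (show z ∈ W.lc.1 from e ▸ hz)⟩
  choose U hU hyU hUS using h
  obtain ⟨t, ht⟩ := (NoetherianSpace.isCompact {y | S.IsGen y}).elim_finite_subcover U hU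
    fun y hy => Set.mem_iUnion.mpr ⟨⟨y, hy⟩, hyU ⟨y, hy⟩⟩
  refine (t.finite_toSet.image Subtype.val).subset fun y hy => ?_
  obtain ⟨y', hy', h⟩ := Set.mem_iUnion₂.mp (ht hy)
  have h1 : y ∈ closure {y'.1} := hUS y' ⟨h, IsGen.mem hy⟩
  have h2 : y'.1 ∈ U ⟨y, hy⟩ := by
    obtain ⟨z, hz, rfl⟩ := mem_closure_iff.mp h1 _ (hU ⟨y, hy⟩) (hyU ⟨y, hy⟩)
    exact hz
  have h3 : y'.1 ∈ closure {y} := hUS ⟨y, hy⟩ ⟨h2, IsGen.mem y'.2⟩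
  have h4 : y'.1 = y :=
    ((specializes_iff_mem_closure.mpr h1).antisymm (specializes_iff_mem_closure.mpr h3)).eq
  exact ⟨y', hy', h4⟩

theorem isGen_of_hasDim {Z : LC X} (hZ : IsClosed Z.1) {p : ℤ} (hp : DimLE Z.1 p) {y : X.sch}
    (hy : y ∈ Z.1) (hyp : HasDim y p) : Z.IsGen y := by
  obtain ⟨U, hU, hyU, h⟩ := exists_nhd_of_hasDim hZ hp hy hyp
  have hyZ : closure {y} ⊆ Z.1 := closure_minimal (by simpa using hy) hZ
  refine ⟨⟨U ∩ closure {y}, ⟨hyU, subset_closure rfl⟩, U, hU, rfl⟩, U, hU, ?_⟩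
  exact Set.Subset.antisymm (Set.inter_subset_inter_right _ hyZ) fun z hz => ⟨hz.1, h hz⟩

end LC

/-- The closed subsets of `X` of dimension at most `p`, ordered by inclusion. -/
def ClosedLE (X : AlgSch k) (p : ℤ) : Type u := {Z : LC X // IsClosed Z.1 ∧ DimLE Z.1 p}

instance (p : ℤ) : PartialOrder (ClosedLE X p) :=
  inferInstanceAs (PartialOrder {Z : LC X // IsClosed Z.1 ∧ DimLE Z.1 p})

/-- The complement of an open neighbourhood of `x` in the closure of `x`, for `x` of
dimension `p + 1`. -/
def Nbd.compl {x : X.sch} {p p' : ℤ} (hp : p = p' + 1) (hx : HasDim x p) (W : Nbd x) :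
    ClosedLE X p' :=
  ⟨(cl x).diff W.lc W.openIn_cl, by
    obtain ⟨U, hU, e⟩ := W.exists_open
    have : (closure {x} \ W.carrier : Set X.sch) = closure {x} ∩ Uᶜ := by
      ext z; simp only [e, Set.mem_sdiff, Set.mem_inter_iff, Set.mem_compl_iff]; tauto
    change IsClosed (closure {x} \ W.carrier)
    rw [this]
    exact isClosed_closure.inter hU.isClosed_compl, by
    have hc : IsClosed (closure {x} \ W.carrier) := by
      obtain ⟨U, hU, e⟩ := W.exists_open
      have : (closure {x} \ W.carrier : Set X.sch) = closure {x} ∩ Uᶜ := by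
        ext z; simp only [e, Set.mem_sdiff, Set.mem_inter_iff, Set.mem_compl_iff]; tauto
      rw [this]
      exact isClosed_closure.inter hU.isClosed_compl
    intro n hn
    obtain ⟨m, hm, hdim⟩ := hx
    have h1 := succ_le_dim hc isIrreducible_singleton.closure Set.sdiff_subset
      (fun h => (h.symm.subset (_root_.subset_closure rfl : x ∈ closure {x})).2 W.mem) n hn
    rw [hdim] at h1
    have h2 : n + 1 ≤ m := by exact_mod_cast h1
    omega⟩

end AlgSch

open AlgSch

/-- The pairs `Y ⊂ X` consisting of an algebraic `k`-scheme and a closed subscheme. -/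
structure ClosedPair (k : Type u) [Field k] where
  Y : AlgSch k
  X : AlgSch k
  ι : Y ⟶ X
  closed : IsClosedImmersion ι.hom

namespace ClosedPair

/-- A morphism of pairs is a cartesian square. -/
@[ext]
structure Hom (P Q : ClosedPair k) where
  left : P.Y ⟶ Q.Y
  right : P.X ⟶ Q.X
  isPullback : IsPullback left.hom P.ι.hom Q.ι.hom right.hom

instance : Category (ClosedPair k) where
  Hom := Hom
  id P := ⟨𝟙 _, 𝟙 _, by
    simp only [id_hom]
    exact IsPullback.of_horiz_isIso ⟨by simp⟩⟩
  comp φ ψ := ⟨φ.left ≫ ψ.left, φ.right ≫ ψ.right, φ.isPullback.paste_horiz ψ.isPullback⟩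
  id_comp _ := Hom.ext (Category.id_comp _) (Category.id_comp _)
  comp_id _ := Hom.ext (Category.comp_id _) (Category.comp_id _)
  assoc _ _ _ := Hom.ext (Category.assoc _ _ _) (Category.assoc _ _ _)

/-- The pair `X ⊂ X`. -/
def self (X : AlgSch k) : ClosedPair k := ⟨X, X, 𝟙 X, by rw [id_hom]; infer_instance⟩

/-- The morphism of pairs `(X' ⊂ X') ⟶ (X ⊂ X)` given by a morphism `X' ⟶ X`. -/
def selfMap {X' X : AlgSch k} (f : X' ⟶ X) : self X' ⟶ self X :=
  Hom.mk f f (by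
    simp only [self, id_hom]
    exact IsPullback.of_vert_isIso ⟨by simp⟩)

end ClosedPair

/-- Closed subschemes `Z ⊂ Y ⊂ X`. -/
structure ClosedTriple (k : Type u) [Field k] where
  Z : AlgSch k
  Y : AlgSch k
  X : AlgSch k
  z : Z ⟶ Y
  y : Y ⟶ X
  closed_z : IsClosedImmersion z.hom
  closed_y : IsClosedImmersion y.hom

namespace ClosedTriple

/-- The pair `Z ⊂ X`. -/
def small (T : ClosedTriple k) : ClosedPair k :=
  ⟨T.Z, T.X, T.z ≫ T.y, by
    have := T.closed_z
    have := T.closed_y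
    rw [comp_hom]
    infer_instance⟩

/-- The pair `Y ⊂ X`. -/
def big (T : ClosedTriple k) : ClosedPair k := ⟨T.Y, T.X, T.y, T.closed_y⟩

/-- `φ` exhibits `P` as the pair `Y ∖ Z ⊂ X ∖ Z`. -/
structure IsCompl (T : ClosedTriple k) {P : ClosedPair k} (φ : P ⟶ T.big) : Prop where
  opn : IsOpenImmersion φ.right.hom
  compl : Set.range φ.right.hom = (Set.range (T.z ≫ T.y).hom)ᶜ

end ClosedTriple

/-- A twisted cohomology theory with supports on algebraic `k`-schemes; `H P i j` is
`H^i_Y(X, j)` for `P` the pair `Y ⊂ X`. -/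
structure TwistedCohomologyTheory (k : Type u) [Field k] where
  H : ClosedPair k → ℤ → ℤ → Type v
  [addCommGroup : ∀ P i j, AddCommGroup (H P i j)]
  map {P Q : ClosedPair k} (φ : P ⟶ Q) (i j : ℤ) : H Q i j →+ H P i j
  map_id (P : ClosedPair k) (i j : ℤ) (x : H P i j) : map (𝟙 P) i j x = x
  map_comp {P Q R : ClosedPair k} (φ : P ⟶ Q) (ψ : Q ⟶ R) (i j : ℤ) (x : H R i j) :
    map (φ ≫ ψ) i j x = map φ i j (map ψ i j x)
  /-- The map `H^i_Z(X, j) → H^i_Y(X, j)`. -/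
  supp (T : ClosedTriple k) (i j : ℤ) : H T.small i j →+ H T.big i j
  /-- The connecting map `H^i_{Y ∖ Z}(X ∖ Z, j) → H^{i+1}_Z(X, j)`. -/
  δ (T : ClosedTriple k) {P : ClosedPair k} (φ : P ⟶ T.big) (hφ : T.IsCompl φ)
    (i i' j : ℤ) (hi : i' = i + 1) : H P i j →+ H T.small i' j
  exact_supp_map (T : ClosedTriple k) {P : ClosedPair k} (φ : P ⟶ T.big) (_ : T.IsCompl φ)
    (i j : ℤ) : Function.Exact (supp T i j) (map φ i j)
  exact_map_δ (T : ClosedTriple k) {P : ClosedPair k} (φ : P ⟶ T.big) (hφ : T.IsCompl φ)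
    (i i' j : ℤ) (hi : i' = i + 1) : Function.Exact (map φ i j) (δ T φ hφ i i' j hi)
  exact_δ_supp (T : ClosedTriple k) {P : ClosedPair k} (φ : P ⟶ T.big) (hφ : T.IsCompl φ)
    (i i' j : ℤ) (hi : i' = i + 1) : Function.Exact (δ T φ hφ i i' j hi) (supp T i' j)
  supp_natural {T' T : ClosedTriple k} (σ : T'.small ⟶ T.small) (β : T'.big ⟶ T.big)
    (_ : σ.right = β.right) (i j : ℤ) (x : H T.small i j) :
    map β i j (supp T i j x) = supp T' i j (map σ i j x)
  δ_natural {T' T : ClosedTriple k} (σ : T'.small ⟶ T.small) (β : T'.big ⟶ T.big)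
    (_ : σ.right = β.right) {P' P : ClosedPair k} (φ' : P' ⟶ T'.big) (hφ' : T'.IsCompl φ')
    (φ : P ⟶ T.big) (hφ : T.IsCompl φ) (ψ : P' ⟶ P) (_ : φ' ≫ β = ψ ≫ φ)
    (i i' j : ℤ) (hi : i' = i + 1) (x : H P i j) :
    map σ i' j (δ T φ hφ i i' j hi x) = δ T' φ' hφ' i i' j hi (map ψ i j x)
  /-- Excision: `φ` is the inclusion of `Z ⊂ U` into `Z ⊂ X` for `U` open in `X`. -/
  excision {P Q : ClosedPair k} (φ : P ⟶ Q) (_ : IsOpenImmersion φ.right.hom)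
    (_ : IsIso φ.left.hom) (i j : ℤ) : Function.Bijective (map φ i j)

attribute [instance] TwistedCohomologyTheory.addCommGroup

/-- A twisted homology theory on algebraic `k`-schemes; `H X a b` is `H_a(X, b)`. -/
structure TwistedHomologyTheory (k : Type u) [Field k] where
  H : AlgSch k → ℤ → ℤ → Type v
  [addCommGroup : ∀ X a b, AddCommGroup (H X a b)]
  /-- Push-forward along proper morphisms. -/
  push {X Y : AlgSch k} (f : X ⟶ Y) (hf : IsProper f.hom) (a b : ℤ) : H X a b →+ H Y a b
  push_id (X : AlgSch k) (h : IsProper (Hom.hom (𝟙 X))) (a b : ℤ) (x : H X a b) :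
    push (𝟙 X) h a b x = x
  push_comp {X Y Z : AlgSch k} (f : X ⟶ Y) (g : Y ⟶ Z) (hf : IsProper f.hom)
    (hg : IsProper g.hom) (hfg : IsProper (f ≫ g).hom) (a b : ℤ) (x : H X a b) :
    push (f ≫ g) hfg a b x = push g hg a b (push f hf a b x)
  /-- Pull-back along étale morphisms. -/
  pull {X' X : AlgSch k} (α : X' ⟶ X) (hα : Etale α.hom) (a b : ℤ) : H X a b →+ H X' a b
  pull_comp {X'' X' X : AlgSch k} (α' : X'' ⟶ X') (α : X' ⟶ X) (hα' : Etale α'.hom)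
    (hα : Etale α.hom) (h : Etale (α' ≫ α).hom) (a b : ℤ) (x : H X a b) :
    pull (α' ≫ α) h a b x = pull α' hα' a b (pull α hα a b x)
  pull_push {X' X Y' Y : AlgSch k} (β : X' ⟶ X) (g : X' ⟶ Y') (f : X ⟶ Y) (α : Y' ⟶ Y)
    (_ : IsPullback β.hom g.hom f.hom α.hom) (hf : IsProper f.hom) (hg : IsProper g.hom)
    (hα : Etale α.hom) (hβ : Etale β.hom) (a b : ℤ) (x : H X a b) :
    pull α hα a b (push f hf a b x) = push g hg a b (pull β hβ a b x)
  /-- The boundary map `H_a(X ∖ Z, b) → H_{a-1}(Z, b)`. -/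
  bdry {Z X U : AlgSch k} (i : Z ⟶ X) (j : U ⟶ X) (h : IsClosedOpenPair i j)
    (a a' b : ℤ) (ha : a = a' + 1) : H U a b →+ H Z a' b
  exact_push_pull {Z X U : AlgSch k} (i : Z ⟶ X) (j : U ⟶ X) (h : IsClosedOpenPair i j)
    (a b : ℤ) : Function.Exact (push i h.proper a b) (pull j h.etale a b)
  exact_pull_bdry {Z X U : AlgSch k} (i : Z ⟶ X) (j : U ⟶ X) (h : IsClosedOpenPair i j)
    (a a' b : ℤ) (ha : a = a' + 1) :
    Function.Exact (pull j h.etale a b) (bdry i j h a a' b ha)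
  exact_bdry_push {Z X U : AlgSch k} (i : Z ⟶ X) (j : U ⟶ X) (h : IsClosedOpenPair i j)
    (a a' b : ℤ) (ha : a = a' + 1) :
    Function.Exact (bdry i j h a a' b ha) (push i h.proper a' b)
  /-- Compatibility of the boundary with proper push-forward: here `f : X' ⟶ X` maps the closed
  subscheme `Z'` to `Z`, `U'` and `U` are the complements, and `W` is the preimage of `U`. -/
  bdry_push {Z' X' U' Z X U W : AlgSch k} (i' : Z' ⟶ X') (j' : U' ⟶ X')
    (h' : IsClosedOpenPair i' j') (i : Z ⟶ X) (j : U ⟶ X) (h : IsClosedOpenPair i j)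
    (f : X' ⟶ X) (_ : IsProper f.hom) (f' : Z' ⟶ Z) (hf' : IsProper f'.hom)
    (_ : f' ≫ i = i' ≫ f) (α : W ⟶ U') (hα : Etale α.hom) (g : W ⟶ U) (hg : IsProper g.hom)
    (_ : IsPullback (α ≫ j').hom g.hom f.hom j.hom)
    (a a' b : ℤ) (ha : a = a' + 1) (x : H U' a b) :
    bdry i j h a a' b ha (push g hg a b (pull α hα a b x)) =
      push f' hf' a' b (bdry i' j' h' a a' b ha x)
  /-- Compatibility of the boundary with étale pull-back. -/
  bdry_pull {Z' X' U' Z X U : AlgSch k} (i' : Z' ⟶ X') (j' : U' ⟶ X')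
    (h' : IsClosedOpenPair i' j') (i : Z ⟶ X) (j : U ⟶ X) (h : IsClosedOpenPair i j)
    (α : X' ⟶ X) (_ : Etale α.hom) (αZ : Z' ⟶ Z) (hαZ : Etale αZ.hom) (αU : U' ⟶ U)
    (hαU : Etale αU.hom) (_ : IsPullback i'.hom αZ.hom α.hom i.hom)
    (_ : IsPullback j'.hom αU.hom α.hom j.hom)
    (a a' b : ℤ) (ha : a = a' + 1) (x : H U a b) :
    bdry i' j' h' a a' b ha (pull αU hαU a b x) = pull αZ hαZ a' b (bdry i j h a a' b ha x)

attribute [instance] TwistedHomologyTheory.addCommGroup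

namespace TwistedHomologyTheory

attribute [local instance] Classical.propDecidable

variable (T : TwistedHomologyTheory.{u, v} k) {X : AlgSch k}

theorem pull_congr {X' X : AlgSch k} {f g : X' ⟶ X} (h : f = g) (hf : Etale f.hom)
    (hg : Etale g.hom) (a b : ℤ) (x : T.H X a b) : T.pull f hf a b x = T.pull g hg a b x := by
  subst h
  rfl

/-- Restriction of homology classes to an open subset. -/
noncomputable def res {S S' : LC X} (h : S'.OpenIn S) (a b : ℤ) :
    T.H S.red a b →+ T.H S'.red a b := T.pull (LC.incl h.le) h.etale a b

theorem res_res {S S' S'' : LC X} (h : S'.OpenIn S) (h' : S''.OpenIn S') (h'' : S''.OpenIn S)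
    (a b : ℤ) (x : T.H S.red a b) : T.res h' a b (T.res h a b x) = T.res h'' a b x := by
  have e : LC.incl h'.le ≫ LC.incl h.le = LC.incl h''.le := LC.incl_comp _ _
  exact (T.pull_comp _ _ h'.etale h.etale (e ▸ h''.etale) a b x).symm.trans
    (T.pull_congr e _ _ a b x)

/-- Push-forward along the inclusion of a closed subset into a locally closed one. -/
noncomputable def pushIncl {S S' : LC X} (h : S ≤ S') (hS : IsClosed S.1) (a b : ℤ) :
    T.H S.red a b →+ T.H S'.red a b := T.push (LC.incl h) (LC.proper_incl h hS) a b

/-- `H_a(x, b)`, the direct limit of `H_a(W, b)` over the nonempty open subsets `W` of the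
closure of `x`. -/
def Hpt (x : X.sch) (a b : ℤ) : Type (max u v) :=
  AddCommGroup.DirectLimit (fun W : Nbd x => T.H W.lc.red a b)
    fun _ _ h => T.res (Nbd.openIn h) a b

noncomputable instance (x : X.sch) (a b : ℤ) : AddCommGroup (T.Hpt x a b) :=
  AddCommGroup.DirectLimit.addCommGroup _ _

/-- The map from `H_a(W, b)` to the direct limit. -/
noncomputable def ofNbd {x : X.sch} (W : Nbd x) (a b : ℤ) : T.H W.lc.red a b →+ T.Hpt x a b :=
  AddCommGroup.DirectLimit.of (fun W : Nbd x => T.H W.lc.red a b)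
    (fun _ _ h => T.res (Nbd.openIn h) a b) W

theorem ofNbd_res {x : X.sch} {W W' : Nbd x} (h : W ≤ W') (a b : ℤ) (z : T.H W.lc.red a b) :
    T.ofNbd W' a b (T.res (Nbd.openIn h) a b z) = T.ofNbd W a b z :=
  AddCommGroup.DirectLimit.of_f (f := fun (_ _ : Nbd x) h => T.res (Nbd.openIn h) a b) h z

/-- The map from `H_a(S, b)` to `H_a(y, b)` for a generic point `y` of `S` (and zero for all other
points `y`). -/
noncomputable def germ (S : LC X) (y : X.sch) (a b : ℤ) : T.H S.red a b →+ T.Hpt y a b :=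
  if h : S.IsGen y then (T.ofNbd h.choose a b).comp (T.res h.choose_spec a b) else 0

theorem germ_eq {S : LC X} {y : X.sch} {W : Nbd y} (hW : W.lc.OpenIn S) (a b : ℤ)
    (z : T.H S.red a b) : T.germ S y a b z = T.ofNbd W a b (T.res hW a b z) := by
  have h : S.IsGen y := ⟨W, hW⟩
  have h1 := Nbd.le_inter_left h.choose W
  have h2 := Nbd.le_inter_right h.choose W
  rw [germ, dif_pos h]
  simp only [AddMonoidHom.comp_apply]
  rw [← T.ofNbd_res h1, ← T.ofNbd_res h2, T.res_res _ _ ((Nbd.openIn h2).trans hW),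
    T.res_res _ _ ((Nbd.openIn h2).trans hW)]

theorem germ_res {S S' : LC X} (h : S'.OpenIn S) {y : X.sch} (hy : y ∈ S'.1) (a b : ℤ)
    (z : T.H S.red a b) : T.germ S' y a b (T.res h a b z) = T.germ S y a b z := by
  by_cases hS : S.IsGen y
  · obtain ⟨W, hW⟩ := hS.restrict h hy
    rw [T.germ_eq hW, T.germ_eq (hW.trans h), T.res_res]
  · rw [germ, germ, dif_neg hS, dif_neg fun h' => hS (h'.mono h)]
    rfl

theorem germ_pushIncl {Z Z' : LC X} (h : Z ≤ Z') (hZ : IsClosed Z.1) {y : X.sch} (hy : Z.IsGen y)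
    (hy' : Z'.IsGen y) (a b : ℤ) (z : T.H Z.red a b) :
    T.germ Z' y a b (T.pushIncl h hZ a b z) = T.germ Z y a b z := by
  obtain ⟨W₁, h₁⟩ := hy
  obtain ⟨W₂, h₂⟩ := hy'
  have hW := (Nbd.openIn (Nbd.le_inter_left W₁ W₂)).trans h₁
  have hW' := (Nbd.openIn (Nbd.le_inter_right W₁ W₂)).trans h₂
  rw [T.germ_eq hW, T.germ_eq hW']
  congr 1
  have := T.pull_push _ _ _ _ (LC.isPullback_incl h hW' hW.le le_rfl fun _ hx => hx.2)
    (LC.proper_incl h hZ) (by rw [LC.incl_refl, id_hom]; infer_instance) hW'.etale hW.etale a b z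
  refine this.trans ?_
  simp only [LC.incl_refl]
  rw [T.push_id]
  rfl

theorem germ_pushIncl_of_notMem {Z Z' : LC X} (h : Z ≤ Z') (hZ : IsClosed Z.1) {y : X.sch}
    (hy : y ∉ Z.1) (a b : ℤ) (z : T.H Z.red a b) :
    T.germ Z' y a b (T.pushIncl h hZ a b z) = 0 := by
  by_cases hy' : y ∈ Z'.1
  · let D : LC X := ⟨Z'.1 \ Z.1, by
      rw [Set.sdiff_eq]
      exact Z'.2.inter hZ.isOpen_compl.isLocallyClosed⟩
    have hD : D.OpenIn Z' := ⟨Z.1ᶜ, hZ.isOpen_compl, by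
      rw [Set.inter_comm, ← Set.sdiff_eq]⟩
    have hp : IsClosedOpenPair (LC.incl h) (LC.incl hD.le) :=
      LC.isClosedOpenPair h hD (by
        change Z.1 = Z'.1 \ (Z'.1 \ Z.1)
        rw [Set.sdiff_sdiff_cancel_left h])
    rw [← T.germ_res hD ⟨hy', hy⟩]
    have : T.res hD a b (T.pushIncl h hZ a b z) = 0 :=
      (T.exact_push_pull _ _ hp a b).apply_apply_eq_zero z
    rw [this, map_zero]
  · rw [germ, dif_neg fun h' => hy' h'.mem]
    rfl

variable (X) in
/-- The direct sum of the groups `H_a(x, b)` over the points `x` of dimension `p`. -/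
abbrev PtSum (p a b : ℤ) : Type (max u v) :=
  DirectSum {x : X.sch // HasDim x p} fun x => T.Hpt x.1 a b

/-- The generic points of dimension `p` of `S`. -/
noncomputable def gens (S : LC X) (p : ℤ) : Finset {x : X.sch // HasDim x p} :=
  (S.finite_isGen.preimage (Subtype.val_injective.injOn)).toFinset

theorem mem_gens {S : LC X} {p : ℤ} {y : {x : X.sch // HasDim x p}} :
    y ∈ gens S p ↔ S.IsGen y.1 := by
  simp [gens]

/-- The map from `H_a(S, b)` to the sum of the groups `H_a(y, b)` over the generic points `y` of
dimension `p` of `S`. -/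
noncomputable def genGerms (S : LC X) (p a b : ℤ) : T.H S.red a b →+ T.PtSum X p a b :=
  ∑ y ∈ gens S p, (DirectSum.of (fun x : {x : X.sch // HasDim x p} => T.Hpt x.1 a b) y).comp
    (T.germ S y.1 a b)

theorem genGerms_apply (S : LC X) (p a b : ℤ) (z : T.H S.red a b) :
    T.genGerms S p a b z = ∑ y ∈ gens S p,
      DirectSum.of (fun x : {x : X.sch // HasDim x p} => T.Hpt x.1 a b) y (T.germ S y.1 a b z) := by
  simp [genGerms, AddMonoidHom.finsetSum_apply]

theorem genGerms_res {S S' : LC X} (h : S'.OpenIn S) (hg : ∀ y, S.IsGen y → y ∈ S'.1) (p a b : ℤ)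
    (z : T.H S.red a b) : T.genGerms S' p a b (T.res h a b z) = T.genGerms S p a b z := by
  have : gens S' p = gens S p := by
    ext y
    rw [mem_gens, mem_gens]
    exact ⟨fun hy => hy.mono h, fun hy => hy.restrict h (hg _ hy)⟩
  rw [genGerms_apply, genGerms_apply, this]
  refine Finset.sum_congr rfl fun y hy => ?_
  rw [T.germ_res h (hg _ (mem_gens.mp hy))]

theorem genGerms_pushIncl {p : ℤ} {Z Z' : ClosedLE X p} (h : Z ≤ Z') (a b : ℤ)
    (z : T.H Z.1.red a b) :
    T.genGerms Z'.1 p a b (T.pushIncl h Z.2.1 a b z) = T.genGerms Z.1 p a b z := by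
  rw [genGerms_apply, genGerms_apply]
  symm
  have hle : Z.1.1 ⊆ Z'.1.1 := h
  have hg : ∀ y : {x : X.sch // HasDim x p}, y ∈ gens Z.1 p → y ∈ gens Z'.1 p := fun y hy =>
    mem_gens.mpr (LC.isGen_of_hasDim Z'.2.1 Z'.2.2 (hle (mem_gens.mp hy).mem) y.2)
  refine Finset.sum_subset_zero_on_sdiff hg ?_ ?_
  · intro y hy
    rw [Finset.mem_sdiff, mem_gens, mem_gens] at hy
    rw [T.germ_pushIncl_of_notMem h Z.2.1 fun hyZ =>
      hy.2 (LC.isGen_of_hasDim Z.2.1 Z.2.2 hyZ y.2), map_zero]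
  · intro y hy
    rw [T.germ_pushIncl h Z.2.1 (mem_gens.mp hy) (mem_gens.mp (hg y hy))]

variable (X) in
/-- `H_a(Z_p(X), b)`, the direct limit of `H_a(Z, b)` over the closed subsets `Z` of dimension at
most `p`. -/
def HZ (p a b : ℤ) : Type (max u v) :=
  AddCommGroup.DirectLimit (fun Z : ClosedLE X p => T.H Z.1.red a b)
    fun Z _ h => T.pushIncl h Z.2.1 a b

noncomputable instance (p a b : ℤ) : AddCommGroup (T.HZ X p a b) :=
  AddCommGroup.DirectLimit.addCommGroup _ _

/-- The map from `H_a(Z, b)` to the direct limit. -/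
noncomputable def ofClosed {p : ℤ} (Z : ClosedLE X p) (a b : ℤ) :
    T.H Z.1.red a b →+ T.HZ X p a b :=
  AddCommGroup.DirectLimit.of (fun Z : ClosedLE X p => T.H Z.1.red a b)
    (fun Z _ h => T.pushIncl h Z.2.1 a b) Z

theorem ofClosed_pushIncl {p : ℤ} {Z Z' : ClosedLE X p} (h : Z ≤ Z') (a b : ℤ)
    (z : T.H Z.1.red a b) :
    T.ofClosed Z' a b (T.pushIncl h Z.2.1 a b z) = T.ofClosed Z a b z :=
  AddCommGroup.DirectLimit.of_f (f := fun (Z _ : ClosedLE X p) h => T.pushIncl h Z.2.1 a b) h z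

variable (X) in
/-- The map from `H_a(Z_p(X), b)` to the sum of the groups `H_a(x, b)` over the points `x` of
dimension `p`. -/
noncomputable def toPts (p a b : ℤ) : T.HZ X p a b →+ T.PtSum X p a b :=
  AddCommGroup.DirectLimit.lift _ _ _ (fun Z => T.genGerms Z.1 p a b)
    fun _ _ h z => T.genGerms_pushIncl h a b z

theorem pair_compl {x : X.sch} {p p' : ℤ} (hp : p = p' + 1) (hx : HasDim x p) (W : Nbd x) :
    IsClosedOpenPair (LC.incl ((cl x).diff_le W.lc W.openIn_cl) :
      (W.compl hp hx).1.red ⟶ (cl x).red) (LC.incl W.openIn_cl.le) :=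
  LC.isClosedOpenPair _ W.openIn_cl rfl

/-- The boundary map `H_a(W, b) → H_{a-1}(Z, b)`, where `Z` is the complement of `W` in the closure
of `x`. -/
noncomputable def nbdBdry {x : X.sch} {p p' : ℤ} (hp : p = p' + 1) (hx : HasDim x p) (W : Nbd x)
    (a a' b : ℤ) (ha : a = a' + 1) : T.H W.lc.red a b →+ T.H (W.compl hp hx).1.red a' b :=
  T.bdry _ _ (pair_compl hp hx W) a a' b ha

theorem nbdBdry_res {x : X.sch} {p p' : ℤ} (hp : p = p' + 1) (hx : HasDim x p) {W W' : Nbd x}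
    (h : W ≤ W') (h' : W.compl hp hx ≤ W'.compl hp hx)
    (a a' b : ℤ) (ha : a = a' + 1) (z : T.H W.lc.red a b) :
    T.nbdBdry hp hx W' a a' b ha (T.res (Nbd.openIn h) a b z) =
      T.pushIncl h' (W.compl hp hx).2.1 a' b (T.nbdBdry hp hx W a a' b ha z) := by
  have hid : ∀ Y : AlgSch k, IsProper (Hom.hom (𝟙 Y)) := fun Y => by
    rw [id_hom]; infer_instance
  have := T.bdry_push _ _ (pair_compl hp hx W) _ _ (pair_compl hp hx W') (𝟙 (cl x).red) (hid _)
    (LC.incl h') (LC.proper_incl _ (W.compl hp hx).2.1) (by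
      rw [Category.comp_id]
      exact LC.incl_comp _ _) (LC.incl (Nbd.openIn h).le) (Nbd.openIn h).etale (𝟙 _) (hid _) (by
      rw [LC.incl_comp, id_hom, id_hom]
      exact IsPullback.of_vert_isIso ⟨by simp⟩) a a' b ha z
  rw [T.push_id] at this
  exact this

variable (X) in
/-- The map from the sum of the groups `H_a(x, b)` over the points `x` of dimension `p` to
`H_{a-1}(Z_{p-1}(X), b)`. -/
noncomputable def fromPts (p p' a a' b : ℤ) (hp : p = p' + 1) (ha : a = a' + 1) :
    T.PtSum X p a b →+ T.HZ X p' a' b :=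
  DirectSum.toAddMonoid fun x => AddCommGroup.DirectLimit.lift _ _ _
    (fun W => (T.ofClosed (W.compl hp x.2) a' b).comp (T.nbdBdry hp x.2 W a a' b ha))
    fun W W' h z => by
      have h' : W.compl hp x.2 ≤ W'.compl hp x.2 := Set.sdiff_subset_sdiff_right h
      simp only [AddMonoidHom.comp_apply]
      rw [T.nbdBdry_res hp x.2 h h', T.ofClosed_pushIncl]

variable (X) in
/-- The term `E^1_{p,q}(X, b)` of the niveau spectral sequence. -/
abbrev E1 (p q b : ℤ) : Type (max u v) := T.PtSum X p (p + q) b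

variable (X) in
/-- The differential `E^1_{p,q}(X, b) → E^1_{p-1,q}(X, b)`. -/
noncomputable def d1 (p p' q b : ℤ) (hp : p = p' + 1) : T.E1 X p q b →+ T.E1 X p' q b :=
  (T.toPts X p' (p' + q) b).comp (T.fromPts X p p' (p + q) (p' + q) b hp (by omega))

variable (X) in
/-- The boundaries in `E^1_{p,q}(X, b)`, as a subgroup of the cycles. -/
noncomputable def boundaries (p q b : ℤ) :
    AddSubgroup (T.d1 X p (p - 1) q b (sub_add_cancel p 1).symm).ker :=
  (T.d1 X (p + 1) p q b rfl).range.addSubgroupOf _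

variable (X) in
/-- The term `E^2_{p,q}(X, b)` of the niveau spectral sequence, the homology of `d^1`. -/
abbrev E2 (p q b : ℤ) : Type (max u v) :=
  (T.d1 X p (p - 1) q b (sub_add_cancel p 1).symm).ker ⧸ T.boundaries X p q b

end TwistedHomologyTheory

/-- Every irreducible component of `X` has dimension `d`. -/
def AlgSch.IsPureDim (X : AlgSch k) (d : ℕ) : Prop :=
  ∀ C ∈ irreducibleComponents X.sch, topologicalKrullDim C = d

/-- `i` is the closed immersion of an effective Cartier divisor with a global equation: its ideal
sheaf is generated by a global function which is everywhere a non-zero-divisor. -/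
def IsPrincipalDivisor {W X : AlgSch k} (i : W ⟶ X) : Prop :=
  IsClosedImmersion i.hom ∧ ∃ f : Γ(X.sch, ⊤), ∀ U : X.sch.affineOpens,
    X.sch.presheaf.map (homOfLE le_top : U.1 ⟶ ⊤).op f ∈ nonZeroDivisors Γ(X.sch, U) ∧
    i.hom.ker.ideal U = Ideal.span {X.sch.presheaf.map (homOfLE le_top : U.1 ⟶ ⊤).op f}

/-- The cohomology of smooth schemes is homotopy invariant; `H^i(X, j)` is the cohomology with
supports in `X` itself. -/
def TwistedCohomologyTheory.HomotopyInvariant (C : TwistedCohomologyTheory.{u, v} k) : Prop :=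
  ∀ X : AlgSch k, Smooth X.str → ∀ i j : ℤ,
    Function.Bijective (C.map (ClosedPair.selfMap X.lineProj) i j)

namespace TwistedHomologyTheory

/-- A family of classes `eta X d` in `H_{2d}(X, d)`, for irreducible `X` of dimension `d`. -/
abbrev ClassFamily (T : TwistedHomologyTheory.{u, v} k) : Type (max (u + 1) v) :=
  ∀ (X : AlgSch k) (d : ℕ), IrreducibleSpace X.sch → topologicalKrullDim X.sch = d →
    T.H X (2 * d) d

/-- `η` restricts to the given class on every irreducible open subscheme of dimension `d`; on a
smooth scheme of pure dimension `d` this says that `η` is the sum of the fundamental classes of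
the connected components. -/
def IsFundamentalClass (T : TwistedHomologyTheory.{u, v} k) (eta : T.ClassFamily)
    (X : AlgSch k) (d : ℕ) (η : T.H X (2 * d) d) : Prop :=
  ∀ (V : AlgSch k) (α : V ⟶ X) (_ : IsOpenImmersion α.hom) (hα : Etale α.hom)
    (hV : IrreducibleSpace V.sch) (hd : topologicalKrullDim V.sch = d),
    T.pull α hα (2 * d) d η = eta V d hV hd

end TwistedHomologyTheory

/-- A twisted Poincaré duality theory on algebraic `k`-schemes. -/
structure TwistedPoincareDuality (k : Type u) [Field k] where
  coh : TwistedCohomologyTheory.{u, v} k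
  hom : TwistedHomologyTheory.{u, v} k
  /-- The cap product of `H_a(X, b)` and `H^i_Y(X, j)` into `H_{a-i}(Y, b-j)`. -/
  cap (P : ClosedPair k) (a b i j a' b' : ℤ) (ha : a' = a - i) (hb : b' = b - j) :
    hom.H P.X a b →+ coh.H P i j →+ hom.H P.Y a' b'
  cap_pull {P' P : ClosedPair k} (φ : P' ⟶ P) (hX : Etale φ.right.hom) (hY : Etale φ.left.hom)
    (a b i j a' b' : ℤ) (ha : a' = a - i) (hb : b' = b - j) (x : hom.H P.X a b)
    (y : coh.H P i j) :
    cap P' a b i j a' b' ha hb (hom.pull φ.right hX a b x) (coh.map φ i j y) =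
      hom.pull φ.left hY a' b' (cap P a b i j a' b' ha hb x y)
  /-- The projection formula. -/
  cap_push {P' P : ClosedPair k} (φ : P' ⟶ P) (hX : IsProper φ.right.hom)
    (hY : IsProper φ.left.hom) (a b i j a' b' : ℤ) (ha : a' = a - i) (hb : b' = b - j)
    (x : hom.H P'.X a b) (y : coh.H P i j) :
    cap P a b i j a' b' ha hb (hom.push φ.right hX a b x) y =
      hom.push φ.left hY a' b' (cap P' a b i j a' b' ha hb x (coh.map φ i j y))
  /-- The fundamental class of an irreducible scheme. -/
  eta : hom.ClassFamily
  pull_eta {X' X : AlgSch k} (α : X' ⟶ X) (hα : Etale α.hom) (d : ℕ)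
    (hX' : IrreducibleSpace X'.sch) (hX : IrreducibleSpace X.sch)
    (hd' : topologicalKrullDim X'.sch = d) (hd : topologicalKrullDim X.sch = d) :
    hom.pull α hα (2 * d) d (eta X d hX hd) = eta X' d hX' hd'
  /-- Poincaré duality. -/
  duality (P : ClosedPair k) (_ : Smooth P.X.str) (d : ℕ) (_ : P.X.IsPureDim d)
    (η : hom.H P.X (2 * d) d) (_ : hom.IsFundamentalClass eta P.X d η)
    (i j a b : ℤ) (ha : a = 2 * d - i) (hb : b = d - j) :
    Function.Bijective (cap P (2 * d) d i j a b ha hb η)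
  /-- Principal triviality. -/
  push_principal {W X : AlgSch k} (i : W ⟶ X) (hi : IsProper i.hom) (_ : Smooth W.str)
    (_ : Smooth X.str) (_ : IsPrincipalDivisor i) (e : ℕ) (_ : W.IsPureDim e)
    (η : hom.H W (2 * e) e) (_ : hom.IsFundamentalClass eta W e η) :
    hom.push i hi (2 * e) e η = 0

/-- An extended Poincaré duality theory: a twisted Poincaré duality theory with pull-backs
`H_a(X, b) → H_{a+2m}(X', b+m)` for flat morphisms `X' ⟶ X` that are equidimensional of
dimension `m`. -/
structure ExtendedPoincareDuality (k : Type u) [Field k]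
    extends TwistedPoincareDuality.{u, v} k where
  flat {X' X : AlgSch k} (f : X' ⟶ X) (m : ℕ) (hf : IsFlatEquidim f.hom m) (a a' b b' : ℤ)
    (ha : a' = a + 2 * m) (hb : b' = b + m) : hom.H X a b →+ hom.H X' a' b'
  flat_id (X : AlgSch k) (hf : IsFlatEquidim (Hom.hom (𝟙 X)) 0) (a b : ℤ)
    (ha : a = a + 2 * (0 : ℕ)) (hb : b = b + (0 : ℕ)) (x : hom.H X a b) :
    flat (𝟙 X) 0 hf a a b b ha hb x = x
  flat_comp {X'' X' X : AlgSch k} (g : X'' ⟶ X') (f : X' ⟶ X) (m n : ℕ)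
    (hf : IsFlatEquidim f.hom m) (hg : IsFlatEquidim g.hom n)
    (hgf : IsFlatEquidim (g ≫ f).hom (m + n)) (a a' a'' b b' b'' : ℤ)
    (ha : a' = a + 2 * m) (hb : b' = b + m) (ha' : a'' = a' + 2 * n) (hb' : b'' = b' + n)
    (ha'' : a'' = a + 2 * (m + n : ℕ)) (hb'' : b'' = b + (m + n : ℕ)) (x : hom.H X a b) :
    flat (g ≫ f) (m + n) hgf a a'' b b'' ha'' hb'' x =
      flat g n hg a' a'' b' b'' ha' hb' (flat f m hf a a' b b' ha hb x)
  flat_etale {X' X : AlgSch k} (α : X' ⟶ X) (hα : Etale α.hom) (hf : IsFlatEquidim α.hom 0)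
    (a b : ℤ) (ha : a = a + 2 * (0 : ℕ)) (hb : b = b + (0 : ℕ)) (x : hom.H X a b) :
    flat α 0 hf a a b b ha hb x = hom.pull α hα a b x
  flat_eta {X' X : AlgSch k} (f : X' ⟶ X) (m : ℕ) (hf : IsFlatEquidim f.hom m)
    (hX' : IrreducibleSpace X'.sch) (hX : IrreducibleSpace X.sch) (d' d : ℕ)
    (hd' : topologicalKrullDim X'.sch = d') (hd : topologicalKrullDim X.sch = d)
    (ha : (2 * d' : ℤ) = 2 * d + 2 * m) (hb : (d' : ℤ) = d + m) :
    flat f m hf (2 * d) (2 * d') d d' ha hb (eta X d hX hd) = eta X' d' hX' hd'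
  flat_cap {P' P : ClosedPair k} (φ : P' ⟶ P) (m : ℕ) (hX : IsFlatEquidim φ.right.hom m)
    (hY : IsFlatEquidim φ.left.hom m) (a b i j a' b' a₁ b₁ a₁' b₁' : ℤ)
    (ha : a' = a - i) (hb : b' = b - j) (ha₁ : a₁ = a + 2 * m) (hb₁ : b₁ = b + m)
    (ha₁' : a₁' = a₁ - i) (hb₁' : b₁' = b₁ - j) (ha' : a₁' = a' + 2 * m) (hb' : b₁' = b' + m)
    (x : hom.H P.X a b) (y : coh.H P i j) :
    flat φ.left m hY a' a₁' b' b₁' ha' hb' (cap P a b i j a' b' ha hb x y) =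
      cap P' a₁ b₁ i j a₁' b₁' ha₁' hb₁' (flat φ.right m hX a a₁ b b₁ ha₁ hb₁ x)
        (coh.map φ i j y)
  /-- Compatibility with push-forward from `Z`, for `Z'` the preimage of `Z`. -/
  flat_push {Z' X' U' Z X U : AlgSch k} {i' : Z' ⟶ X'} {j' : U' ⟶ X'}
    (h' : IsClosedOpenPair i' j') {i : Z ⟶ X} {j : U ⟶ X} (h : IsClosedOpenPair i j)
    (f : X' ⟶ X) (fZ : Z' ⟶ Z) (fU : U' ⟶ U) (m : ℕ) (hf : IsFlatEquidim f.hom m)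
    (hfZ : IsFlatEquidim fZ.hom m) (_ : IsFlatEquidim fU.hom m)
    (_ : IsPullback i'.hom fZ.hom f.hom i.hom) (_ : IsPullback j'.hom fU.hom f.hom j.hom)
    (a a₁ b b₁ : ℤ) (ha : a₁ = a + 2 * m) (hb : b₁ = b + m) (x : hom.H Z a b) :
    flat f m hf a a₁ b b₁ ha hb (hom.push i h.proper a b x) =
      hom.push i' h'.proper a₁ b₁ (flat fZ m hfZ a a₁ b b₁ ha hb x)
  /-- Compatibility with restriction to `U`, for `U'` the preimage of `U`. -/
  flat_pull {Z' X' U' Z X U : AlgSch k} {i' : Z' ⟶ X'} {j' : U' ⟶ X'}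
    (h' : IsClosedOpenPair i' j') {i : Z ⟶ X} {j : U ⟶ X} (h : IsClosedOpenPair i j)
    (f : X' ⟶ X) (fZ : Z' ⟶ Z) (fU : U' ⟶ U) (m : ℕ) (hf : IsFlatEquidim f.hom m)
    (_ : IsFlatEquidim fZ.hom m) (hfU : IsFlatEquidim fU.hom m)
    (_ : IsPullback i'.hom fZ.hom f.hom i.hom) (_ : IsPullback j'.hom fU.hom f.hom j.hom)
    (a a₁ b b₁ : ℤ) (ha : a₁ = a + 2 * m) (hb : b₁ = b + m) (x : hom.H X a b) :
    flat fU m hfU a a₁ b b₁ ha hb (hom.pull j h.etale a b x) =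
      hom.pull j' h'.etale a₁ b₁ (flat f m hf a a₁ b b₁ ha hb x)
  /-- Compatibility with the boundary maps. -/
  flat_bdry {Z' X' U' Z X U : AlgSch k} {i' : Z' ⟶ X'} {j' : U' ⟶ X'}
    (h' : IsClosedOpenPair i' j') {i : Z ⟶ X} {j : U ⟶ X} (h : IsClosedOpenPair i j)
    (f : X' ⟶ X) (fZ : Z' ⟶ Z) (fU : U' ⟶ U) (m : ℕ) (_ : IsFlatEquidim f.hom m)
    (hfZ : IsFlatEquidim fZ.hom m) (hfU : IsFlatEquidim fU.hom m)
    (_ : IsPullback i'.hom fZ.hom f.hom i.hom) (_ : IsPullback j'.hom fU.hom f.hom j.hom)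
    (a a' a₁ a₁' b b₁ : ℤ) (ha : a = a' + 1) (ha' : a₁ = a₁' + 1) (ha₁ : a₁ = a + 2 * m)
    (ha₁' : a₁' = a' + 2 * m) (hb : b₁ = b + m) (x : hom.H U a b) :
    hom.bdry i' j' h' a₁ a₁' b₁ ha' (flat fU m hfU a a₁ b b₁ ha₁ hb x) =
      flat fZ m hfZ a' a₁' b b₁ ha₁' hb (hom.bdry i j h a a' b ha x)

namespace ExtendedPoincareDuality

variable (T : ExtendedPoincareDuality.{u, v} k) {X : AlgSch k}

/-- The pull-back `H_a(X, b) → H_{a+2}(A^1_X, b+1)`. -/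
noncomputable def linePull (X : AlgSch k) (a b : ℤ) :
    T.hom.H X a b →+ T.hom.H X.line (a + 2) (b + 1) :=
  T.flat X.lineProj 1 X.isFlatEquidim_lineProj a (a + 2) b (b + 1) (by norm_num) (by norm_num)

/-- The pull-back `H_a(S, b) → H_{a+2}(A^1_S, b+1)` for a locally closed subset `S` of `X`. -/
noncomputable def lineResPull (S : LC X) (a a₁ b b₁ : ℤ) (ha : a₁ = a + 2) (hb : b₁ = b + 1) :
    T.hom.H S.red a b →+ T.hom.H S.line.red a₁ b₁ :=
  T.flat S.lineRes 1 S.isFlatEquidim_lineRes a a₁ b b₁ (by simpa using ha) (by simpa using hb)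

theorem lineResPull_res {S S' : LC X} (h : S'.OpenIn S) (a a₁ b b₁ : ℤ) (ha : a₁ = a + 2)
    (hb : b₁ = b + 1) (z : T.hom.H S.red a b) :
    T.lineResPull S' a a₁ b b₁ ha hb (T.hom.res h a b z) =
      T.hom.res h.line a₁ b₁ (T.lineResPull S a a₁ b b₁ ha hb z) :=
  T.flat_pull (LC.isClosedOpenPair (LC.line_mono (S.diff_le S' h)) h.line rfl)
    (LC.isClosedOpenPair (S.diff_le S' h) h rfl) S.lineRes (S.diff S' h).lineRes S'.lineRes 1
    S.isFlatEquidim_lineRes (S.diff S' h).isFlatEquidim_lineRes S'.isFlatEquidim_lineRes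
    (LC.isPullback_line_incl _) (LC.isPullback_line_incl _) a a₁ b b₁ (by simpa using ha)
    (by simpa using hb) z

end ExtendedPoincareDuality

theorem AlgSch.Nbd.mem_line_of_isGen {X : AlgSch k} {x : X.sch} {W W' : Nbd x} (h : W ≤ W')
    {y : X.line.sch} (hy : W.lc.line.IsGen y) : y ∈ W'.lc.line.1 := by
  obtain ⟨W₁, U, hU, e⟩ := id hy
  obtain ⟨V, hV, eV⟩ := W.exists_open
  obtain ⟨V', hV', eV'⟩ := W'.exists_open
  let π := X.lineProj.hom
  have hyW : π y ∈ W.carrier := hy.mem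
  have hyU : y ∈ U := (e ▸ W₁.mem : y ∈ U ∩ W.lc.line.1).1
  have hyc : π y ∈ closure {x} := W.subset_closure hyW
  have hopen : IsOpen (π '' U) := AffineSpace.isOpenMap_over _ U hU
  obtain ⟨z, hz, rfl⟩ := mem_closure_iff.mp hyc _ hopen ⟨y, hyU, rfl⟩
  obtain ⟨w, hwU, hw⟩ := hz
  have hwW : w ∈ W₁.carrier := by
    change w ∈ W₁.lc.1
    rw [e]
    refine ⟨hwU, ?_⟩
    change π w ∈ W.carrier
    rw [hw]
    exact W.mem
  have h1 : y ⤳ w := specializes_iff_mem_closure.mpr (W₁.subset_closure hwW)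
  have h2 : π y ⤳ π w := h1.map π.continuous
  rw [hw] at h2
  change π y ∈ W'.carrier
  have hx' : z ∈ V' := (eV' ▸ W'.mem : z ∈ V' ∩ closure {z}).1
  rw [eV']
  exact ⟨h2.mem_open hV' hx', hyc⟩

namespace ExtendedPoincareDuality

attribute [local instance] Classical.propDecidable

variable (T : ExtendedPoincareDuality.{u, v} k) (X : AlgSch k)

/-- The pull-back from the sum over the points of `X` of dimension `p` to the sum over the points
of the affine line over `X` of dimension `p + 1`. On the summand of `x` it is the limit, over the
neighbourhoods `W` of `x` in its closure, of the pull-back from `H_a(W, b)` to the homology of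
`A^1_W` followed by the map to the homology of the generic points of `A^1_W`. -/
noncomputable def ptsPull (p p₁ a a₁ b b₁ : ℤ) (ha : a₁ = a + 2) (hb : b₁ = b + 1) :
    T.hom.PtSum X p a b →+ T.hom.PtSum X.line p₁ a₁ b₁ :=
  DirectSum.toAddMonoid fun x => AddCommGroup.DirectLimit.lift _ _ _
    (fun W => (T.hom.genGerms W.lc.line p₁ a₁ b₁).comp (T.lineResPull W.lc a a₁ b b₁ ha hb))
    fun W W' h z => by
      simp only [AddMonoidHom.comp_apply]
      rw [T.lineResPull_res, T.hom.genGerms_res (Nbd.openIn h).line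
        fun y hy => Nbd.mem_line_of_isGen h hy]

/-- The pull-back `E^1_{p,q}(X, b) → E^1_{p+1,q+1}(A^1_X, b+1)`. -/
noncomputable def pullE1 (p p₁ q q₁ b b₁ : ℤ) (hp : p₁ = p + 1) (hq : q₁ = q + 1)
    (hb : b₁ = b + 1) : T.hom.E1 X p q b →+ T.hom.E1 X.line p₁ q₁ b₁ :=
  T.ptsPull X p p₁ (p + q) (p₁ + q₁) b b₁ (by omega) hb

/-- The pull-back on `E^1`-terms commutes with the differentials. -/
def PullE1Comm : Prop :=
  ∀ (p p' p₁ p₁' q q₁ b b₁ : ℤ) (h : p = p' + 1) (h₁ : p₁ = p₁' + 1) (hp : p₁ = p + 1)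
    (hp' : p₁' = p' + 1) (hq : q₁ = q + 1) (hb : b₁ = b + 1) (x : T.hom.E1 X p q b),
    T.hom.d1 X.line p₁ p₁' q₁ b₁ h₁ (T.pullE1 X p p₁ q q₁ b b₁ hp hq hb x) =
      T.pullE1 X p' p₁' q q₁ b b₁ hp' hq hb (T.hom.d1 X p p' q b h x)

variable {X}

/-- The pull-back on cycles. -/
noncomputable def pullCycles (h : T.PullE1Comm X) (p q b : ℤ) :
    (T.hom.d1 X p (p - 1) q b (sub_add_cancel p 1).symm).ker →+
      (T.hom.d1 X.line (p + 1) (p + 1 - 1) (q + 1) (b + 1) (sub_add_cancel (p + 1) 1).symm).ker :=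
  ((T.pullE1 X p (p + 1) q (q + 1) b (b + 1) rfl rfl rfl).comp (AddSubgroup.subtype _)).codRestrict
    _ fun x => by
      have hx := x.2
      rw [AddMonoidHom.mem_ker] at hx ⊢
      simp only [AddMonoidHom.comp_apply, AddSubgroup.subtype_apply]
      rw [h p (p - 1) (p + 1) (p + 1 - 1) q (q + 1) b (b + 1) (sub_add_cancel p 1).symm _ rfl
        (by omega) rfl rfl, hx,
        map_zero]

/-- The induced map `E^2_{p,q}(X, b) → E^2_{p+1,q+1}(A^1_X, b+1)`. -/
noncomputable def pullE2 (h : T.PullE1Comm X) (p q b : ℤ) :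
    T.hom.E2 X p q b →+ T.hom.E2 X.line (p + 1) (q + 1) (b + 1) :=
  QuotientAddGroup.map _ _ (T.pullCycles h p q b) (by
    rintro x ⟨y, hy⟩
    exact ⟨T.pullE1 X (p + 1) (p + 1 + 1) q (q + 1) b (b + 1) rfl rfl rfl y, by
      rw [h (p + 1) p (p + 1 + 1) (p + 1) q (q + 1) b (b + 1) rfl rfl rfl rfl rfl rfl, hy]
      rfl⟩)

end ExtendedPoincareDuality

end BlochOgus

/-! For (i), localization sequences and the five lemma allow noetherian induction on closed subsets.
Since `k` is perfect, a non-empty reduced scheme has a non-empty smooth open part, so it suffices to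
treat smooth integral schemes. There the cap product with the fundamental class turns `p^*` on
homology into `p^*` on cohomology, because `p^*` preserves both fundamental classes and cap
products, and homotopy invariance applies (`linePull_bijective_of_smooth`,
`linePull_bijective_of_pair`).

For (ii), a point of the affine line over `x` is either the generic point `fibGen x` of the fibre,
of dimension one more than `x`, or a closed point `y` of the fibre, of the same dimension as `x`. On
`E^1` the pull-back sends the summand of `x` to that of `fibGen x`. The heart of the proof is the
exactness, for each `x`, of `0 → H_a(x, b) → H_{a+2}(fibGen x, b+1) → ⊕_y H_{a+1}(y, b+1) → 0`, with
`y` running over the closed points of the fibre and the last map a part of `d^1`. The three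
assertions are `pullPt_injective`, `exists_pullPt_eq` and `exists_ptsBdry_eq`. They come from the
localization sequences of the lines over small neighbourhoods `W` of `x` in its closure, together
with (i), once it is known that push-forward from the closure of `y` to the line over `W` is zero.

This vanishing is `exists_pushLC_over_eq_zero`. For small affine `W`, the part `V` of the closure of
`y` above `W` is smooth, integral, affine and finite over `W`. The inclusion of `V` in the line over
`W` factors through its graph `s`, a section of the line over `V`, followed by a proper map. The
image of `s` is a principal divisor, so `s_* η_V = 0`. Every class on `V` has the form `η_V ∩ c`
with `c = s^* p^* c`, so the projection formula gives `s_* = 0`.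

The comparison on `E^2` is then a diagram chase. Any chain on the line can be changed by a boundary
into one supported at generic points of fibres (`exists_isFibGenSupported_sub`). Such a chain is a
pull-back as soon as its boundary is also supported there (`exists_ptsPull_eq`). Applied to cycles
this gives surjectivity; applied to chains that bound a pull-back it gives injectivity. -/

namespace BlochOgus

open AlgSch

variable {k : Type u} [Field k]

/-! ### Generic points of the fibres of the affine line. -/

namespace AlgSch

variable {X : AlgSch k}

theorem surjective_lineProj (X : AlgSch k) : Function.Surjective X.lineProj.hom :=
  (𝔸(PUnit.{u+1}; X.sch) ↘ X.sch).surjective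

theorem isOpenMap_lineProj (X : AlgSch k) : IsOpenMap X.lineProj.hom :=
  AffineSpace.isOpenMap_over X.sch

theorem isIrreducible_lineProj_preimage {s : Set X.sch} (hs : IsIrreducible s) :
    IsIrreducible (X.lineProj.hom ⁻¹' s) :=
  (𝔸(PUnit.{u+1}; X.sch) ↘ X.sch).isIrreducible_preimage X.isOpenMap_lineProj hs

theorem isIrreducible_linePreimage_closure (x : X.sch) :
    IsIrreducible (X.lineProj.hom ⁻¹' closure {x}) :=
  isIrreducible_lineProj_preimage isIrreducible_singleton.closure

theorem isClosed_linePreimage_closure (x : X.sch) : IsClosed (X.lineProj.hom ⁻¹' closure {x}) :=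
  isClosed_closure.preimage X.lineProj.hom.continuous

/-- The generic point of the fibre of the affine line over `x`. -/
noncomputable def fibGen (x : X.sch) : X.line.sch :=
  (isIrreducible_linePreimage_closure x).genericPoint

theorem closure_fibGen (x : X.sch) : closure {fibGen x} = X.lineProj.hom ⁻¹' closure {x} := by
  exact (isIrreducible_linePreimage_closure x).closure_genericPoint
    (isClosed_linePreimage_closure x)

theorem mem_closure_fibGen {x : X.sch} {y : X.line.sch} :
    y ∈ closure {fibGen x} ↔ X.lineProj.hom y ∈ closure {x} := by
  rw [closure_fibGen]; rfl

theorem eq_of_mem_closure {Y : AlgSch k} {x y : Y.sch} (h : x ∈ closure {y})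
    (h' : y ∈ closure {x}) : x = y :=
  ((specializes_iff_mem_closure.mpr h').antisymm (specializes_iff_mem_closure.mpr h)).eq

-- The image lies in the closure of `x` by construction. Conversely, every point above `x` is a
-- specialization of `fibGen x`, so `x` is a specialization of the image.
@[simp]
theorem lineProj_fibGen (x : X.sch) : X.lineProj.hom (fibGen x) = x := by
  refine eq_of_mem_closure (mem_closure_fibGen.mp (subset_closure rfl)) ?_
  obtain ⟨y, rfl⟩ := X.surjective_lineProj x
  have h : y ∈ closure {fibGen (X.lineProj.hom y)} := mem_closure_fibGen.mpr (subset_closure rfl)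
  exact specializes_iff_mem_closure.mp
    ((specializes_iff_mem_closure.mpr h).map X.lineProj.hom.continuous)

theorem fibGen_injective : Function.Injective (fibGen (X := X)) := fun x y h => by
  rw [← lineProj_fibGen x, h, lineProj_fibGen]

/-- The preimage in the affine line of a neighbourhood of `x`. -/
def Nbd.line {x : X.sch} (W : Nbd x) : Nbd (fibGen x) :=
  ⟨X.lineProj.hom ⁻¹' W.carrier, by
    change X.lineProj.hom (fibGen x) ∈ W.carrier
    rw [lineProj_fibGen]; exact W.mem, by
    obtain ⟨U, hU, e⟩ := W.exists_open
    exact ⟨_, hU.preimage X.lineProj.hom.continuous, by rw [e, closure_fibGen]; rfl⟩⟩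

theorem Nbd.line_mono {x : X.sch} {W W' : Nbd x} (h : W ≤ W') : W.line ≤ W'.line :=
  Set.preimage_mono h

theorem cl_line (x : X.sch) : (cl x).line = cl (fibGen x) := LC.ext (closure_fibGen x).symm

namespace LC

/-- A locally closed set is only open in its closure, so `U ∩ closure {y}` may leave `S`.
Intersecting with `S.nhd`, in which `S` is closed, repairs this. -/
theorem isGen_of_open {S : LC X} {y : X.sch} (hy : y ∈ S.1) {U : Set X.sch} (hU : IsOpen U)
    (hyU : y ∈ U) (h : U ∩ S.1 ⊆ closure {y}) : S.IsGen y := by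
  have hS : S.1 = S.nhd.1 ∩ closure S.1 := by
    change S.1 = coborder S.1 ∩ closure S.1
    exact (coborder_inter_closure (s := S.1)).symm
  have hyS : y ∈ S.nhd.1 := subset_coborder hy
  refine ⟨⟨(U ∩ S.nhd.1) ∩ closure {y}, ⟨⟨hyU, hyS⟩, subset_closure rfl⟩, _,
    hU.inter S.nhd.2, rfl⟩, U ∩ S.nhd.1, hU.inter S.nhd.2, ?_⟩
  change (U ∩ S.nhd.1) ∩ closure {y} = (U ∩ S.nhd.1) ∩ S.1
  refine Set.Subset.antisymm ?_ fun z hz => ⟨hz.1, h ⟨hz.1.1, hz.2⟩⟩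
  rintro z ⟨hz, hz'⟩
  refine ⟨hz, ?_⟩
  rw [hS]
  exact ⟨hz.2, closure_mono (by simpa using hy) hz'⟩

theorem IsGen.exists_open {S : LC X} {y : X.sch} (h : S.IsGen y) :
    ∃ U : Set X.sch, IsOpen U ∧ y ∈ U ∧ U ∩ S.1 ⊆ closure {y} := by
  obtain ⟨W, U, hU, e⟩ := h
  exact ⟨U, hU, (e ▸ W.mem : y ∈ U ∩ S.1).1, fun z hz => W.subset_closure (e ▸ hz : z ∈ W.lc.1)⟩

/-- The projection is open, so a neighbourhood that isolates `fibGen x` has an open image that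
isolates `x`. -/
theorem isGen_line_fibGen {S : LC X} {x : X.sch} : S.line.IsGen (fibGen x) ↔ S.IsGen x := by
  constructor
  · intro h
    obtain ⟨U, hU, hxU, hUS⟩ := h.exists_open
    have hx : x ∈ S.1 := by
      have : X.lineProj.hom (fibGen x) ∈ S.1 := h.mem
      rwa [lineProj_fibGen] at this
    refine isGen_of_open hx (X.isOpenMap_lineProj U hU) ⟨_, hxU, lineProj_fibGen x⟩ ?_
    rintro _ ⟨⟨u, hu, rfl⟩, hs⟩
    exact mem_closure_fibGen.mp (hUS ⟨hu, hs⟩)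
  · rintro ⟨W, hW⟩
    exact ⟨W.line, hW.line⟩

/-- The point `y` specializes from the generic point of its fibre, which also lies above `S`;
nothing above `S` specializes properly to a generic point. With `isGen_line_fibGen`, this matches
the components of the line over `S` with those of `S`. -/
theorem eq_fibGen_of_isGen_line {S : LC X} {y : X.line.sch} (h : S.line.IsGen y) :
    y = fibGen (X.lineProj.hom y) := by
  obtain ⟨U, hU, hxU, hUS⟩ := h.exists_open
  have h1 : y ∈ closure {fibGen (X.lineProj.hom y)} := mem_closure_fibGen.mpr (subset_closure rfl)
  refine eq_of_mem_closure h1 (hUS ⟨?_, ?_⟩)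
  · obtain ⟨z, hz, rfl⟩ := mem_closure_iff.mp h1 U hU hxU
    exact hz
  · change X.lineProj.hom (fibGen _) ∈ S.1
    rw [lineProj_fibGen]
    exact h.mem

/-- Distinct generic points have disjoint neighbourhoods. -/
theorem nbd_disjoint {S : LC X} {y y' : X.sch} {W : Nbd y} {W' : Nbd y'} (hW : W.lc.OpenIn S)
    (hW' : W'.lc.OpenIn S) (hne : y ≠ y') : Disjoint W.carrier W'.carrier := by
  have key : ∀ {y y' : X.sch} {W : Nbd y} {W' : Nbd y'}, W.lc.OpenIn S → W'.lc.OpenIn S →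
      (W.carrier ∩ W'.carrier).Nonempty → y ∈ closure {y'} := by
    intro y y' W W' hW hW' ⟨z, hz, hz'⟩
    obtain ⟨U, hU, e⟩ := hW'
    have h1 : z ∈ U := (e ▸ hz' : z ∈ U ∩ S.1).1
    obtain ⟨w, hw, hw'⟩ := mem_closure_iff.mp (W.subset_closure hz) U hU h1
    rw [Set.mem_singleton_iff] at hw'
    subst hw'
    refine W'.subset_closure (show w ∈ W'.lc.1 from ?_)
    rw [e]
    exact ⟨hw, hW.le W.mem⟩
  rw [Set.disjoint_iff_inter_eq_empty]
  by_contra h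
  have h' := Set.nonempty_iff_ne_empty.mpr h
  exact hne (eq_of_mem_closure (key hW hW' h') (key hW' hW (by rwa [Set.inter_comm])))

end LC

/-- A closed subset over the closure of `x` without points over `x` can be avoided. -/
theorem exists_nbd_disjoint {Y : AlgSch k} (f : Y ⟶ X) {x : X.sch} {F : Set Y.sch}
    (hF : IsClosed F) (hFx : ∀ y ∈ F, f.hom y ∈ closure {x}) (h : ∀ y ∈ F, f.hom y ≠ x) :
    ∃ W : Nbd x, ∀ y ∈ F, f.hom y ∉ W.carrier := by
  obtain ⟨S, hS, hSc, hSi, e⟩ := NoetherianSpace.exists_finite_set_isClosed_irreducible hF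
  have hgen : ∀ C : S, ∃ c ∈ C.1, closure {c} = C.1 := fun C => by
    have h1 := (hSi C.1 C.2).closure_genericPoint (hSc C.1 C.2)
    exact ⟨_, h1.subset (subset_closure (Set.mem_singleton _)), h1⟩
  choose c hc hcC using hgen
  have hcF : ∀ C, c C ∈ F := fun C => by
    rw [e]; exact ⟨C.1, C.2, hc C⟩
  have := hS.to_subtype
  -- The image of `F` need not be closed, but it lies in the closures of the images of the finitely
  -- many generic points of `F`. Those images are proper specializations of `x`, so none of these
  -- closures contains `x`.
  let B : Set X.sch := ⋃ C, closure {f.hom (c C)}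
  have hB : IsClosed B := isClosed_iUnion_of_finite fun _ => isClosed_closure
  refine ⟨⟨Bᶜ ∩ closure {x}, ⟨?_, subset_closure rfl⟩, Bᶜ, hB.isOpen_compl, rfl⟩, ?_⟩
  · simp only [B, Set.mem_compl_iff, Set.mem_iUnion, not_exists]
    intro C hx
    exact h _ (hcF C) (eq_of_mem_closure (hFx _ (hcF C)) hx)
  · rintro y hy ⟨hyB, -⟩
    rw [e] at hy
    obtain ⟨C, hC, hyC⟩ := hy
    refine hyB (Set.mem_iUnion.mpr ⟨⟨C, hC⟩, ?_⟩)
    replace hyC : y ∈ closure {c ⟨C, hC⟩} := (hcC ⟨C, hC⟩).symm.subset hyC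
    exact specializes_iff_mem_closure.mp
      ((specializes_iff_mem_closure.mpr hyC).map f.hom.continuous)

theorem HasDim.eq_of_mem_closure {x y : X.sch} {p : ℤ} (hx : HasDim x p) (hy : HasDim y p)
    (h : x ∈ closure {y}) : x = y := by
  by_contra hne
  obtain ⟨n, hn, hx⟩ := hx
  obtain ⟨m, hm, hy⟩ := hy
  have h1 : closure {x} ⊆ closure {y} := closure_minimal (by simpa using h) isClosed_closure
  have h2 := succ_le_dim isClosed_closure isIrreducible_singleton.closure h1
    (fun e => hne (AlgSch.eq_of_mem_closure h (e ▸ subset_closure rfl))) n hx.ge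
  rw [hy] at h2
  have : n + 1 ≤ m := by exact_mod_cast h2
  omega

theorem HasDim.unique {x : X.sch} {p q : ℤ} (hp : HasDim x p) (hq : HasDim x q) : p = q := by
  obtain ⟨n, rfl, hn⟩ := hp
  obtain ⟨m, rfl, hm⟩ := hq
  rw [hn] at hm
  exact_mod_cast hm

end AlgSch

/-! ### Krull dimension of finitely generated algebras over a field. -/

section Algebra

/-- Going up lifts chains of primes from `R` to `S`, starting from a prime over the bottom of the
chain. Incomparability makes contraction of primes strictly monotone. -/
theorem ringKrullDim_eq_of_isIntegral {R S : Type*} [CommRing R] [CommRing S] [Algebra R S]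
    [Algebra.IsIntegral R S] (h : Function.Injective (algebraMap R S)) :
    ringKrullDim R = ringKrullDim S := by
  refine le_antisymm ?_ ?_
  · refine iSup_le fun l => ?_
    obtain ⟨P, -, hP, hPl⟩ := Ideal.exists_ideal_over_prime_of_isIntegral l.head.asIdeal
      (⊥ : Ideal S) (by
        rw [← RingHom.ker_eq_comap_bot, (RingHom.injective_iff_ker_eq_bot _).mp h]; exact bot_le)
    have : P.LiesOver l.head.asIdeal := ⟨hPl.symm⟩
    obtain ⟨L, hL, -⟩ := Ideal.exists_ltSeries_of_hasGoingUp l P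
    rw [← hL]
    exact Order.LTSeries.length_le_krullDim L
  · refine Order.krullDim_le_of_strictMono (PrimeSpectrum.comap (algebraMap R S)) fun P Q hPQ => ?_
    exact Ideal.IsIntegral.comap_lt_comap (R := R) (show P.asIdeal < Q.asIdeal from hPQ)

/-- By Noether normalization `A` is integral over a polynomial ring in `s` variables, and both
invariants equal `s`. -/
theorem exists_ringKrullDim_trdeg (F A : Type u) [Field F] [CommRing A] [IsDomain A] [Algebra F A]
    [Algebra.FiniteType F A] : ∃ n : ℕ, ringKrullDim A = n ∧ Algebra.trdeg F A = n := by
  obtain ⟨s, g, hg, hi⟩ := exists_integral_inj_algHom_of_fg F A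
  refine ⟨s, ?_, ?_⟩
  · let _ := g.toRingHom.toAlgebra
    have : Algebra.IsIntegral (MvPolynomial (Fin s) F) A := ⟨hi⟩
    rw [← ringKrullDim_eq_of_isIntegral (R := MvPolynomial (Fin s) F) (S := A) hg,
      MvPolynomial.ringKrullDim_of_isNoetherianRing, ringKrullDim_eq_zero_of_field]
    simp
  · let _ := g.toRingHom.toAlgebra
    have : IsScalarTower F (MvPolynomial (Fin s) F) A := IsScalarTower.of_algebraMap_eq fun x =>
      (g.commutes x).symm
    have : Algebra.IsIntegral (MvPolynomial (Fin s) F) A := ⟨hi⟩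
    have : FaithfulSMul (MvPolynomial (Fin s) F) A :=
      (faithfulSMul_iff_algebraMap_injective _ _).mpr hg
    rw [← trdeg_add_eq F (MvPolynomial (Fin s) F) (A := A), trdeg_eq_zero (R := MvPolynomial (Fin s) F) (A := A)]
    simp

/-- Krull dimension can drop under localization of a general domain. Here it is a transcendence
degree, which an algebraic extension such as a localization does not change. -/
theorem ringKrullDim_eq_of_isLocalizationAway {F A B : Type u} [Field F] [CommRing A] [IsDomain A]
    [CommRing B] [Algebra A B] (φ : F →+* A) (hφ : φ.FiniteType) {f : A} (hf : f ≠ 0)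
    [IsLocalization.Away f B] : ringKrullDim B = ringKrullDim A := by
  let _ := φ.toAlgebra
  have : Algebra.FiniteType F A := hφ
  let _ := ((algebraMap A B).comp φ).toAlgebra
  have : IsScalarTower F A B := IsScalarTower.of_algebraMap_eq fun x => rfl
  have hle : Submonoid.powers f ≤ nonZeroDivisors A := powers_le_nonZeroDivisors_of_noZeroDivisors hf
  have : IsDomain B := IsLocalization.isDomain_of_le_nonZeroDivisors B hle
  have : FaithfulSMul A B :=
    (faithfulSMul_iff_algebraMap_injective _ _).mpr (IsLocalization.injective B hle)
  have : Algebra.FiniteType A B :=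
    have := IsLocalization.Away.finitePresentation f (S := B)
    inferInstance
  have : Algebra.FiniteType F B := Algebra.FiniteType.trans (S := A) inferInstance inferInstance
  obtain ⟨n, hn, hn'⟩ := exists_ringKrullDim_trdeg F A
  obtain ⟨m, hm, hm'⟩ := exists_ringKrullDim_trdeg F B
  have : Algebra.IsAlgebraic A B := IsLocalization.isAlgebraic B (Submonoid.powers f)
  have h := trdeg_add_eq F A (A := B)
  rw [trdeg_eq_zero (R := A) (A := B), add_zero, hn', hm'] at h
  rw [hn, hm]
  exact_mod_cast h.symm

end Algebra

/-! ### Dimension of integral algebraic schemes and of their affine lines. -/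

section Scheme

/-- A chain of irreducible closed sets above `Z` is visible in any open set meeting `Z`. Writing the
dimension as a supremum of coheights therefore makes it local. -/
theorem topologicalKrullDim_le_of_open_cover {α : Type*} [TopologicalSpace α] {d : WithBot ℕ∞}
    (h : ∀ x : α, ∃ U : Set α, IsOpen U ∧ x ∈ U ∧ topologicalKrullDim U ≤ d) :
    topologicalKrullDim α ≤ d := by
  change Order.krullDim (IrreducibleCloseds α) ≤ d
  rw [Order.krullDim_eq_iSup_coheight]
  refine iSup_le fun Z => ?_
  obtain ⟨z, hz⟩ := Z.2.nonempty
  obtain ⟨U, hU, hzU, hd⟩ := h z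
  refine le_trans ?_ hd
  have hU' := hU.isOpenEmbedding_subtypeVal
  obtain ⟨Z', hZ'⟩ := (IrreducibleCloseds.orderIsoOfIsOpenEmbedding _ hU').surjective
    ⟨Z, ⟨z, hzU⟩, hz⟩
  have h1 : IrreducibleCloseds.map _ hU'.continuous Z' = Z := congr($(hZ').1)
  rw [← h1, hU'.coheight_map]
  exact Order.coheight_le_krullDim Z'

theorem topologicalKrullDim_affineOpen {Y : Scheme.{u}} {U : Y.Opens} (hU : IsAffineOpen U) :
    topologicalKrullDim U = ringKrullDim Γ(Y, U) := by
  rw [← PrimeSpectrum.topologicalKrullDim_eq_ringKrullDim]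
  exact (hU.isoSpec.hom.homeomorph.isHomeomorph.topologicalKrullDim_eq : _)

theorem AlgSch.exists_finiteType (Y : AlgSch k) {U : Y.sch.Opens} (hU : IsAffineOpen U) :
    ∃ φ : k →+* Γ(Y.sch, U), φ.FiniteType := by
  have h := Y.str.finiteType_appLE (isAffineOpen_top (Spec (.of k))) hU le_top
  refine ⟨(Y.str.appLE ⊤ U le_top).hom.comp (Scheme.ΓSpecIso (.of k)).inv.hom, ?_⟩
  exact h.comp (RingHom.FiniteType.of_surjective _
    (Scheme.ΓSpecIso (.of k)).symm.commRingCatIsoToRingEquiv.surjective)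

theorem AlgSch.ringKrullDim_basicOpen (Y : AlgSch k) [IsIntegral Y.sch] {U : Y.sch.Opens}
    (hU : IsAffineOpen U) (f : Γ(Y.sch, U)) (hf : (Y.sch.basicOpen f : Set Y.sch).Nonempty) :
    ringKrullDim Γ(Y.sch, Y.sch.basicOpen f) = ringKrullDim Γ(Y.sch, U) := by
  have : Nonempty U := ⟨⟨hf.some, Y.sch.basicOpen_le f hf.some_mem⟩⟩
  obtain ⟨φ, hφ⟩ := Y.exists_finiteType hU
  have := hU.isLocalization_basicOpen f
  refine ringKrullDim_eq_of_isLocalizationAway φ hφ (f := f) ?_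
  rintro rfl
  simp at hf

/-- Two non-empty opens of an integral scheme meet, and around a common point there is an open that
is basic in both. -/
theorem AlgSch.ringKrullDim_affineOpen_eq (Y : AlgSch k) [IsIntegral Y.sch] {U V : Y.sch.Opens}
    (hU : IsAffineOpen U) (hV : IsAffineOpen V) (hU' : (U : Set Y.sch).Nonempty)
    (hV' : (V : Set Y.sch).Nonempty) : ringKrullDim Γ(Y.sch, U) = ringKrullDim Γ(Y.sch, V) := by
  obtain ⟨x, hxU, hxV⟩ := nonempty_preirreducible_inter U.2 V.2 hU' hV'
  obtain ⟨f, g, e, hx⟩ := exists_basicOpen_le_affine_inter hU hV x ⟨hxU, hxV⟩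
  rw [← Y.ringKrullDim_basicOpen hU f ⟨x, hx⟩, e, Y.ringKrullDim_basicOpen hV g ⟨x, e ▸ hx⟩]

theorem AlgSch.topologicalKrullDim_eq_ringKrullDim (Y : AlgSch k) [IsIntegral Y.sch]
    {U : Y.sch.Opens} (hU : IsAffineOpen U) (hU' : (U : Set Y.sch).Nonempty) :
    topologicalKrullDim Y.sch = ringKrullDim Γ(Y.sch, U) := by
  refine le_antisymm (topologicalKrullDim_le_of_open_cover fun x => ?_) ?_
  · obtain ⟨_, ⟨V, hV, rfl⟩, hxV, -⟩ :=
      Y.sch.isBasis_affineOpens.exists_subset_of_mem_open (Set.mem_univ x) isOpen_univ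
    refine ⟨V, V.2, hxV, ?_⟩
    rw [Y.ringKrullDim_affineOpen_eq hU hV hU' ⟨x, hxV⟩]
    exact (topologicalKrullDim_affineOpen hV).le
  · rw [← topologicalKrullDim_affineOpen hU]
    exact topologicalKrullDim_subspace_le Y.sch U

theorem AlgSch.exists_affine (Y : AlgSch k) [Nonempty Y.sch] :
    ∃ U : Y.sch.Opens, IsAffineOpen U ∧ (U : Set Y.sch).Nonempty := by
  obtain ⟨x⟩ := ‹Nonempty Y.sch›
  obtain ⟨_, ⟨V, hV, rfl⟩, hxV, -⟩ :=
      Y.sch.isBasis_affineOpens.exists_subset_of_mem_open (Set.mem_univ x) isOpen_univ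
  exact ⟨V, hV, x, hxV⟩

theorem AlgSch.exists_dim (Y : AlgSch k) [IsIntegral Y.sch] :
    ∃ n : ℕ, topologicalKrullDim Y.sch = n := by
  obtain ⟨U, hU, hU'⟩ := Y.exists_affine
  have : Nonempty U := hU'.to_subtype
  obtain ⟨φ, hφ⟩ := Y.exists_finiteType hU
  let _ := φ.toAlgebra
  have : Algebra.FiniteType k Γ(Y.sch, U) := hφ
  obtain ⟨n, hn, -⟩ := exists_ringKrullDim_trdeg k Γ(Y.sch, U)
  exact ⟨n, (Y.topologicalKrullDim_eq_ringKrullDim hU hU').trans hn⟩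

/-- A dense open subscheme of an integral scheme has the same dimension. -/
theorem AlgSch.dim_eq_of_isOpenImmersion {V Y : AlgSch k} (j : V ⟶ Y) [IsOpenImmersion j.hom]
    [IsIntegral Y.sch] [IsIntegral V.sch] :
    topologicalKrullDim V.sch = topologicalKrullDim Y.sch := by
  obtain ⟨U, hU, hU'⟩ := V.exists_affine
  rw [V.topologicalKrullDim_eq_ringKrullDim hU hU',
    Y.topologicalKrullDim_eq_ringKrullDim (hU.image_of_isOpenImmersion j.hom)
      (hU'.image j.hom)]
  exact ringKrullDim_eq_of_ringEquiv (j.hom.appIso U).symm.commRingCatIsoToRingEquiv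

/-- A finite surjective morphism of integral schemes preserves the dimension. -/
theorem AlgSch.dim_eq_of_isFinite {V Y : AlgSch k} (f : V ⟶ Y) [IsFinite f.hom]
    [Surjective f.hom] [IsIntegral Y.sch] [IsIntegral V.sch] :
    topologicalKrullDim V.sch = topologicalKrullDim Y.sch := by
  obtain ⟨U, hU, hU'⟩ := Y.exists_affine
  rw [Y.topologicalKrullDim_eq_ringKrullDim hU hU',
    V.topologicalKrullDim_eq_ringKrullDim (hU.preimage f.hom)
      (hU'.preimage f.hom.surjective)]
  have h1 := IsFinite.finite_app (f := f.hom) U hU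
  let _ := (f.hom.app U).hom.toAlgebra
  have : Module.Finite Γ(Y.sch, U) Γ(V.sch, f.hom ⁻¹ᵁ U) := h1
  have := IsSchemeTheoreticallyDominant.of_isDominant f.hom
  exact (ringKrullDim_eq_of_isIntegral (f.hom.app_injective U)).symm

instance (Y : AlgSch k) [IsIntegral Y.sch] : IsIntegral Y.line.sch :=
  inferInstanceAs (IsIntegral 𝔸(PUnit.{u+1}; Y.sch))

/-- The morphism of affine lines induced by a morphism of schemes. -/
noncomputable def AlgSch.lineMap {V Y : AlgSch k} (f : V ⟶ Y) : V.line ⟶ Y.line :=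
  ⟨AffineSpace.map _ f.hom, by
    change AffineSpace.map _ f.hom ≫ (𝔸(PUnit.{u+1}; Y.sch) ↘ Y.sch) ≫ Y.str = _
    rw [AffineSpace.map_over_assoc, f.w]⟩

theorem AlgSch.isPullback_lineMap {V Y : AlgSch k} (f : V ⟶ Y) :
    IsPullback (lineMap f).hom V.lineProj.hom Y.lineProj.hom f.hom :=
  AffineSpace.isPullback_map f.hom

instance {V Y : AlgSch k} (f : V ⟶ Y) [IsOpenImmersion f.hom] :
    IsOpenImmersion (lineMap f).hom :=
  MorphismProperty.of_isPullback (isPullback_lineMap f).flip ‹_›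

/-- Dimension can be computed on dense opens, so the base may be taken affine, where the claim is
the dimension formula for a polynomial ring over a noetherian ring. -/
theorem AlgSch.dim_line (Y : AlgSch k) [IsIntegral Y.sch] :
    topologicalKrullDim Y.line.sch = topologicalKrullDim Y.sch + 1 := by
  obtain ⟨U, hU, hU'⟩ := Y.exists_affine
  have : Nonempty U := hU'.to_subtype
  let V : AlgSch k := Y.ofHom U.ι
  let j : V ⟶ Y := ⟨U.ι, rfl⟩
  have : IsOpenImmersion j.hom := inferInstanceAs (IsOpenImmersion U.ι)
  have : IsIntegral V.sch := inferInstanceAs (IsIntegral U.toScheme)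
  have : IsAffine V.sch := hU
  have : IsNoetherianRing Γ(V.sch, ⊤) :=
    IsLocallyNoetherian.component_noetherian ⟨⊤, isAffineOpen_top V.sch⟩
  rw [← dim_eq_of_isOpenImmersion (lineMap j), ← dim_eq_of_isOpenImmersion j]
  have h1 := (AffineSpace.isoOfIsAffine PUnit.{u+1} V.sch).hom.homeomorph.isHomeomorph
    |>.topologicalKrullDim_eq
  refine h1.trans ?_
  refine (PrimeSpectrum.topologicalKrullDim_eq_ringKrullDim
    (MvPolynomial PUnit.{u+1} Γ(V.sch, ⊤))).trans ?_
  rw [MvPolynomial.ringKrullDim_of_isNoetherianRing,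
    V.topologicalKrullDim_eq_ringKrullDim (isAffineOpen_top V.sch) Set.univ_nonempty]
  simp

namespace AlgSch

variable {X : AlgSch k}

theorem LC.dim_red (S : LC X) : topologicalKrullDim S.red.sch = topologicalKrullDim S.1 := by
  have h := S.ι.hom.isEmbedding.toHomeomorph.isHomeomorph.topologicalKrullDim_eq
  rw [h, S.range_ι]

theorem LC.isIntegral_red {S : LC X} (h : IsIrreducible S.1) : IsIntegral S.red.sch := by
  have : IrreducibleSpace S.red.sch := by
    have h1 : IsIrreducible (Set.range S.ι.hom) := by rwa [S.range_ι]
    have h2 : IrreducibleSpace (Set.range S.ι.hom) := isIrreducible_iff_irreducibleSpace.mp h1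
    exact S.ι.hom.isEmbedding.toHomeomorph.symm.surjective.irreducibleSpace
      S.ι.hom.isEmbedding.toHomeomorph.symm.continuous
  exact isIntegral_of_irreducibleSpace_of_isReduced _

theorem Nbd.isIrreducible {x : X.sch} (W : Nbd x) : IsIrreducible W.carrier := by
  refine ⟨⟨x, W.mem⟩, fun u v hu hv hu' hv' => ⟨x, W.mem, ?_, ?_⟩⟩
  · obtain ⟨z, hz, hzu⟩ := hu'
    exact (specializes_iff_mem_closure.mpr (W.subset_closure hz)).mem_open hu hzu
  · obtain ⟨z, hz, hzv⟩ := hv'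
    exact (specializes_iff_mem_closure.mpr (W.subset_closure hz)).mem_open hv hzv

instance {x : X.sch} (W : Nbd x) : IsIntegral W.lc.red.sch := LC.isIntegral_red W.isIrreducible

instance (x : X.sch) : IsIntegral (cl x).red.sch :=
  LC.isIntegral_red isIrreducible_singleton.closure

theorem Nbd.dim_red {x : X.sch} (W : Nbd x) :
    topologicalKrullDim W.lc.red.sch = topologicalKrullDim (closure {x} : Set X.sch) := by
  have := W.openIn_cl.isOpenImmersion
  rw [dim_eq_of_isOpenImmersion (LC.incl W.openIn_cl.le), LC.dim_red]
  rfl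

theorem exists_hasDim (x : X.sch) : ∃ n : ℕ, HasDim x n := by
  obtain ⟨n, hn⟩ := (cl x).red.exists_dim
  rw [LC.dim_red] at hn
  exact ⟨n, n, rfl, hn⟩

/-- The part of the affine line over `X` above `S`, compared with the affine line over `S`. -/
noncomputable def LC.toLine (S : LC X) : S.line.red ⟶ S.red.line where
  hom := (S.isPullback_lineRes.isoIsPullback _ _ (isPullback_lineMap S.ι)).hom
  w := by
    rw [← S.red.lineProj.w, ← Category.assoc, IsPullback.isoIsPullback_hom_snd, S.lineRes.w]

instance (S : LC X) : IsIso S.toLine.hom := by unfold LC.toLine; infer_instance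

@[simp]
theorem LC.toLine_lineProj (S : LC X) : S.toLine ≫ S.red.lineProj = S.lineRes :=
  hom_ext (IsPullback.isoIsPullback_hom_snd _ _ _ _)

theorem LC.dim_line {S : LC X} [IsIntegral S.red.sch] :
    topologicalKrullDim S.line.red.sch = topologicalKrullDim S.red.sch + 1 := by
  rw [← AlgSch.dim_line S.red]
  exact S.toLine.hom.homeomorph.isHomeomorph.topologicalKrullDim_eq

theorem HasDim.fibGen {x : X.sch} {p : ℤ} (h : HasDim x p) : HasDim (fibGen x) (p + 1) := by
  obtain ⟨n, rfl, hn⟩ := h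
  refine ⟨n + 1, by simp, ?_⟩
  have h1 : topologicalKrullDim (cl (AlgSch.fibGen x)).red.sch = (n + 1 : ℕ) := by
    rw [← cl_line, LC.dim_line, LC.dim_red]
    change topologicalKrullDim (closure {x} : Set X.sch) + 1 = _
    rw [hn]; simp
  rwa [LC.dim_red] at h1

end AlgSch

end Scheme

/-! ### Closed subschemes of the affine line over an affine base, by polynomials. -/

section AffineLine

variable {W V : Scheme.{u}}

/-- Evaluation of polynomials over the base in the coordinate function of a scheme over the
affine line. -/
noncomputable def lineEval (j : V ⟶ 𝔸(PUnit.{u+1}; W)) : Polynomial Γ(W, ⊤) →+* Γ(V, ⊤) :=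
  Polynomial.eval₂RingHom ((j ≫ 𝔸(PUnit.{u+1}; W) ↘ W).appTop).hom
    (j.appTop (AffineSpace.coord W PUnit.unit))

/-- Only the passage from `MvPolynomial` in one variable to `Polynomial` is involved; degrees and
leading coefficients are needed later. -/
theorem bijective_lineEval_id [IsAffine W] :
    Function.Bijective (lineEval (𝟙 𝔸(PUnit.{u+1}; W))) := by
  let e := MvPolynomial.uniqueAlgEquiv Γ(W, ⊤) PUnit.{u+1}
  let F := MvPolynomial.eval₂Hom ((𝔸(PUnit.{u+1}; W) ↘ W).appTop).hom
    (AffineSpace.coord (n := PUnit.{u+1}) W)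
  have hF : Function.Bijective F := by
    have h1 := AffineSpace.isoOfIsAffine_hom_appTop (n := PUnit.{u+1}) (S := W)
    have h2 : CommRingCat.ofHom F = (Scheme.ΓSpecIso _).inv ≫
        (AffineSpace.isoOfIsAffine PUnit.{u+1} W).hom.appTop := by
      rw [h1, Iso.inv_hom_id_assoc]
    have h3 : IsIso (AffineSpace.isoOfIsAffine PUnit.{u+1} W).hom.appTop :=
      inferInstanceAs (IsIso ((AffineSpace.isoOfIsAffine PUnit.{u+1} W).hom.app ⊤))
    have h4 : IsIso (CommRingCat.ofHom F) := h2 ▸ IsIso.comp_isIso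
    exact (ConcreteCategory.isIso_iff_bijective (CommRingCat.ofHom F)).mp h4
  have h : F = (lineEval (𝟙 𝔸(PUnit.{u+1}; W))).comp e.toRingEquiv.toRingHom := by
    refine MvPolynomial.ringHom_ext (fun r => ?_) fun i => ?_
    · simp [F, lineEval, e]
    · simp [F, lineEval, e]
  have h' : ⇑F = lineEval (𝟙 𝔸(PUnit.{u+1}; W)) ∘ e := congr(⇑$h)
  rw [h'] at hF
  exact (Function.Bijective.of_comp_iff _ e.bijective).mp hF

@[simp]
theorem lineEval_C (j : V ⟶ 𝔸(PUnit.{u+1}; W)) (r : Γ(W, ⊤)) :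
    lineEval j (Polynomial.C r) = (j ≫ 𝔸(PUnit.{u+1}; W) ↘ W).appTop r :=
  Polynomial.eval₂_C _ _

@[simp]
theorem lineEval_X (j : V ⟶ 𝔸(PUnit.{u+1}; W)) :
    lineEval j Polynomial.X = j.appTop (AffineSpace.coord W PUnit.unit) :=
  Polynomial.eval₂_X _ _

theorem lineEval_comp {V' : Scheme.{u}} (g : V' ⟶ V) (j : V ⟶ 𝔸(PUnit.{u+1}; W)) :
    lineEval (g ≫ j) = g.appTop.hom.comp (lineEval j) := by
  refine Polynomial.ringHom_ext (fun r => ?_) ?_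
  · rw [RingHom.comp_apply, lineEval_C, lineEval_C, Category.assoc, Scheme.Hom.comp_appTop]
    rfl
  · rw [RingHom.comp_apply, lineEval_X, lineEval_X, Scheme.Hom.comp_appTop]
    rfl

theorem lineEval_map {W' : Scheme.{u}} (j : V ⟶ 𝔸(PUnit.{u+1}; W')) (w : W' ⟶ W) :
    lineEval (j ≫ AffineSpace.map _ w) = (lineEval j).comp (Polynomial.mapRingHom w.appTop.hom) := by
  refine Polynomial.ringHom_ext (fun r => ?_) ?_
  · rw [RingHom.comp_apply, Polynomial.coe_mapRingHom, Polynomial.map_C, lineEval_C, lineEval_C,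
      Category.assoc, AffineSpace.map_over, ← Category.assoc, Scheme.Hom.comp_appTop]
    rfl
  · rw [RingHom.comp_apply, Polynomial.coe_mapRingHom, Polynomial.map_X, lineEval_X, lineEval_X,
      Scheme.Hom.comp_appTop, CommRingCat.comp_apply, AffineSpace.map_appTop_coord]

theorem surjective_lineEval [IsAffine W] (j : V ⟶ 𝔸(PUnit.{u+1}; W)) [IsClosedImmersion j] :
    Function.Surjective (lineEval j) := by
  have h := lineEval_comp j (𝟙 𝔸(PUnit.{u+1}; W))
  rw [Category.comp_id] at h
  rw [h]
  exact ((IsClosedImmersion.isAffine_surjective_of_isAffine j).2).comp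
    bijective_lineEval_id.2

/-- Injectivity on functions makes the closed immersion `j` an isomorphism. Contrapositively, a
proper closed subscheme `V` is killed by some non-zero polynomial, provided it is proper as a set.
-/
theorem surjective_of_injective_lineEval [IsAffine W] (j : V ⟶ 𝔸(PUnit.{u+1}; W))
    [IsClosedImmersion j] (hj : Function.Injective (lineEval j)) : Function.Surjective j := by
  have h := lineEval_comp j (𝟙 𝔸(PUnit.{u+1}; W))
  rw [Category.comp_id] at h
  have h' : ⇑(lineEval j) = j.appTop ∘ lineEval (𝟙 𝔸(PUnit.{u+1}; W)) := congr(⇑$h)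
  rw [h'] at hj
  have h2 := (Function.Injective.of_comp_iff' _ bijective_lineEval_id).mp hj
  have hV := (IsClosedImmersion.isAffine_surjective_of_isAffine j).1
  have := IsClosedImmersion.isIso_of_injective_of_isAffine h2
  exact j.surjective

theorem isFinite_of_finite_appTop [IsAffine V] [IsAffine W] (f : V ⟶ W)
    (hf : f.appTop.hom.Finite) : IsFinite f := by
  have h1 := (IsFinite.SpecMap_iff f.appTop).mpr hf
  have h2 : f = V.isoSpec.hom ≫ Spec.map f.appTop ≫ W.isoSpec.inv := by
    rw [← Category.assoc, Iso.eq_comp_inv, Scheme.isoSpec_hom_naturality]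
  rw [h2]
  infer_instance

/-- A closed subscheme of the affine line over an affine scheme on which a polynomial with
invertible leading coefficient vanishes is finite over the base. -/
theorem isFinite_of_lineEval_eq_zero [IsAffine W] (j : V ⟶ 𝔸(PUnit.{u+1}; W))
    [IsClosedImmersion j] {P : Polynomial Γ(W, ⊤)} (hP : lineEval j P = 0)
    (hu : IsUnit P.leadingCoeff) : IsFinite (j ≫ 𝔸(PUnit.{u+1}; W) ↘ W) := by
  have hV := (IsClosedImmersion.isAffine_surjective_of_isAffine j).1
  refine isFinite_of_finite_appTop _ ?_
  let φ : Γ(W, ⊤) →+* Γ(V, ⊤) := ((j ≫ 𝔸(PUnit.{u+1}; W) ↘ W).appTop).hom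
  obtain ⟨c, hc⟩ := hu
  -- Dividing by the leading coefficient gives a monic equation for the coordinate function, which
  -- generates the functions on `V` over the base.
  let Q : Polynomial Γ(W, ⊤) := Polynomial.C (↑c⁻¹ : Γ(W, ⊤)) * P
  have hQ : Q.Monic := by
    rw [Polynomial.Monic, Polynomial.leadingCoeff_C_mul_of_isUnit c⁻¹.isUnit, ← hc, Units.inv_mul]
  have hQ0 : lineEval j Q = 0 := by simp [Q, hP]
  have hint : φ.IsIntegralElem (lineEval j Polynomial.X) := ⟨Q, hQ, by
    rw [← hQ0, lineEval_X]
    rfl⟩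
  have hfin : φ.FiniteType := by
    have h1 : φ = (lineEval j).comp Polynomial.C := RingHom.ext fun r => (lineEval_C j r).symm
    rw [h1]
    refine RingHom.FiniteType.comp_surjective ?_ (surjective_lineEval j)
    rw [← Polynomial.algebraMap_eq, RingHom.finiteType_algebraMap]
    infer_instance
  refine RingHom.IsIntegral.to_finite (fun s => ?_) hfin
  obtain ⟨p, rfl⟩ := surjective_lineEval j s
  induction p using Polynomial.induction_on' with
  | add p q hp hq => rw [map_add]; exact hp.add _ hq
  | monomial n a =>
    rw [← Polynomial.C_mul_X_pow_eq_monomial, map_mul, map_pow]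
    refine RingHom.IsIntegralElem.mul _ ?_ ?_
    · rw [lineEval_C]
      exact RingHom.isIntegralElem_map _
    · induction n with
      | zero => rw [pow_zero]; exact RingHom.isIntegralElem_one _
      | succ n ih => rw [pow_succ]; exact ih.mul _ hint

end AffineLine


/-! ### Spreading out: points closed in their fibre are finite over the base. -/

namespace AlgSch

variable {X : AlgSch k}

theorem LC.mem_ι {S : LC X} (s : S.red.sch) : S.ι.hom s ∈ S.1 := by
  rw [← S.range_ι]; exact ⟨s, rfl⟩

theorem lineMap_comp {V W Y : AlgSch k} (f : V ⟶ W) (g : W ⟶ Y) :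
    lineMap (f ≫ g) = lineMap f ≫ lineMap g := hom_ext (AffineSpace.map_comp _ _)

theorem LC.toLine_lineMap (S : LC X) : S.toLine ≫ lineMap S.ι = S.line.ι :=
  hom_ext (IsPullback.isoIsPullback_hom_fst _ _ _ _)

instance {S : LC X} : IsImmersion (lineMap S.ι).hom :=
  MorphismProperty.of_isPullback (isPullback_lineMap S.ι).flip inferInstance

theorem LC.toLine_naturality {S T : LC X} (h : S ≤ T) :
    S.toLine ≫ lineMap (incl h) = incl (line_mono h) ≫ T.toLine := by
  have : ((S.toLine ≫ lineMap (incl h)) ≫ lineMap T.ι) =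
      (incl (line_mono h) ≫ T.toLine) ≫ lineMap T.ι := by
    rw [Category.assoc, ← lineMap_comp, incl_ι, toLine_lineMap, Category.assoc, toLine_lineMap,
      incl_ι]
  refine hom_ext ?_
  rw [← cancel_mono (lineMap T.ι).hom]
  exact congr($(this).hom)

/-- Open subsets of a neighbourhood of `x` are neighbourhoods. -/
theorem Nbd.exists_of_opens {x : X.sch} (W : Nbd x) (O : W.lc.red.sch.Opens)
    (hO : (O : Set W.lc.red.sch).Nonempty) :
    ∃ (W' : Nbd x) (h : W ≤ W'), Set.range (LC.incl (Nbd.openIn h).le).hom = O := by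
  obtain ⟨O₁, hO₁, e⟩ := W.lc.ι.hom.isEmbedding.isInducing.isOpen_iff.mp O.2
  obtain ⟨o, ho⟩ := hO
  obtain ⟨V, hV, eV⟩ := W.exists_open
  have ho₁ : W.lc.ι.hom o ∈ O₁ := e.symm.subset ho
  have hx : x ∈ O₁ :=
    (specializes_iff_mem_closure.mpr (W.subset_closure (LC.mem_ι o))).mem_open hO₁ ho₁
  refine ⟨⟨O₁ ∩ W.carrier, ⟨hx, W.mem⟩, O₁ ∩ V, hO₁.inter hV, by rw [eV, Set.inter_assoc]⟩,
    Set.inter_subset_right, ?_⟩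
  rw [LC.range_incl]
  refine Eq.trans ?_ e
  exact Set.Subset.antisymm (fun s hs => hs.1) fun s hs => ⟨hs, LC.mem_ι s⟩

theorem isAffine_of_range_eq {V Y : Scheme.{u}} (f : V ⟶ Y) [IsOpenImmersion f] {O : Y.Opens}
    (hO : IsAffineOpen O) (h : Set.range f = O) : IsAffine V := by
  have h1 : f.opensRange = O := Opens.ext h
  have : IsAffine f.opensRange := h1 ▸ hO
  exact .of_isIso f.isoOpensRange.hom

theorem Nbd.exists_affine (x : X.sch) : ∃ W : Nbd x, IsAffine W.lc.red.sch := by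
  obtain ⟨W⟩ := (inferInstance : Nonempty (Nbd x))
  obtain ⟨O, hO, hO'⟩ := W.lc.red.exists_affine
  obtain ⟨W', h, e⟩ := W.exists_of_opens O hO'
  have := (Nbd.openIn h).isOpenImmersion
  exact ⟨W', isAffine_of_range_eq _ hO e⟩

/-- The part of a neighbourhood of a point of the affine line which lies above `W`. -/
def Nbd.over {x : X.sch} {y : X.line.sch} (U : Nbd y) (W : Nbd x) (h : X.lineProj.hom y = x) :
    Nbd y :=
  ⟨U.carrier ∩ X.lineProj.hom ⁻¹' W.carrier, ⟨U.mem, by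
    change X.lineProj.hom y ∈ W.carrier
    rw [h]; exact W.mem⟩, by
    obtain ⟨O, hO, e⟩ := U.exists_open
    obtain ⟨O', hO', e'⟩ := W.exists_open
    refine ⟨O ∩ X.lineProj.hom ⁻¹' O', hO.inter (hO'.preimage X.lineProj.hom.continuous), ?_⟩
    rw [e, e', Set.preimage_inter]
    refine Set.Subset.antisymm (fun z hz => ⟨⟨hz.1.1, hz.2.1⟩, hz.1.2⟩)
      fun z hz => ⟨⟨hz.1.1, hz.2⟩, hz.1.2, ?_⟩
    subst h
    have h1 : X.lineProj.hom y ∈ closure {X.lineProj.hom y} := _root_.subset_closure rfl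
    exact closure_minimal (s := {y}) (by simpa using h1) (isClosed_linePreimage_closure _) hz.2⟩

section Over

variable {x : X.sch} {y : X.line.sch} (U : Nbd y) (W : Nbd x) (h : X.lineProj.hom y = x)

theorem Nbd.le_over : U ≤ U.over W h := Set.inter_subset_left

theorem Nbd.over_le_line : (U.over W h).lc ≤ W.lc.line := Set.inter_subset_right

/-- The projection from the part of `U` above `W` to `W`. -/
noncomputable def Nbd.overProj : (U.over W h).lc.red ⟶ W.lc.red :=
  LC.incl (U.over_le_line W h) ≫ W.lc.lineRes

/-- The morphism from the part of `U` above `W` to the affine line over `W`. -/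
noncomputable def Nbd.overLine : (U.over W h).lc.red ⟶ W.lc.red.line :=
  LC.incl (U.over_le_line W h) ≫ W.lc.toLine

theorem Nbd.overLine_lineProj : U.overLine W h ≫ W.lc.red.lineProj = U.overProj W h := by
  rw [overLine, Category.assoc, LC.toLine_lineProj, overProj]

end Over

theorem Nbd.over_mono {x : X.sch} {y : X.line.sch} (U : Nbd y) {W W' : Nbd x} (h : W ≤ W')
    (hy : X.lineProj.hom y = x) : U.over W hy ≤ U.over W' hy :=
  Set.inter_subset_inter_right _ (Set.preimage_mono h)

theorem Nbd.overLine_naturality {x : X.sch} {y : X.line.sch} (U : Nbd y) {W W' : Nbd x}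
    (h : W ≤ W') (hy : X.lineProj.hom y = x) :
    U.overLine W' hy ≫ lineMap (LC.incl (Nbd.openIn h).le) =
      LC.incl (Nbd.openIn (U.over_mono h hy)).le ≫ U.overLine W hy := by
  rw [overLine, overLine, Category.assoc, LC.toLine_naturality, ← Category.assoc, ← Category.assoc,
    LC.incl_comp, LC.incl_comp]

/-- The closure of a point. -/
def Nbd.top (x : X.sch) : Nbd x :=
  ⟨closure {x}, _root_.subset_closure rfl, Set.univ, isOpen_univ, by simp⟩

theorem isUnit_appTop_of_range_subset {V Y : Scheme.{u}} (f : V ⟶ Y) (c : Γ(Y, ⊤))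
    (h : Set.range f ⊆ Y.basicOpen c) : IsUnit (f.appTop c) := by
  have h1 : ∀ v, v ∈ V.basicOpen (f.appTop c) := fun v => by
    rw [← Scheme.preimage_basicOpen_top]
    exact h ⟨v, rfl⟩
  exact V.toLocallyRingedSpace.toRingedSpace.isUnit_of_isUnit_germ ⊤ _ fun v hv =>
    (V.mem_basicOpen_top _ v).mp (h1 v)

theorem Nbd.isClosedImmersion_overLine {x : X.sch} {y : X.line.sch} (U : Nbd y) (W : Nbd x)
    (hy : X.lineProj.hom y = x) {F : Set X.line.sch} (hF : IsClosed F)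
    (h : (U.over W hy).carrier = F ∩ W.lc.line.1) : IsClosedImmersion (U.overLine W hy).hom := by
  have h1 : IsClosedImmersion (LC.incl (U.over_le_line W hy)).hom := by
    refine LC.isClosedImmersion_incl _ ?_
    have : (U.over W hy).lc.1 = F ∩ W.lc.line.1 := h
    rw [this, Set.preimage_inter]
    have h2 : W.lc.line.ι.hom ⁻¹' W.lc.line.1 = Set.univ :=
      Set.eq_univ_of_forall fun z => LC.mem_ι z
    rw [h2, Set.inter_univ]
    exact hF.preimage W.lc.line.ι.hom.continuous
  rw [overLine, comp_hom]
  infer_instance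

/-- Over an affine `W`, the closure of `y` is a proper closed subset of the line, as it misses
`fibGen x`; hence a non-zero polynomial vanishes on it. Inverting its leading coefficient shrinks
`W` and makes the projection finite. -/
theorem exists_isFinite_overProj {x : X.sch} {y : X.line.sch} (hy : X.lineProj.hom y = x)
    (hne : y ≠ fibGen x) : ∃ W : Nbd x, IsFinite ((Nbd.top y).overProj W hy).hom := by
  obtain ⟨W, hW⟩ := Nbd.exists_affine x
  let j := ((Nbd.top y).overLine W hy).hom
  have hcl : ∀ W : Nbd x, IsClosedImmersion ((Nbd.top y).overLine W hy).hom := fun W =>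
    (Nbd.top y).isClosedImmersion_overLine W hy isClosed_closure rfl
  -- If no non-zero polynomial vanished, the closure of `y` would fill the line over `W`, so `fibGen
  -- x` would be a specialization of `y`. Since `y` is a specialization of `fibGen x`, the two would
  -- coincide.
  have hj : ¬ Function.Injective (lineEval j) := fun hinj => by
    have := hcl W
    have hs := surjective_of_injective_lineEval j hinj
    have hs' : Function.Surjective (LC.incl ((Nbd.top y).over_le_line W hy)).hom := by
      have h1 : ⇑j = W.lc.toLine.hom ∘ (LC.incl ((Nbd.top y).over_le_line W hy)).hom := rfl
      rw [h1] at hs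
      exact (Function.Surjective.of_comp_iff' W.lc.toLine.hom.homeomorph.bijective _).mp hs
    have h2 : fibGen x ∈ W.lc.line.1 := W.line.mem
    rw [← W.lc.line.range_ι] at h2
    obtain ⟨z, hz⟩ := h2
    obtain ⟨v, rfl⟩ := hs' z
    have h3 : (LC.ι _).hom v = fibGen x := (congr($(LC.incl_hom_ι
      ((Nbd.top y).over_le_line W hy)) v).symm.trans hz)
    have h4 : fibGen x ∈ closure {y} := h3 ▸ (LC.mem_ι v).1
    refine hne (eq_of_mem_closure (mem_closure_fibGen.mpr ?_) h4)
    rw [hy]; exact _root_.subset_closure rfl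
  rw [injective_iff_map_eq_zero] at hj
  push Not at hj
  obtain ⟨P, hP, hP0⟩ := hj
  let c := P.leadingCoeff
  have hc : c ≠ 0 := by simpa [c] using hP0
  -- The locus where `c` is invertible is non-empty because `W` is integral and `c` is non-zero, so
  -- it contains `x`.
  obtain ⟨W', hWW', hr⟩ := W.exists_of_opens (W.lc.red.sch.basicOpen c) (by
    rw [Set.nonempty_iff_ne_empty]
    intro he
    exact hc ((basicOpen_eq_bot_iff c).mp (Opens.ext he)))
  have : IsOpenImmersion (LC.incl (Nbd.openIn hWW').le).hom := (Nbd.openIn hWW').isOpenImmersion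
  have : IsAffine W'.lc.red.sch := isAffine_of_range_eq _
    ((isAffineOpen_top W.lc.red.sch).basicOpen c) hr
  have hu : IsUnit ((LC.incl (Nbd.openIn hWW').le).hom.appTop c) :=
    isUnit_appTop_of_range_subset _ _ hr.subset
  refine ⟨W', ?_⟩
  rw [← Nbd.overLine_lineProj]
  have := hcl W'
  refine isFinite_of_lineEval_eq_zero ((Nbd.top y).overLine W' hy).hom
    (P := P.map (LC.incl (Nbd.openIn hWW').le).hom.appTop.hom) ?_ ?_
  · have h1 := (Nbd.top y).overLine_naturality hWW' hy
    have h2 := lineEval_map ((Nbd.top y).overLine W' hy).hom (LC.incl (Nbd.openIn hWW').le).hom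
    have h3 := lineEval_comp (LC.incl (Nbd.openIn ((Nbd.top y).over_mono hWW' hy)).le).hom j
    have h4 : ((Nbd.top y).overLine W' hy).hom ≫ AffineSpace.map _ (LC.incl (Nbd.openIn hWW').le).hom
      = (LC.incl (Nbd.openIn ((Nbd.top y).over_mono hWW' hy)).le).hom ≫ j := congr($(h1).hom)
    rw [h4, h3] at h2
    have h5 := congr($h2 P)
    simp only [RingHom.comp_apply, hP, map_zero] at h5
    exact h5.symm
  · rw [Polynomial.leadingCoeff_map_of_leadingCoeff_ne_zero]
    · exact hu
    · exact hu.ne_zero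

end AlgSch

/-! ### Dimension and smoothness of the closure of a point closed in its fibre. -/

namespace AlgSch

variable {X : AlgSch k}

theorem LC.exists_ι_eq {S : LC X} {y : X.sch} (hy : y ∈ S.1) : ∃ s : S.red.sch, S.ι.hom s = y := by
  rwa [← S.range_ι] at hy

theorem Nbd.ι_overProj {x : X.sch} {y : X.line.sch} (U : Nbd y) (W : Nbd x)
    (hy : X.lineProj.hom y = x) (v : (U.over W hy).lc.red.sch) :
    W.lc.ι.hom ((U.overProj W hy).hom v) = X.lineProj.hom ((U.over W hy).lc.ι.hom v) := by
  have h : U.overProj W hy ≫ W.lc.ι = (U.over W hy).lc.ι ≫ X.lineProj := by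
    rw [overProj, Category.assoc, LC.lineRes_ι, LC.incl_ι_assoc]
  exact congr($(h).hom v)

/-- Near the image of `y`, the closure of `y` is finite over the base. Its fibres are discrete
there, so they contain no proper specializations. -/
theorem eq_of_mem_closure_of_lineProj_eq {y z : X.line.sch} (hne : y ≠ fibGen (X.lineProj.hom y))
    (hz : z ∈ closure {y}) (hzy : X.lineProj.hom z = X.lineProj.hom y) : z = y := by
  obtain ⟨W, hW⟩ := exists_isFinite_overProj rfl hne
  let f := ((Nbd.top y).overProj W rfl).hom
  obtain ⟨v, hv⟩ := LC.exists_ι_eq (S := ((Nbd.top y).over W rfl).lc)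
    ((Nbd.top y).over W rfl).mem
  obtain ⟨w, hw⟩ := LC.exists_ι_eq (S := ((Nbd.top y).over W rfl).lc) (y := z)
    ⟨hz, by change X.lineProj.hom z ∈ W.carrier; rw [hzy]; exact W.mem⟩
  have hfw : f w = f v := W.lc.ι.hom.isEmbedding.injective (by
    rw [Nbd.ι_overProj, Nbd.ι_overProj, hv, hw, hzy])
  obtain ⟨O, hO, e⟩ := isDiscrete_iff_forall_mem_exists_isOpen.mp
    (f.isDiscrete_preimage_singleton (f v)) w hfw
  have hvw : v ⤳ w := by
    rw [← ((Nbd.top y).over W rfl).lc.ι.hom.isEmbedding.isInducing.specializes_iff, hv, hw]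
    exact specializes_iff_mem_closure.mpr hz
  have hvO : v ∈ O ∩ f ⁻¹' {f v} :=
    ⟨hvw.mem_open hO (e.symm.subset (Set.mem_singleton w)).1, rfl⟩
  rw [e] at hvO
  rw [← hv, ← hw, hvO]

theorem isPullback_overProj {x : X.sch} {y : X.line.sch} (U : Nbd y) {W W' : Nbd x} (h : W ≤ W')
    (hy : X.lineProj.hom y = x) :
    IsPullback (LC.incl (Nbd.openIn (U.over_mono h hy)).le).hom (U.overProj W' hy).hom
      (U.overProj W hy).hom (LC.incl (Nbd.openIn h).le).hom := by
  refine IsPullback.paste_vert (LC.isPullback_incl (U.over_le_line W hy) (Nbd.openIn h).line _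
    (U.over_le_line W' hy) fun z hz => ⟨hz.1.1, hz.2⟩) ?_
  exact LC.isPullback_line_incl (Nbd.openIn h).le

theorem isFinite_overProj_of_le {x : X.sch} {y : X.line.sch} (U : Nbd y) {W W' : Nbd x}
    (h : W ≤ W') (hy : X.lineProj.hom y = x) (hW : IsFinite (U.overProj W hy).hom) :
    IsFinite (U.overProj W' hy).hom :=
  MorphismProperty.of_isPullback (isPullback_overProj U h hy) hW

theorem isFinite_overProj_congr {x : X.sch} {y : X.line.sch} {U U' : Nbd y} {W : Nbd x}
    {hy : X.lineProj.hom y = x} (h : (U.over W hy).carrier = (U'.over W hy).carrier)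
    (hU : IsFinite (U.overProj W hy).hom) : IsFinite (U'.overProj W hy).hom := by
  have key : ∀ {S S' : LC X.line} (hS : S ≤ W.lc.line) (hS' : S' ≤ W.lc.line), S = S' →
      IsFinite (LC.incl hS ≫ W.lc.lineRes).hom → IsFinite (LC.incl hS' ≫ W.lc.lineRes).hom := by
    rintro S _ hS hS' rfl h
    exact h
  exact key (U.over_le_line W hy) (U'.over_le_line W hy) (LC.ext h) hU

/-- A finite projection from an irreducible subset of the line is surjective. -/
theorem surjective_overProj {x : X.sch} {y : X.line.sch} (U : Nbd y) (W : Nbd x)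
    (hy : X.lineProj.hom y = x) [IsFinite (U.overProj W hy).hom] :
    Surjective (U.overProj W hy).hom := by
  refine ⟨fun w => ?_⟩
  have hcl := (U.overProj W hy).hom.isClosedMap.isClosed_range
  obtain ⟨v, hv⟩ := LC.exists_ι_eq (S := (U.over W hy).lc) (U.over W hy).mem
  have h1 : W.lc.ι.hom ((U.overProj W hy).hom v) = x := by rw [Nbd.ι_overProj, hv, hy]
  have h2 : (U.overProj W hy).hom v ⤳ w := by
    rw [← W.lc.ι.hom.isEmbedding.isInducing.specializes_iff, h1]
    exact specializes_iff_mem_closure.mpr (W.subset_closure (LC.mem_ι w))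
  exact h2.mem_closed hcl ⟨v, rfl⟩

/-- Dense open parts of the closures of `y` and of its image are related by a finite surjective
morphism, which preserves dimension. -/
theorem HasDim.of_lineProj {y : X.line.sch} (hne : y ≠ AlgSch.fibGen (X.lineProj.hom y)) {p : ℤ}
    (h : HasDim (X.lineProj.hom y) p) : HasDim y p := by
  obtain ⟨W, hW⟩ := exists_isFinite_overProj rfl hne
  have := surjective_overProj (Nbd.top y) W rfl
  obtain ⟨n, hn, e⟩ := h
  refine ⟨n, hn, ?_⟩
  rw [← e, ← W.dim_red, ← ((Nbd.top y).over W rfl).dim_red]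
  exact dim_eq_of_isFinite ((Nbd.top y).overProj W rfl)

theorem smooth_of_isOpenImmersion {V Y : AlgSch k} (j : V ⟶ Y) [IsOpenImmersion j.hom]
    [Smooth Y.str] : Smooth V.str := by
  rw [← j.w]; infer_instance

/-- Perfectness of `k` enters here: it makes the smooth locus of a reduced scheme dense. -/
theorem exists_smooth_opens [PerfectField k] (Y : AlgSch k) [IsReduced Y.sch] [Nonempty Y.sch] :
    ∃ O : Y.sch.Opens, (O : Set Y.sch).Nonempty ∧
      ∀ (V : AlgSch k) (j : V ⟶ Y) [IsOpenImmersion j.hom], Set.range j.hom ⊆ O → Smooth V.str := by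
  have : LocallyOfFinitePresentation Y.str := inferInstance
  refine ⟨Y.str.smoothLocus, Y.str.dense_smoothLocus_of_perfectField.nonempty, fun V j _ h => ?_⟩
  rw [← j.w, ← Scheme.Hom.smoothLocus_eq_top_iff, ← Scheme.Hom.preimage_smoothLocus_eq]
  exact top_le_iff.mp fun v _ => h ⟨v, rfl⟩

theorem Nbd.exists_smooth [PerfectField k] {y : X.sch} (U : Nbd y) :
    ∃ U', U ≤ U' ∧ Smooth U'.lc.red.str := by
  obtain ⟨O, hO, h⟩ := U.lc.red.exists_smooth_opens
  obtain ⟨U', hU, e⟩ := U.exists_of_opens O hO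
  have := (Nbd.openIn hU).isOpenImmersion
  exact ⟨U', hU, h _ (LC.incl (Nbd.openIn hU).le) e.subset⟩

/-- Neighbourhoods of `y` in its closure can be controlled from the base: what a smooth
neighbourhood `U'` omits from the closure of `y` contains no point above `x`, so it disappears after
shrinking `W`. The part of `U` above `W` is then closed in the line over `W`, and inherits
smoothness from `U'` and finiteness from the full closure of `y`. -/
theorem exists_isFinite_smooth_over [PerfectField k] {x : X.sch} {y : X.line.sch}
    (hy : X.lineProj.hom y = x) (hne : y ≠ fibGen x) (U : Nbd y) :
    ∃ W₀ : Nbd x, ∀ W, W₀ ≤ W → (U.over W hy).carrier = closure {y} ∩ W.lc.line.1 ∧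
      IsFinite (U.overProj W hy).hom ∧ Smooth (U.over W hy).lc.red.str := by
  subst hy
  obtain ⟨U', hU, hs⟩ := U.exists_smooth
  obtain ⟨W₁, hW₁⟩ := exists_isFinite_overProj rfl hne
  have hcl : IsClosed (closure {y} \ U'.carrier) := by
    obtain ⟨O, hO, e⟩ := U'.exists_open
    have : closure {y} \ U'.carrier = closure {y} \ O := by
      ext z; simp only [e, Set.mem_sdiff, Set.mem_inter_iff]; tauto
    rw [this]
    exact isClosed_closure.sdiff hO
  obtain ⟨W₂, hW₂⟩ := exists_nbd_disjoint X.lineProj (x := X.lineProj.hom y) hcl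
    (fun z hz => ((specializes_iff_mem_closure.mpr hz.1).map X.lineProj.hom.continuous).mem_closure)
    (fun z hz hzy => hz.2 (eq_of_mem_closure_of_lineProj_eq hne hz.1 hzy ▸ U'.mem))
  refine ⟨W₁.inter W₂, fun W hW => ?_⟩
  have h₁ : W₁ ≤ W := (Nbd.le_inter_left W₁ W₂).trans hW
  have h₂ : W₂ ≤ W := (Nbd.le_inter_right W₁ W₂).trans hW
  have e' : closure {y} ∩ W.lc.line.1 ⊆ U'.carrier := fun z hz => by
    by_contra hzU
    exact hW₂ z ⟨hz.1, hzU⟩ (h₂ hz.2)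
  have e : (U.over W rfl).carrier = closure {y} ∩ W.lc.line.1 :=
    Set.Subset.antisymm (fun z hz => ⟨U.subset_closure hz.1, hz.2⟩)
      fun z hz => ⟨hU (e' hz), hz.2⟩
  refine ⟨e, isFinite_overProj_congr (U := Nbd.top y) e.symm
    (isFinite_overProj_of_le _ h₁ rfl hW₁), ?_⟩
  have h : U' ≤ U.over W rfl := fun z hz => e' (e.subset hz)
  have := (Nbd.openIn h).isOpenImmersion
  exact smooth_of_isOpenImmersion (LC.incl (Nbd.openIn h).le)

end AlgSch

/-! ### Formal consequences of the homology axioms for locally closed subsets. -/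

/-- `T` is the union of its closed subset `C` and its open subset `W`, which are disjoint. -/
structure AlgSch.LC.Split {X : AlgSch k} (C W T : LC X) : Prop where
  le : C ≤ T
  opn : W.OpenIn T
  eq : C.1 = T.1 \ W.1

theorem AlgSch.LC.Split.pair {X : AlgSch k} {C W T : LC X} (h : LC.Split C W T) :
    IsClosedOpenPair (LC.incl h.le) (LC.incl h.opn.le) := LC.isClosedOpenPair h.le h.opn h.eq

theorem AlgSch.LC.split_diff {X : AlgSch k} {W T : LC X} (h : W.OpenIn T) :
    LC.Split (T.diff W h) W T := ⟨T.diff_le W h, h, rfl⟩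

theorem AlgSch.LC.OpenIn.inter_left {X : AlgSch k} {T T' : LC X} (hT : T'.OpenIn T) {S : LC X}
    (h : S ≤ T) : (S.inter T').OpenIn S := by
  obtain ⟨U, hU, e⟩ := hT
  refine ⟨U, hU, ?_⟩
  change S.1 ∩ T'.1 = _
  rw [e, Set.inter_comm U, ← Set.inter_assoc, Set.inter_eq_left.mpr h, Set.inter_comm]

theorem AlgSch.LC.OpenIn.of_self {X : AlgSch k} {S T : LC X} (h : S.OpenIn T) : S.OpenIn S :=
  h.of_le le_rfl h.le

theorem isProper_id (Y : AlgSch k) : IsProper (AlgSch.Hom.hom (𝟙 Y)) := by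
  rw [id_hom]; infer_instance

theorem etale_id (Y : AlgSch k) : Etale (AlgSch.Hom.hom (𝟙 Y)) := by
  rw [id_hom]; infer_instance

namespace TwistedHomologyTheory

variable (T : TwistedHomologyTheory.{u, v} k) {X : AlgSch k}

theorem push_congr {X' X : AlgSch k} {f g : X' ⟶ X} (h : f = g) (hf : IsProper f.hom)
    (hg : IsProper g.hom) (a b : ℤ) (x : T.H X' a b) : T.push f hf a b x = T.push g hg a b x := by
  subst h
  rfl

/-- The homology of the empty scheme vanishes. -/
theorem subsingleton_of_isEmpty (Y : AlgSch k) [IsEmpty Y.sch] (a b : ℤ) :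
    Subsingleton (T.H Y a b) := by
  -- On the empty scheme the identity is both the closed and the open part. Since its push-forward
  -- is the identity, exactness forces restriction and boundary to vanish; exactness between these
  -- two then kills the group.
  have h : IsClosedOpenPair (𝟙 Y) (𝟙 Y) :=
    ⟨by rw [id_hom]; infer_instance, by rw [id_hom]; infer_instance, Subsingleton.elim _ _⟩
  have h1 : ∀ a (x : T.H Y a b), T.pull (𝟙 Y) h.etale a b x = 0 := fun a x => by
    have := (T.exact_push_pull _ _ h a b).apply_apply_eq_zero x
    rwa [T.push_id] at this
  refine ⟨fun x y => ?_⟩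
  have h2 : ∀ x : T.H Y a b, x = 0 := fun x => by
    have h3 : T.bdry _ _ h a (a - 1) b (by ring) x = 0 := by
      have := (T.exact_bdry_push _ _ h a (a - 1) b (by ring)).apply_apply_eq_zero x
      rwa [T.push_id] at this
    obtain ⟨z, rfl⟩ := (T.exact_pull_bdry _ _ h a (a - 1) b (by ring) x).mp h3
    exact h1 a z
  rw [h2 x, h2 y]

theorem isClosedOpenPair_empty (X : AlgSch k) :
    ∃ S : LC X, S.1 = ∅ ∧ IsEmpty S.red.sch ∧ IsClosedOpenPair S.ι (𝟙 X) := by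
  let S : LC X := ⟨∅, isClosed_empty.isLocallyClosed⟩
  refine ⟨S, rfl, ⟨fun s => LC.mem_ι s⟩, ?_, ?_, ?_⟩
  · exact .of_isPreimmersion _ (by rw [S.range_ι]; exact isClosed_empty)
  · rw [id_hom]; infer_instance
  · rw [S.range_ι]
    change Set.range (fun x => x) = _
    simp [S]

/-- The axioms give composition of étale pull-backs but no identity law. Pull-back along the
identity is idempotent, and it is injective by the localization sequence with empty closed part, so
it is the identity. -/
theorem pull_id (h : Etale (AlgSch.Hom.hom (𝟙 X))) (a b : ℤ) (x : T.H X a b) :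
    T.pull (𝟙 X) h a b x = x := by
  obtain ⟨S, -, hS, hp⟩ := isClosedOpenPair_empty X
  have := T.subsingleton_of_isEmpty S.red a b
  have h1 := T.pull_comp (𝟙 X) (𝟙 X) h h (by rwa [Category.comp_id]) a b x
  rw [T.pull_congr (Category.comp_id (𝟙 X)) _ h] at h1
  have h2 : T.pull (𝟙 X) h a b (x - T.pull (𝟙 X) h a b x) = 0 := by
    rw [map_sub, ← h1, sub_self]
  obtain ⟨z, hz⟩ := (T.exact_push_pull _ _ hp a b _).mp h2
  rw [Subsingleton.elim z 0, map_zero] at hz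
  exact (sub_eq_zero.mp hz.symm).symm

theorem push_bijective_of_inverse {Y Y' : AlgSch k} (f : Y ⟶ Y') (g : Y' ⟶ Y) (h : f ≫ g = 𝟙 _)
    (h' : g ≫ f = 𝟙 _) (hf : IsProper f.hom) (hg : IsProper g.hom) (a b : ℤ) :
    Function.Bijective (T.push f hf a b) := by
  refine Function.bijective_iff_has_inverse.mpr ⟨T.push g hg a b, fun x => ?_, fun x => ?_⟩
  · rw [← T.push_comp f g hf hg (h ▸ isProper_id _), T.push_congr h _ (isProper_id _), T.push_id]
  · rw [← T.push_comp g f hg hf (h' ▸ isProper_id _), T.push_congr h' _ (isProper_id _), T.push_id]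

theorem pull_bijective_of_inverse {Y Y' : AlgSch k} (f : Y ⟶ Y') (g : Y' ⟶ Y) (h : f ≫ g = 𝟙 _)
    (h' : g ≫ f = 𝟙 _) (hf : Etale f.hom) (hg : Etale g.hom) (a b : ℤ) :
    Function.Bijective (T.pull f hf a b) := by
  refine Function.bijective_iff_has_inverse.mpr ⟨T.pull g hg a b, fun x => ?_, fun x => ?_⟩
  · rw [← T.pull_comp g f hg hf (h' ▸ etale_id _), T.pull_congr h' _ (etale_id _), T.pull_id]
  · rw [← T.pull_comp f g hf hg (h ▸ etale_id _), T.pull_congr h _ (etale_id _), T.pull_id]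

/-- Push-forward along a closed inclusion of locally closed subsets. -/
noncomputable def pushLC {S S' : LC X} (h : S ≤ S') (hp : IsProper (LC.incl h).hom) (a b : ℤ) :
    T.H S.red a b →+ T.H S'.red a b := T.push (LC.incl h) hp a b

/-- The boundary map of a decomposition of a locally closed subset. -/
noncomputable def bdryLC {C W S : LC X} (h : LC.Split C W S) (a a' b : ℤ) (ha : a = a' + 1) :
    T.H W.red a b →+ T.H C.red a' b := T.bdry _ _ h.pair a a' b ha

theorem exact_pushLC_res {C W S : LC X} (h : LC.Split C W S) (a b : ℤ) :
    Function.Exact (T.pushLC h.le h.pair.proper a b) (T.res h.opn a b) :=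
  T.exact_push_pull _ _ h.pair a b

theorem exact_res_bdryLC {C W S : LC X} (h : LC.Split C W S) (a a' b : ℤ) (ha : a = a' + 1) :
    Function.Exact (T.res h.opn a b) (T.bdryLC h a a' b ha) :=
  T.exact_pull_bdry _ _ h.pair a a' b ha

theorem exact_bdryLC_pushLC {C W S : LC X} (h : LC.Split C W S) (a a' b : ℤ) (ha : a = a' + 1) :
    Function.Exact (T.bdryLC h a a' b ha) (T.pushLC h.le h.pair.proper a' b) :=
  T.exact_bdry_push _ _ h.pair a a' b ha

theorem res_self {S : LC X} (h : S.OpenIn S) (a b : ℤ) (x : T.H S.red a b) :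
    T.res h a b x = x :=
  (T.pull_congr (LC.incl_refl S) _ (etale_id _) a b x).trans (T.pull_id _ a b x)

theorem pushLC_self {S : LC X} (h : S ≤ S) (hp : IsProper (LC.incl h).hom) (a b : ℤ)
    (x : T.H S.red a b) : T.pushLC h hp a b x = x :=
  (T.push_congr (LC.incl_refl S) _ (isProper_id _) a b x).trans (T.push_id _ _ a b x)

theorem res_pushLC {S V S' R : LC X} (h : S ≤ S') (hp : IsProper (LC.incl h).hom)
    (hV : V.OpenIn S') (hR : R.OpenIn S) (hRV : R ≤ V) (hp' : IsProper (LC.incl hRV).hom)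
    (e : S.1 ∩ V.1 ⊆ R.1) (a b : ℤ) (x : T.H S.red a b) :
    T.res hV a b (T.pushLC h hp a b x) = T.pushLC hRV hp' a b (T.res hR a b x) :=
  T.pull_push _ _ _ _ (LC.isPullback_incl h hV hR.le hRV e) hp hp' hV.etale hR.etale a b x

theorem res_pushLC_of_openIn {S V S' : LC X} (h : S ≤ S') (hp : IsProper (LC.incl h).hom)
    (hS : S.OpenIn S') (hV : V.OpenIn S) (hVS : V.OpenIn S') (a b : ℤ) (x : T.H S.red a b) :
    T.res hVS a b (T.pushLC h hp a b x) = T.res hV a b x := by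
  have hid : IsProper (LC.incl (le_refl S)).hom := by rw [LC.incl_refl]; exact isProper_id _
  rw [← T.res_res hS hV, T.res_pushLC h hp hS hS.of_self (le_refl S) hid fun _ hx => hx.1,
    T.pushLC_self, T.res_self]

theorem res_pushLC_of_disjoint {S V S' : LC X} (h : S ≤ S') (hp : IsProper (LC.incl h).hom)
    (hV : V.OpenIn S') (hd : Disjoint S.1 V.1) (a b : ℤ) (x : T.H S.red a b) :
    T.res hV a b (T.pushLC h hp a b x) = 0 := by
  have hR := hV.inter_left h
  have : IsEmpty (S.inter V).red.sch :=
    ⟨fun s => Set.disjoint_left.mp hd (LC.mem_ι s).1 (LC.mem_ι s).2⟩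
  have := T.subsingleton_of_isEmpty (S.inter V).red a b
  rw [T.res_pushLC h hp hV hR (LC.inter_le_right _ _)
    (MorphismProperty.of_isPullback (LC.isPullback_incl h hV hR.le (LC.inter_le_right _ _) le_rfl)
      hp) le_rfl, Subsingleton.elim (T.res hR a b x) 0, map_zero]

theorem res_bdryLC {C W S C' W' S' : LC X} (h : LC.Split C W S) (h' : LC.Split C' W' S')
    (hS : S'.OpenIn S) (hC : C'.OpenIn C) (hW : W'.OpenIn W) (a a' b : ℤ)
    (ha : a = a' + 1) (x : T.H W.red a b) :
    T.bdryLC h' a a' b ha (T.res hW a b x) = T.res hC a' b (T.bdryLC h a a' b ha x) := by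
  refine T.bdry_pull _ _ h'.pair _ _ h.pair (LC.incl hS.le) hS.etale (LC.incl hC.le) hC.etale
    (LC.incl hW.le) hW.etale (LC.isPullback_incl h.le hS hC.le h'.le ?_).flip
    (LC.isPullback_incl h.opn.le hS hW.le h'.opn.le ?_).flip a a' b ha x
  · rintro z ⟨hz, hz'⟩
    rw [h'.eq]
    rw [h.eq] at hz
    exact ⟨hz', fun hzW => hz.2 (hW.le hzW)⟩
  · rintro z ⟨hz, hz'⟩
    by_contra hzW
    have h1 : z ∈ C'.1 := by rw [h'.eq]; exact ⟨hz', hzW⟩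
    have h2 : z ∈ C.1 := hC.le h1
    rw [h.eq] at h2
    exact h2.2 hz

theorem bdryLC_pushLC {C W S C' W' S' : LC X} (h : LC.Split C W S) (h' : LC.Split C' W' S')
    (hS : S ≤ S') (hpS : IsProper (LC.incl hS).hom) (hC : C ≤ C') (hpC : IsProper (LC.incl hC).hom)
    (hW : W ≤ W') (hpW : IsProper (LC.incl hW).hom) (a a' b : ℤ) (ha : a = a' + 1)
    (x : T.H W.red a b) :
    T.bdryLC h' a a' b ha (T.pushLC hW hpW a b x) =
      T.pushLC hC hpC a' b (T.bdryLC h a a' b ha x) := by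
  have h1 := T.bdry_push _ _ h.pair _ _ h'.pair (LC.incl hS) hpS (LC.incl hC) hpC (by
      rw [LC.incl_comp, LC.incl_comp]) (𝟙 _) (etale_id _) (LC.incl hW) hpW (by
      rw [Category.id_comp]
      refine (LC.isPullback_incl hS h'.opn h.opn.le hW ?_)
      rintro z ⟨hz, hz'⟩
      by_contra hzW
      have h1 : z ∈ C.1 := by rw [h.eq]; exact ⟨hz, hzW⟩
      have h2 : z ∈ C'.1 := hC h1
      rw [h'.eq] at h2
      exact h2.2 hz') a a' b ha x
  rw [T.pull_id] at h1
  exact h1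

/-- A class that vanishes on the members of a finite partition into open subsets vanishes. -/
theorem eq_zero_of_res {ι : Type*} (s : Finset ι) (U : ι → LC X) (S : LC X)
    (hU : ∀ i ∈ s, (U i).OpenIn S) (hd : (s : Set ι).PairwiseDisjoint fun i => (U i).1)
    (hS : S.1 ⊆ ⋃ i ∈ s, (U i).1) (a b : ℤ) (x : T.H S.red a b)
    (hx : ∀ i (hi : i ∈ s), T.res (hU i hi) a b x = 0) : x = 0 := by
  classical
  induction s using Finset.induction_on generalizing S with
  | empty =>
    have : IsEmpty S.red.sch := ⟨fun z => by simpa using hS (LC.mem_ι z)⟩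
    have := T.subsingleton_of_isEmpty S.red a b
    exact Subsingleton.elim _ _
  | insert i s hi ih =>
    have hUi := hU i (Finset.mem_insert_self _ _)
    have hsp := LC.split_diff hUi
    obtain ⟨y, rfl⟩ := (T.exact_pushLC_res hsp a b x).mp (hx i (Finset.mem_insert_self _ _))
    have hle : ∀ j ∈ s, U j ≤ S.diff (U i) hUi := fun j hj z hz =>
      ⟨(hU j (Finset.mem_insert_of_mem hj)).le hz, fun hz' =>
        Set.disjoint_left.mp (hd (by simp) (by simp [hj]) (fun e => hi (by rw [e]; exact hj))) hz' hz⟩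
    -- The complement of `U i` is the union of the other members of the partition, so it is open as
    -- well as closed. Pushing forward from it therefore does not change restrictions to those
    -- members.
    have hop : (S.diff (U i) hUi).OpenIn S := by
      have h1 : ∀ j ∈ s, ∃ O : Set X.sch, IsOpen O ∧ (U j).1 = O ∩ S.1 := fun j hj =>
        hU j (Finset.mem_insert_of_mem hj)
      choose! O hO e using h1
      refine ⟨⋃ j ∈ s, O j, isOpen_biUnion hO, ?_⟩
      refine Set.Subset.antisymm (fun z hz => ?_) fun z hz => ?_
      · have h2 := hS hz.1
        simp only [Finset.mem_insert, Set.iUnion_iUnion_eq_or_left, Set.mem_union,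
          Set.mem_iUnion] at h2
        obtain h2 | ⟨j, hj, h2⟩ := h2
        · exact (hz.2 h2).elim
        · rw [e j hj] at h2
          exact ⟨Set.mem_biUnion hj h2.1, hz.1⟩
      · obtain ⟨h2, h3⟩ := hz
        simp only [Set.mem_iUnion] at h2
        obtain ⟨j, hj, h2⟩ := h2
        exact hle j hj (show z ∈ (U j).1 by rw [e j hj]; exact ⟨h2, h3⟩)
    have h0 : y = 0 := by
      refine ih (S.diff (U i) hUi)
        (fun j hj => (hU j (Finset.mem_insert_of_mem hj)).of_le (hle j hj) (S.diff_le _ hUi))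
        (hd.subset (by simp)) (fun z hz => ?_) y fun j hj => ?_
      · have h2 := hS hz.1
        simp only [Finset.mem_insert, Set.iUnion_iUnion_eq_or_left, Set.mem_union] at h2
        exact h2.resolve_left hz.2
      · rw [← T.res_pushLC_of_openIn (S.diff_le _ hUi) hsp.pair.proper hop _
          (hU j (Finset.mem_insert_of_mem hj))]
        exact hx j (Finset.mem_insert_of_mem hj)
    rw [h0, map_zero]

/-- A class is the sum of its restrictions to the members of a finite partition into open
subsets. -/
theorem eq_sum_pushLC_res {ι : Type*} [DecidableEq ι] (s : Finset ι) (U : ι → LC X) (S : LC X)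
    (hU : ∀ i, (U i).OpenIn S) (hp : ∀ i, IsProper (LC.incl (hU i).le).hom)
    (hd : (s : Set ι).PairwiseDisjoint fun i => (U i).1)
    (hS : S.1 ⊆ ⋃ i ∈ s, (U i).1) (a b : ℤ) (x : T.H S.red a b) :
    x = ∑ i ∈ s, T.pushLC (hU i).le (hp i) a b (T.res (hU i) a b x) := by
  rw [← sub_eq_zero]
  refine T.eq_zero_of_res s U S (fun i _ => hU i) hd hS a b _ fun i hi => ?_
  rw [map_sub, map_sum, Finset.sum_eq_single i, T.res_pushLC_of_openIn _ _ (hU i) (hU i).of_self,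
    T.res_self, sub_self]
  · intro j hj hji
    exact T.res_pushLC_of_disjoint _ _ _ (hd hj hi hji) a b _
  · exact fun h => (h hi).elim

end TwistedHomologyTheory

/-! ### Homotopy invariance of homology. -/

theorem isPureDim_of_irreducible (Y : AlgSch k) [IrreducibleSpace Y.sch] {d : ℕ}
    (hd : topologicalKrullDim Y.sch = d) : Y.IsPureDim d := by
  intro C hC
  rw [irreducibleComponents_eq_singleton] at hC
  obtain rfl := hC
  rw [← hd]
  exact (Homeomorph.Set.univ _).isHomeomorph.topologicalKrullDim_eq

theorem isFlatEquidim_id (S : Scheme.{u}) : IsFlatEquidim (𝟙 S) 0 := by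
  refine ⟨inferInstance, fun y C hC => ?_⟩
  let e := asIso (pullback.snd (𝟙 S) (S.fromSpecResidueField y))
  have h1 : topologicalKrullDim ((𝟙 S : S ⟶ S).fiber y) = 0 := by
    rw [← ringKrullDim_eq_zero_of_field (S.residueField y),
      ← PrimeSpectrum.topologicalKrullDim_eq_ringKrullDim]
    exact e.hom.homeomorph.isHomeomorph.topologicalKrullDim_eq
  have : IrreducibleSpace ((𝟙 S : S ⟶ S).fiber y) := by
    have : IrreducibleSpace (Spec (S.residueField y)) := inferInstance
    exact e.inv.homeomorph.surjective.irreducibleSpace e.inv.continuous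
  rw [irreducibleComponents_eq_singleton] at hC
  obtain rfl := hC
  rw [(Homeomorph.Set.univ _).isHomeomorph.topologicalKrullDim_eq, h1]
  simp

theorem isFlatEquidim_of_isIso {S S' : Scheme.{u}} (f : S ⟶ S') [IsIso f] : IsFlatEquidim f 0 := by
  simpa using (isFlatEquidim_id S').iso_comp f

theorem bijective_of_comm {A B C D : Type*} {c : A → B} {c' : C → D} {m : A → C} {l : B → D}
    (hc : Function.Bijective c) (hc' : Function.Bijective c') (hm : Function.Bijective m)
    (h : ∀ y, l (c y) = c' (m y)) : Function.Bijective l := by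
  refine (Function.Bijective.of_comp_iff l hc).mp ?_
  have : l ∘ c = c' ∘ m := funext h
  rw [this]
  exact hc'.comp hm

namespace AlgSch

variable {X : AlgSch k}

/-- Among finitely many irreducible closed sets covering `S`, choose a maximal one. Its generic
point avoids every other set of the covering that does not contain it. -/
theorem LC.exists_isGen {S : LC X} (hS : IsClosed S.1) (hne : S.1.Nonempty) : ∃ y, S.IsGen y := by
  obtain ⟨F, hF, hFc, hFi, e⟩ := NoetherianSpace.exists_finite_set_isClosed_irreducible hS
  obtain ⟨C, hC⟩ := hF.exists_maximal (by
    obtain ⟨z, hz⟩ := hne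
    rw [e] at hz
    obtain ⟨C, hC, -⟩ := hz
    exact ⟨C, hC⟩)
  have hy := (hFi C hC.prop).closure_genericPoint (hFc C hC.prop)
  set y := (hFi C hC.prop).genericPoint
  have hyC : y ∈ C := hy.subset (subset_closure rfl)
  refine ⟨y, LC.isGen_of_open (U := (⋃ C' ∈ {C' ∈ F | ¬ C ⊆ C'}, C')ᶜ) ?_ ?_ ?_ ?_⟩
  · rw [e]; exact ⟨C, hC.prop, hyC⟩
  · rw [isOpen_compl_iff]
    exact (hF.subset fun _ h => h.1).isClosed_biUnion fun C' h => hFc C' h.1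
  · simp only [Set.mem_compl_iff, Set.mem_iUnion, not_exists]
    rintro C' ⟨h, h'⟩ hyC'
    refine h' (hy ▸ closure_minimal (by simpa using hyC') (hFc C' h))
  · rintro z ⟨hz, hzS⟩
    rw [e] at hzS
    obtain ⟨C', hC', hz'⟩ := hzS
    rw [hy]
    by_cases h : C ⊆ C'
    · exact hC.le_of_ge hC' h hz'
    · exact (hz (Set.mem_biUnion (show C' ∈ {C' ∈ F | ¬ C ⊆ C'} from ⟨hC', h⟩) hz')).elim

theorem range_lineMap {V Y : AlgSch k} (f : V ⟶ Y) :
    Set.range (lineMap f).hom = Y.lineProj.hom ⁻¹' Set.range f.hom := by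
  rw [← Scheme.Pullback.range_fst, ← (isPullback_lineMap f).isoPullback_hom_fst]
  exact (isPullback_lineMap f).isoPullback.hom.surjective.range_comp _

end AlgSch

theorem AlgSch.IsClosedOpenPair.line {Z X U : AlgSch k} {i : Z ⟶ X} {j : U ⟶ X}
    (h : IsClosedOpenPair i j) : IsClosedOpenPair (lineMap i) (lineMap j) := by
  have := h.closed
  have := h.opn
  refine ⟨MorphismProperty.of_isPullback (isPullback_lineMap i).flip h.closed, inferInstance, ?_⟩
  rw [range_lineMap, range_lineMap, h.compl, Set.preimage_compl]

/-- The inverse of an isomorphism of schemes, as a morphism of `k`-schemes. -/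
noncomputable def AlgSch.invHom {V Y : AlgSch k} (f : V ⟶ Y) [IsIso f.hom] : Y ⟶ V :=
  ⟨inv f.hom, by rw [IsIso.inv_comp_eq, f.w]⟩

@[simp] theorem AlgSch.hom_invHom {V Y : AlgSch k} (f : V ⟶ Y) [IsIso f.hom] : f ≫ invHom f = 𝟙 V :=
  hom_ext (by simp [invHom])

@[simp] theorem AlgSch.invHom_hom {V Y : AlgSch k} (f : V ⟶ Y) [IsIso f.hom] : invHom f ≫ f = 𝟙 Y :=
  hom_ext (by simp [invHom])

instance {V Y : AlgSch k} (f : V ⟶ Y) [IsIso f.hom] : IsIso (invHom f).hom := by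
  unfold invHom; infer_instance

theorem smooth_affineSpace (n : Type u) [Finite n] (S : Scheme.{u}) : Smooth (𝔸(n; S) ↘ S) := by
  let R : CommRingCat.{u} := .of (ULift.{u} ℤ)
  have h : Smooth (𝔸(n; Spec R) ↘ Spec R) := by
    have h1 : Smooth (Spec.map (CommRingCat.ofHom (MvPolynomial.C (σ := n) (R := R)))) := by
      rw [HasRingHomProperty.Spec_iff (P := @Smooth)]
      change RingHom.Smooth (algebraMap (ULift.{u} ℤ) (MvPolynomial n (ULift.{u} ℤ)))
      rw [RingHom.smooth_algebraMap]
      exact ⟨inferInstance, inferInstance⟩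
    have h2 : (AffineSpace.SpecIso n R).hom ≫ Spec.map (CommRingCat.ofHom MvPolynomial.C) =
        𝔸(n; Spec R) ↘ Spec R := by
      rw [← AffineSpace.SpecIso_inv_over, Iso.hom_inv_id_assoc]
    rw [← h2]
    infer_instance
  exact MorphismProperty.of_isPullback (P := @Smooth)
    (AffineSpace.isPullback_map (n := n) (specULiftZIsTerminal.from S)) h

instance (Y : AlgSch k) [Smooth Y.str] : Smooth Y.line.str := by
  have := smooth_affineSpace PUnit.{u+1} Y.sch
  change Smooth ((𝔸(PUnit.{u+1}; Y.sch) ↘ Y.sch) ≫ Y.str)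
  infer_instance

namespace TwistedPoincareDuality

variable (T : TwistedPoincareDuality.{u, v} k)

theorem isFundamentalClass_eta (Y : AlgSch k) (d : ℕ) (hY : IrreducibleSpace Y.sch)
    (hd : topologicalKrullDim Y.sch = d) : T.hom.IsFundamentalClass T.eta Y d (T.eta Y d hY hd) :=
  fun _ α _ hα hV hdV => T.pull_eta α hα d hV hY hdV hd

theorem bijective_cap_eta (Y : AlgSch k) [Smooth Y.str] (d : ℕ) (hY : IrreducibleSpace Y.sch)
    (hd : topologicalKrullDim Y.sch = d) (i j a b : ℤ) (ha : a = 2 * d - i) (hb : b = d - j) :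
    Function.Bijective (T.cap (ClosedPair.self Y) (2 * d) d i j a b ha hb (T.eta Y d hY hd)) :=
  T.duality (ClosedPair.self Y) ‹_› d (isPureDim_of_irreducible Y hd) _
    (T.isFundamentalClass_eta Y d hY hd) i j a b ha hb

end TwistedPoincareDuality

namespace ExtendedPoincareDuality

variable (T : ExtendedPoincareDuality.{u, v} k)

theorem flat_congr {Y' Y : AlgSch k} {f g : Y' ⟶ Y} (h : f = g) (m : ℕ)
    (hf : IsFlatEquidim f.hom m) (hg : IsFlatEquidim g.hom m) (a a' b b' : ℤ)
    (ha : a' = a + 2 * m) (hb : b' = b + m) (x : T.hom.H Y a b) :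
    T.flat f m hf a a' b b' ha hb x = T.flat g m hg a a' b b' ha hb x := by
  subst h
  rfl

/-- Poincaré duality on `Y` and on its line places the map in a commutative square whose other sides
are bijective. The square commutes because `p^* (η ∩ y) = p^* η ∩ p^* y` and `p^* η` is the
fundamental class of the line. -/
theorem linePull_bijective_of_smooth (hT : T.coh.HomotopyInvariant) (Y : AlgSch k)
    [IsIntegral Y.sch] [Smooth Y.str] (a b : ℤ) : Function.Bijective (T.linePull Y a b) := by
  obtain ⟨d, hd⟩ := Y.exists_dim
  have hd' : topologicalKrullDim Y.line.sch = (d + 1 : ℕ) := by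
    rw [AlgSch.dim_line, hd]; simp
  have hY : IrreducibleSpace Y.sch := inferInstance
  have hY' : IrreducibleSpace Y.line.sch := inferInstance
  have h1 := T.bijective_cap_eta Y d hY hd (2 * d - a) (d - b) a b (by ring) (by ring)
  have h2 := T.bijective_cap_eta Y.line (d + 1) hY' hd' (2 * d - a) (d - b) (a + 2) (b + 1)
    (by push_cast; ring) (by push_cast; ring)
  have h3 := hT Y inferInstance (2 * d - a) (d - b)
  have h4 : ∀ y, T.linePull Y a b (T.cap (ClosedPair.self Y) (2 * d) d (2 * d - a) (d - b) a b
      (by ring) (by ring) (T.eta Y d hY hd) y) =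
      T.cap (ClosedPair.self Y.line) (2 * (d + 1 : ℕ)) (d + 1 : ℕ) (2 * d - a) (d - b) (a + 2)
        (b + 1) (by push_cast; ring) (by push_cast; ring) (T.eta Y.line (d + 1) hY' hd')
        (T.coh.map (ClosedPair.selfMap Y.lineProj) (2 * d - a) (d - b) y) := fun y => by
    rw [← T.flat_eta Y.lineProj 1 Y.isFlatEquidim_lineProj hY' hY (d + 1) d hd' hd
      (by push_cast; ring) (by push_cast; ring)]
    exact T.flat_cap (ClosedPair.selfMap Y.lineProj) 1 Y.isFlatEquidim_lineProj
      Y.isFlatEquidim_lineProj (2 * d) d (2 * d - a) (d - b) a b (2 * (d + 1 : ℕ)) (d + 1 : ℕ)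
      (a + 2) (b + 1) (by ring) (by ring) (by push_cast; ring) (by push_cast; ring)
      (by push_cast; ring) (by push_cast; ring) (by push_cast; ring) (by push_cast; ring) _ y
  exact bijective_of_comm h1 h2 h3 h4

/-- The five lemma for the localization sequences of the pair and of its affine line. -/
theorem linePull_bijective_of_pair {Z X U : AlgSch k} {i : Z ⟶ X} {j : U ⟶ X}
    (h : IsClosedOpenPair i j) (hZ : ∀ a b, Function.Bijective (T.linePull Z a b))
    (hU : ∀ a b, Function.Bijective (T.linePull U a b)) (a b : ℤ) :
    Function.Bijective (T.linePull X a b) := by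
  refine AddMonoidHom.bijective_of_surjective_of_bijective_of_bijective_of_injective
    (T.hom.bdry i j h (a + 1) a b rfl) (T.hom.push i h.proper a b) (T.hom.pull j h.etale a b)
    (T.hom.bdry i j h a (a - 1) b (by ring))
    (T.hom.bdry _ _ h.line (a + 1 + 2) (a + 2) (b + 1) (by ring))
    (T.hom.push _ h.line.proper (a + 2) (b + 1)) (T.hom.pull _ h.line.etale (a + 2) (b + 1))
    (T.hom.bdry _ _ h.line (a + 2) (a - 1 + 2) (b + 1) (by ring))
    (T.linePull U (a + 1) b) (T.linePull Z a b) (T.linePull X a b) (T.linePull U a b)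
    (T.linePull Z (a - 1) b) ?_ ?_ ?_ ?_
    (T.hom.exact_bdry_push _ _ h _ _ _ _) (T.hom.exact_push_pull _ _ h _ _)
    (T.hom.exact_pull_bdry _ _ h _ _ _ _) (T.hom.exact_bdry_push _ _ h.line _ _ _ _)
    (T.hom.exact_push_pull _ _ h.line _ _) (T.hom.exact_pull_bdry _ _ h.line _ _ _ _)
    (hU _ _).2 (hZ _ _) (hU _ _) (hZ _ _).1
  · ext x
    exact T.flat_bdry h.line h X.lineProj Z.lineProj U.lineProj 1 X.isFlatEquidim_lineProj
      Z.isFlatEquidim_lineProj U.isFlatEquidim_lineProj (isPullback_lineMap i)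
      (isPullback_lineMap j) (a + 1) a (a + 1 + 2) (a + 2) b (b + 1) _ _ _ _ _ x
  · ext x
    exact (T.flat_push h.line h X.lineProj Z.lineProj U.lineProj 1 X.isFlatEquidim_lineProj
      Z.isFlatEquidim_lineProj U.isFlatEquidim_lineProj (isPullback_lineMap i)
      (isPullback_lineMap j) a (a + 2) b (b + 1) _ _ x).symm
  · ext x
    exact (T.flat_pull h.line h X.lineProj Z.lineProj U.lineProj 1 X.isFlatEquidim_lineProj
      Z.isFlatEquidim_lineProj U.isFlatEquidim_lineProj (isPullback_lineMap i)
      (isPullback_lineMap j) a (a + 2) b (b + 1) _ _ x).symm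
  · ext x
    exact T.flat_bdry h.line h X.lineProj Z.lineProj U.lineProj 1 X.isFlatEquidim_lineProj
      Z.isFlatEquidim_lineProj U.isFlatEquidim_lineProj (isPullback_lineMap i)
      (isPullback_lineMap j) a (a - 1) (a + 2) (a - 1 + 2) b (b + 1) _ _ _ _ _ x

theorem linePull_bijective_of_isEmpty (Y : AlgSch k) [IsEmpty Y.sch] (a b : ℤ) :
    Function.Bijective (T.linePull Y a b) := by
  have : IsEmpty Y.line.sch := Function.isEmpty Y.lineProj.hom
  have := T.hom.subsingleton_of_isEmpty Y a b
  have := T.hom.subsingleton_of_isEmpty Y.line (a + 2) (b + 1)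
  exact ⟨Function.injective_of_subsingleton _, fun y => ⟨0, Subsingleton.elim _ _⟩⟩

/-- Homotopy invariance of homology. -/
theorem linePull_bijective [PerfectField k] (hT : T.coh.HomotopyInvariant) (X : AlgSch k) (a b : ℤ) :
    Function.Bijective (T.linePull X a b) := by
  have key : ∀ (Z : Closeds X.sch) (S : LC X), S.1 = Z → ∀ a b,
      Function.Bijective (T.linePull S.red a b) := by
    intro Z
    induction Z using WellFoundedLT.induction with
    | ind Z ih =>
      intro S hS
      by_cases hne : S.1.Nonempty
      · have hSc : IsClosed S.1 := hS ▸ Z.isClosed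
        obtain ⟨y, W, hW⟩ := LC.exists_isGen hSc hne
        -- Near a generic point `S` is irreducible, so a small enough open part is integral and
        -- smooth. Its complement in `S` is closed and strictly smaller.
        obtain ⟨W', hW', hs⟩ := W.exists_smooth
        have hW'S := (Nbd.openIn hW').trans hW
        have hc : IsClosed (S.diff W'.lc hW'S).1 := by
          obtain ⟨O, hO, e⟩ := hW'S
          have : S.1 \ W'.lc.1 = S.1 \ O := by rw [e, Set.sdiff_inter_self_eq_sdiff]
          change IsClosed (S.1 \ W'.lc.1)
          rw [this]
          exact hSc.sdiff hO
        refine T.linePull_bijective_of_pair (LC.split_diff hW'S).pair ?_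
          (T.linePull_bijective_of_smooth hT W'.lc.red)
        refine ih ⟨_, hc⟩ (lt_of_le_of_ne (fun z hz => hS.subset hz.1) fun e => ?_) _ rfl
        have h1 : y ∈ (Z : Set X.sch) := hS.subset (hW'S.le W'.mem)
        rw [← e] at h1
        exact h1.2 W'.mem
      · have : IsEmpty S.red.sch := ⟨fun s => hne ⟨_, LC.mem_ι s⟩⟩
        exact T.linePull_bijective_of_isEmpty S.red
  let S : LC X := ⟨Set.univ, isClosed_univ.isLocallyClosed⟩
  obtain ⟨E, -, hE, -⟩ := TwistedHomologyTheory.isClosedOpenPair_empty X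
  -- Since `X` need not be reduced, it is compared with its reduction: this is a closed subscheme
  -- with empty complement, so the lemma on pairs applies once more.
  have h : IsClosedOpenPair S.ι E.ι := by
    refine ⟨.of_isPreimmersion _ (by rw [S.range_ι]; exact isClosed_univ),
      isOpenImmersion_of_isEmpty _, ?_⟩
    rw [Set.range_eq_empty, S.range_ι]
    exact Set.compl_univ.symm
  exact T.linePull_bijective_of_pair h (key ⊤ S rfl) (T.linePull_bijective_of_isEmpty E.red) a b

/-- The reduced preimage of `S` is isomorphic to the line over `S` through `toLine`, and flat
pull-back along this isomorphism is an étale pull-back. Part (i) thus holds in the form needed for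
subsets of a fixed `X`. -/
theorem lineResPull_bijective [PerfectField k] (hT : T.coh.HomotopyInvariant) {X : AlgSch k}
    (S : LC X) (a a₁ b b₁ : ℤ) (ha : a₁ = a + 2) (hb : b₁ = b + 1) :
    Function.Bijective (T.lineResPull S a a₁ b b₁ ha hb) := by
  subst ha hb
  have h0 := isFlatEquidim_of_isIso S.toLine.hom
  have he : Etale S.toLine.hom := inferInstance
  have h1 : ∀ x, T.lineResPull S a (a + 2) b (b + 1) rfl rfl x =
      T.hom.pull S.toLine he (a + 2) (b + 1) (T.linePull S.red a b x) := fun x => by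
    rw [← T.flat_etale S.toLine he h0 (a + 2) (b + 1) (by simp) (by simp)]
    refine (T.flat_congr S.toLine_lineProj.symm 1 _ (by
      rw [S.toLine_lineProj]; exact S.isFlatEquidim_lineRes) a (a + 2) b (b + 1) _ _ x).trans ?_
    exact T.flat_comp S.toLine S.red.lineProj 1 0 S.red.isFlatEquidim_lineProj h0
      (by rw [S.toLine_lineProj]; exact S.isFlatEquidim_lineRes) a (a + 2) (a + 2) b (b + 1) (b + 1)
      _ _ _ _ _ _ x
  have h2 := T.hom.pull_bijective_of_inverse S.toLine (invHom S.toLine) (by simp) (by simp) he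
    inferInstance (a + 2) (b + 1)
  have h3 : ⇑(T.lineResPull S a (a + 2) b (b + 1) rfl rfl) =
      T.hom.pull S.toLine he (a + 2) (b + 1) ∘ T.linePull S.red a b := funext h1
  rw [h3]
  exact h2.comp (T.linePull_bijective hT S.red a b)

end ExtendedPoincareDuality

/-! ### Vanishing of push-forwards to the affine line, by principal triviality. -/

/-- A section over an affine `V` is evaluation of polynomials at a function `r`, and its ideal is
generated by the coordinate minus `r`. -/
theorem isPrincipalDivisor_of_section {V : AlgSch k} [IsIntegral V.sch] [IsAffine V.sch]
    (s : V ⟶ V.line) (hs : s ≫ V.lineProj = 𝟙 V) : IsPrincipalDivisor s := by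
  have hs' : s.hom ≫ (𝔸(PUnit.{u+1}; V.sch) ↘ V.sch) = 𝟙 V.sch := congr($(hs).hom)
  have hc : IsClosedImmersion s.hom := by
    have : IsClosedImmersion (s.hom ≫ (𝔸(PUnit.{u+1}; V.sch) ↘ V.sch)) := by
      rw [hs']; infer_instance
    exact .of_comp _ (𝔸(PUnit.{u+1}; V.sch) ↘ V.sch)
  let r : Γ(V.sch, ⊤) := s.hom.appTop (AffineSpace.coord V.sch PUnit.unit)
  let E := lineEval (𝟙 𝔸(PUnit.{u+1}; V.sch))
  have hE : Function.Bijective E := bijective_lineEval_id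
  have h1 : lineEval s.hom = Polynomial.evalRingHom r := by
    refine Polynomial.ringHom_ext (fun a => ?_) ?_
    · rw [lineEval_C, hs']; simp
    · rw [lineEval_X]; simp [r]
  have h2 : s.hom.appTop.hom.comp E = Polynomial.evalRingHom r := by
    rw [← h1, ← lineEval_comp, Category.comp_id]
  let f : Γ(V.line.sch, ⊤) := E (Polynomial.X - Polynomial.C r)
  have hf : f ≠ 0 := fun h => Polynomial.X_sub_C_ne_zero r (hE.1 (h.trans (map_zero E).symm))
  have hker : RingHom.ker s.hom.appTop.hom = Ideal.span {f} := by
    ext x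
    obtain ⟨p, rfl⟩ := hE.2 x
    have h3 : s.hom.appTop.hom (E p) = p.eval r := congr($h2 p)
    rw [RingHom.mem_ker, h3, Ideal.mem_span_singleton, ← Polynomial.IsRoot.def,
      ← Polynomial.dvd_iff_isRoot]
    refine ⟨map_dvd E, fun ⟨y, hy⟩ => ?_⟩
    obtain ⟨q, rfl⟩ := hE.2 y
    exact ⟨q, hE.1 (by rw [hy, map_mul])⟩
  refine ⟨hc, f, fun U => ⟨?_, ?_⟩⟩
  · by_cases hU : Nonempty U.1
    · have h3 := map_injective_of_isIntegral V.line.sch (homOfLE le_top : U.1 ⟶ ⊤)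
      refine mem_nonZeroDivisors_of_ne_zero fun h => hf (h3 (h.trans (map_zero _).symm))
    · have hb : U.1 = ⊥ := by
        rw [← Opens.not_nonempty_iff_eq_bot]
        rintro ⟨z, hz⟩
        exact hU ⟨z, hz⟩
      have : Subsingleton Γ(V.line.sch, U) := by
        rw [show (U : V.line.sch.Opens) = ⊥ from hb]
        infer_instance
      exact mem_nonZeroDivisors_iff.mpr ⟨fun _ _ => Subsingleton.elim _ _,
        fun _ _ => Subsingleton.elim _ _⟩
  -- The line over `V` is affine, so the generator found on global sections generates the ideal on
  -- every affine open.
  · have h3 := s.hom.ker.map_ideal (U := U) (V := ⟨⊤, isAffineOpen_top _⟩) (le_top (a := U.1))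
    rw [← h3, Scheme.Hom.ker_apply]
    change Ideal.map _ (RingHom.ker s.hom.appTop.hom) = _
    rw [hker, Ideal.map_span, Set.image_singleton]
    rfl

namespace TwistedPoincareDuality

variable (T : TwistedPoincareDuality.{u, v} k)

/-- By duality `z = η ∩ c`, and `c = s^* p^* c` since `s` is a section. The projection formula gives
`s_* z = s_* η ∩ p^* c`, and `s_* η = 0` by principal triviality. -/
theorem push_section_eq_zero {V : AlgSch k} [IsIntegral V.sch] [IsAffine V.sch] [Smooth V.str]
    (s : V ⟶ V.line) (hs : s ≫ V.lineProj = 𝟙 V) (h : IsProper s.hom) (a b : ℤ)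
    (z : T.hom.H V a b) : T.hom.push s h a b z = 0 := by
  obtain ⟨d, hd⟩ := V.exists_dim
  have hV : IrreducibleSpace V.sch := inferInstance
  obtain ⟨c, rfl⟩ := (T.bijective_cap_eta V d hV hd (2 * d - a) (d - b) a b (by ring) (by ring)).2 z
  have h0 := T.push_principal s h inferInstance inferInstance (isPrincipalDivisor_of_section s hs) d
    (isPureDim_of_irreducible V hd) _ (T.isFundamentalClass_eta V d hV hd)
  have h1 := T.cap_push (ClosedPair.selfMap s) h h (2 * d) d (2 * d - a) (d - b) a b (by ring)
    (by ring) (T.eta V d hV hd) (T.coh.map (ClosedPair.selfMap V.lineProj) (2 * d - a) (d - b) c)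
  have h2 : ClosedPair.selfMap s ≫ ClosedPair.selfMap V.lineProj = 𝟙 (ClosedPair.self V) :=
    ClosedPair.Hom.ext hs hs
  rw [← T.coh.map_comp, h2, T.coh.map_id] at h1
  refine h1.symm.trans ?_
  have h3 : T.hom.push (ClosedPair.selfMap s).right h (2 * d) d (T.eta V d hV hd) = 0 := h0
  rw [h3, map_zero]
  rfl

/-- Push-forward to the affine line vanishes for a smooth scheme which is proper over the base. -/
theorem push_eq_zero_of_isProper {V W : AlgSch k} [IsIntegral V.sch] [IsAffine V.sch]
    [Smooth V.str] (i : V ⟶ W.line) (hi : IsProper i.hom) (hπ : IsProper (i ≫ W.lineProj).hom)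
    (a b : ℤ) (z : T.hom.H V a b) : T.hom.push i hi a b z = 0 := by
  have hp := isPullback_lineMap (i ≫ W.lineProj)
  -- This is the graph of `i`: the line over `V` is the fibre product of `V` and the line over `W`.
  -- Then `i` is this section followed by a base change of the proper map from `V` to `W`.
  let s₀ := hp.lift i.hom (𝟙 V.sch) (by simp)
  let s : V ⟶ V.line := ⟨s₀, by
    rw [← V.lineProj.w, ← Category.assoc, hp.lift_snd, Category.id_comp]⟩
  have hs : s ≫ V.lineProj = 𝟙 V := hom_ext (hp.lift_snd _ _ _)
  have hsi : s ≫ lineMap (i ≫ W.lineProj) = i := hom_ext (hp.lift_fst _ _ _)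
  have hm : IsProper (lineMap (i ≫ W.lineProj)).hom := MorphismProperty.of_isPullback hp.flip hπ
  have := (isPrincipalDivisor_of_section s hs).1
  have hs' : IsProper s.hom := inferInstance
  rw [← T.hom.push_congr hsi (by rw [hsi]; exact hi) hi, T.hom.push_comp s _ hs' hm,
    T.push_section_eq_zero s hs, map_zero]

end TwistedPoincareDuality

theorem AlgSch.Nbd.exists_affine_ge {X : AlgSch k} {x : X.sch} (W₀ : Nbd x) :
    ∃ W, W₀ ≤ W ∧ IsAffine W.lc.red.sch := by
  obtain ⟨O, hO, hO'⟩ := W₀.lc.red.exists_affine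
  obtain ⟨W, hW, e⟩ := W₀.exists_of_opens O hO'
  have := (Nbd.openIn hW).isOpenImmersion
  exact ⟨W, hW, isAffine_of_range_eq _ hO e⟩

/-- The closure of a point of the affine line which is not generic in its fibre is, over
small neighbourhoods of its image, closed and homologically trivial in the affine line. -/
theorem exists_pushLC_over_eq_zero [PerfectField k] (T : TwistedPoincareDuality.{u, v} k)
    {X : AlgSch k} {x : X.sch} {y : X.line.sch}
    (hy : X.lineProj.hom y = x) (hne : y ≠ fibGen x) (U : Nbd y) :
    ∃ W₀ : Nbd x, ∀ W, W₀ ≤ W → IsAffine W.lc.red.sch →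
      (U.over W hy).carrier = closure {y} ∩ W.lc.line.1 ∧
      IsClosedImmersion (LC.incl (U.over_le_line W hy)).hom ∧
      ∀ (hp : IsProper (LC.incl (U.over_le_line W hy)).hom) a b z,
        T.hom.pushLC (U.over_le_line W hy) hp a b z = 0 := by
  obtain ⟨W₀, hW₀⟩ := exists_isFinite_smooth_over hy hne U
  refine ⟨W₀, fun W hW _ => ?_⟩
  obtain ⟨he, hf, hs⟩ := hW₀ W hW
  -- Affineness of `W` is used here: the finite cover becomes affine, as required for the principal
  -- divisor argument.
  have : IsAffine (U.over W hy).lc.red.sch := isAffine_of_isAffineHom (U.overProj W hy).hom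
  have hcl := U.isClosedImmersion_overLine W hy isClosed_closure he
  have hcl' : IsClosedImmersion (LC.incl (U.over_le_line W hy)).hom := by
    have : IsClosedImmersion ((LC.incl (U.over_le_line W hy)).hom ≫ W.lc.toLine.hom) := hcl
    exact .of_comp (LC.incl (U.over_le_line W hy)).hom W.lc.toLine.hom
  refine ⟨he, hcl', fun hp a b z => ?_⟩
  have h1 : T.hom.push (U.overLine W hy) inferInstance a b z = 0 :=
    T.push_eq_zero_of_isProper _ _ (by rw [Nbd.overLine_lineProj]; infer_instance) a b z
  have hq : IsProper W.lc.toLine.hom := inferInstance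
  have h2 := T.hom.push_comp (LC.incl (U.over_le_line W hy)) W.lc.toLine hp hq
    (inferInstanceAs (IsProper (U.overLine W hy).hom)) a b z
  refine (T.hom.push_bijective_of_inverse W.lc.toLine (invHom W.lc.toLine) (by simp) (by simp) hq
    inferInstance a b).1 ?_
  rw [map_zero]
  exact h2.symm.trans h1

/-! ### Complements of neighbourhoods of the generic point of a fibre. -/

namespace AlgSch

variable {X : AlgSch k} {x : X.sch}

theorem lineProj_mem_closure {y : X.line.sch} (h : y ∈ closure {fibGen x}) :
    X.lineProj.hom y ∈ closure {x} := mem_closure_fibGen.mp h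

theorem HasDim.lineProj {y : X.line.sch} (hne : y ≠ AlgSch.fibGen (X.lineProj.hom y)) {p : ℤ}
    (h : HasDim y p) : HasDim (X.lineProj.hom y) p := by
  obtain ⟨n, hn⟩ := exists_hasDim (X.lineProj.hom y)
  rwa [h.unique (hn.of_lineProj hne)]

/-- A point of the affine line over the closure of `x` of the same dimension as `x`, not generic
in its fibre, lies above `x`. -/
theorem lineProj_eq_of_hasDim {y : X.line.sch} (hne : y ≠ AlgSch.fibGen (X.lineProj.hom y)) {p : ℤ}
    (hy : HasDim y p) (hx : HasDim x p) (h : y ∈ closure {AlgSch.fibGen x}) :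
    X.lineProj.hom y = x :=
  (hy.lineProj hne).eq_of_mem_closure hx (lineProj_mem_closure h)

/-- The part of a neighbourhood of the generic point of the fibre of `x` above `W`. -/
theorem Nbd.inter_line_openIn (V : Nbd (fibGen x)) (W : Nbd x) :
    (V.inter W.line).lc.OpenIn W.lc.line := Nbd.openIn (Nbd.le_inter_right V W.line)

/-- The closed set `Y` that `V` omits from the closure of `fibGen x` has dimension at most that of
`x`. Its points above `x` have exactly that dimension, so they are generic in `Y` and finite in
number. Over small `W`, disjoint neighbourhoods of these points cover all of `Y`. -/
theorem Nbd.exists_partition (V : Nbd (fibGen x)) :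
    ∃ (ι : Type u) (_ : Fintype ι) (y : ι → X.line.sch) (hy : ∀ i, X.lineProj.hom (y i) = x)
      (U : ∀ i, Nbd (y i)) (W₀ : Nbd x), (∀ i, y i ≠ fibGen x) ∧ ∀ W, W₀ ≤ W →
        (∀ i, ((U i).over W (hy i)).lc.OpenIn (W.lc.line.diff _ (V.inter_line_openIn W))) ∧
        ((Set.univ : Set ι).PairwiseDisjoint fun i => ((U i).over W (hy i)).lc.1) ∧
        (W.lc.line.diff _ (V.inter_line_openIn W)).1 ⊆ ⋃ i, ((U i).over W (hy i)).lc.1 := by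
  obtain ⟨n, hn⟩ := exists_hasDim x
  let Y := V.compl (p' := n) rfl hn.fibGen
  have hYV : ∀ z ∈ Y.1.1, z ∉ V.carrier := fun z hz => hz.2
  have hYc : ∀ z ∈ Y.1.1, z ∈ closure {fibGen x} := fun z hz => hz.1
  let ι := {y : X.line.sch // Y.1.IsGen y ∧ X.lineProj.hom y = x}
  have hfin : Finite ι := (Y.1.finite_isGen.subset fun y h => h.1 : {y : X.line.sch | Y.1.IsGen y ∧
    X.lineProj.hom y = x}.Finite)
  choose U hU using fun i : ι => i.2.1
  have hne : ∀ z ∈ Y.1.1, z ≠ fibGen x := fun z hz e => hYV z hz (e ▸ V.mem)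
  -- This remainder of `Y` has no point above `x`, since such a point would be one of the chosen
  -- generic points. Shrinking `W` therefore removes it.
  have hcl : IsClosed (Y.1.1 \ ⋃ i, (U i).carrier) := by
    choose O hO e using hU
    have : Y.1.1 \ ⋃ i, (U i).carrier = Y.1.1 \ ⋃ i, O i := by
      ext z
      simp only [Set.mem_sdiff, Set.mem_iUnion, not_exists]
      refine and_congr_right fun hz => forall_congr' fun i => not_congr ?_
      change z ∈ (U i).lc.1 ↔ _
      rw [e]
      exact ⟨fun h => h.1, fun h => ⟨h, hz⟩⟩
    rw [this]
    exact Y.2.1.sdiff (isOpen_iUnion hO)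
  obtain ⟨W₀, hW₀⟩ := exists_nbd_disjoint X.lineProj (x := x) hcl
    (fun z hz => lineProj_mem_closure (hYc z hz.1)) (fun z hz hzx => hz.2 (by
      have h1 : HasDim z n :=
        HasDim.of_lineProj (by rw [hzx]; exact hne z hz.1) (by rw [hzx]; exact hn)
      have h2 : Y.1.IsGen z := LC.isGen_of_hasDim Y.2.1 Y.2.2 hz.1 h1
      exact Set.mem_iUnion.mpr ⟨⟨z, h2, hzx⟩, (U ⟨z, h2, hzx⟩).mem⟩))
  refine ⟨ι, Fintype.ofFinite ι, fun i => i.1, fun i => i.2.2, U, W₀,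
    fun i => hne _ i.2.1.mem, fun W hW => ⟨fun i => ?_, fun i _ j _ hij => ?_, fun z hz => ?_⟩⟩
  · obtain ⟨O, hO, e⟩ := hU i
    refine ⟨O, hO, Set.Subset.antisymm (fun z hz => ?_) fun z hz => ?_⟩
    · have h1 : z ∈ O ∩ Y.1.1 := e.subset hz.1
      exact ⟨h1.1, hz.2, fun h => hYV z h1.2 h.1⟩
    · refine ⟨?_, hz.2.1⟩
      change z ∈ (U i).lc.1
      rw [e]
      exact ⟨hz.1, W.line.subset_closure hz.2.1, fun h => hz.2.2 ⟨h, hz.2.1⟩⟩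
  · exact (LC.nbd_disjoint (hU i) (hU j) fun h => hij (Subtype.ext h)).mono (fun z hz => hz.1)
      (fun z hz => hz.1)
  · have h1 : z ∈ Y.1.1 := ⟨W.line.subset_closure hz.1, fun h => hz.2 ⟨h, hz.1⟩⟩
    by_contra h
    refine hW₀ z ⟨h1, fun h2 => h ?_⟩ (hW hz.1)
    obtain ⟨i, hi⟩ := Set.mem_iUnion.mp h2
    exact Set.mem_iUnion.mpr ⟨i, hi, hz.1⟩

theorem Nbd.exists_le_of_finite {ι : Type*} [Finite ι] (W : ι → Nbd x) (W₀ : Nbd x) :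
    ∃ W', W₀ ≤ W' ∧ ∀ i, W i ≤ W' := by
  obtain ⟨W', h⟩ := Finite.exists_le fun o : Option ι => o.elim W₀ W
  exact ⟨W', h none, fun i => h (some i)⟩

theorem LC.eq_of_isGen_nbd {x y : X.sch} {W : Nbd x} (h : W.lc.IsGen y) : y = x := by
  obtain ⟨U, hU, hyU, hUW⟩ := h.exists_open
  have h1 := W.subset_closure h.mem
  have h2 : x ∈ U := (specializes_iff_mem_closure.mpr h1).mem_open hU hyU
  exact eq_of_mem_closure h1 (hUW ⟨h2, W.mem⟩)

end AlgSch

-- Differential and pull-back on `E^1`, computed point by point.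

attribute [local instance] Classical.propDecidable

namespace TwistedHomologyTheory

variable (T : TwistedHomologyTheory.{u, v} k) {X : AlgSch k}

theorem exists_ofNbd {x : X.sch} {a b : ℤ} (h : T.Hpt x a b) (W₀ : Nbd x) :
    ∃ W, W₀ ≤ W ∧ ∃ z, T.ofNbd W a b z = h := by
  have h1 : ∃ (W : Nbd x) (z : T.H W.lc.red a b), T.ofNbd W a b z = h :=
    AddCommGroup.DirectLimit.induction_on (C := fun h => ∃ (W : Nbd x) (z : T.H W.lc.red a b),
      T.ofNbd W a b z = h) h fun W z => ⟨W, z, rfl⟩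
  obtain ⟨W, z, rfl⟩ := h1
  exact ⟨W₀.inter W, Nbd.le_inter_left _ _, _, T.ofNbd_res (Nbd.le_inter_right W₀ W) a b z⟩

theorem exists_res_eq_zero {x : X.sch} {W : Nbd x} {a b : ℤ} {z : T.H W.lc.red a b}
    (h : T.ofNbd W a b z = 0) : ∃ (W' : Nbd x) (hW : W ≤ W'), T.res (Nbd.openIn hW) a b z = 0 := by
  have : DirectedSystem (fun W : Nbd x => T.H W.lc.red a b)
      fun _ _ h => T.res (Nbd.openIn h) a b :=
    { map_self := fun W z => T.res_self _ a b z
      map_map := fun W₁ W₂ W₃ h h' z => T.res_res _ _ _ a b z }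
  exact AddCommGroup.DirectLimit.of.zero_exact (G := fun W : Nbd x => T.H W.lc.red a b)
    (f := fun _ _ h => T.res (Nbd.openIn h) a b) W z h

theorem germ_of_not_isGen {S : LC X} {y : X.sch} (h : ¬ S.IsGen y) (a b : ℤ) (z : T.H S.red a b) :
    T.germ S y a b z = 0 := by
  rw [germ, dif_neg h]; rfl

theorem genGerms_component (S : LC X) (p a b : ℤ) (z : T.H S.red a b)
    (y : {x : X.sch // HasDim x p}) : T.genGerms S p a b z y = T.germ S y.1 a b z := by
  rw [genGerms_apply, DFinsupp.finsetSum_apply]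
  by_cases h : y ∈ gens S p
  · rw [Finset.sum_eq_single y, DirectSum.of_eq_same]
    · exact fun w _ hw => DirectSum.of_eq_of_ne _ _ _ hw.symm
    · exact fun h' => (h' h).elim
  · rw [T.germ_of_not_isGen fun h' => h (mem_gens.mpr h')]
    exact Finset.sum_eq_zero fun w hw => DirectSum.of_eq_of_ne _ _ _ fun e => h (e ▸ hw)

variable (X) in
/-- The differential between the sums over the points of dimension `p` and `p - 1`. -/
noncomputable def ptsBdry (p p' a a' b : ℤ) (hp : p = p' + 1) (ha : a = a' + 1) :
    T.PtSum X p a b →+ T.PtSum X p' a' b :=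
  (T.toPts X p' a' b).comp (T.fromPts X p p' a a' b hp ha)

theorem fromPts_of (p p' a a' b : ℤ) (hp : p = p' + 1) (ha : a = a' + 1)
    (x : {x : X.sch // HasDim x p}) (W : Nbd x.1) (z : T.H W.lc.red a b) :
    T.fromPts X p p' a a' b hp ha (DirectSum.of (fun x : {x : X.sch // HasDim x p} => T.Hpt x.1 a b)
      x (T.ofNbd W a b z)) = T.ofClosed (W.compl hp x.2) a' b (T.nbdBdry hp x.2 W a a' b ha z) := by
  refine (DirectSum.toAddMonoid_of _ _ _).trans ?_
  exact AddCommGroup.DirectLimit.lift_of _ _ _ _ _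

theorem toPts_ofClosed (p a b : ℤ) (Z : ClosedLE X p) (z : T.H Z.1.red a b) :
    T.toPts X p a b (T.ofClosed Z a b z) = T.genGerms Z.1 p a b z :=
  AddCommGroup.DirectLimit.lift_of _ _ _ _ _

theorem ptsBdry_of (p p' a a' b : ℤ) (hp : p = p' + 1) (ha : a = a' + 1)
    (x : {x : X.sch // HasDim x p}) (W : Nbd x.1) (z : T.H W.lc.red a b) :
    T.ptsBdry X p p' a a' b hp ha (DirectSum.of (fun x : {x : X.sch // HasDim x p} => T.Hpt x.1 a b)
      x (T.ofNbd W a b z)) =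
      T.genGerms (W.compl hp x.2).1 p' a' b (T.nbdBdry hp x.2 W a a' b ha z) := by
  rw [ptsBdry, AddMonoidHom.comp_apply, fromPts_of, toPts_ofClosed]

/-- The components of the boundary of a class can be computed on open subsets. -/
theorem ptsBdry_of_component (p p' a a' b : ℤ) (hp : p = p' + 1) (ha : a = a' + 1)
    (x : {x : X.sch // HasDim x p}) (W : Nbd x.1) (z : T.H W.lc.red a b) {C S : LC X}
    (hS : S.OpenIn (cl x.1)) (h : LC.Split C W.lc S) (y : {x : X.sch // HasDim x p'})
    (hy : y.1 ∈ closure {x.1} → y.1 ∈ S.1) :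
    T.ptsBdry X p p' a a' b hp ha (DirectSum.of (fun x : {x : X.sch // HasDim x p} => T.Hpt x.1 a b)
      x (T.ofNbd W a b z)) y = T.germ C y.1 a' b (T.bdryLC h a a' b ha z) := by
  rw [ptsBdry_of, genGerms_component]
  have hle : C ≤ (W.compl hp x.2).1 := fun w hw => by
    have h1 : w ∈ S.1 \ W.lc.1 := h.eq ▸ hw
    exact ⟨hS.le h1.1, h1.2⟩
  have hop : C.OpenIn (W.compl hp x.2).1 := by
    obtain ⟨O, hO, e⟩ := hS
    refine ⟨O, hO, ?_⟩
    rw [h.eq, e]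
    change (O ∩ closure {x.1}) \ W.carrier = O ∩ (closure {x.1} \ W.carrier)
    rw [Set.inter_sdiff_assoc]
  have h1 := T.res_bdryLC (LC.split_diff W.openIn_cl) h hS hop h.opn.of_self a a' b ha z
  rw [T.res_self] at h1
  rw [h1]
  by_cases hC : y.1 ∈ C.1
  · exact (T.germ_res hop hC a' b _).symm
  · rw [T.germ_of_not_isGen fun h' => hC h'.mem, T.germ_of_not_isGen fun h' => hC ?_]
    rw [h.eq]
    exact ⟨hy h'.mem.1, h'.mem.2⟩

end TwistedHomologyTheory

namespace ExtendedPoincareDuality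

variable (T : ExtendedPoincareDuality.{u, v} k) {X : AlgSch k}

/-- The pull-back to the generic point of the fibre of `x`. -/
noncomputable def pullPt (x : X.sch) (a a₁ b b₁ : ℤ) (ha : a₁ = a + 2) (hb : b₁ = b + 1) :
    T.hom.Hpt x a b →+ T.hom.Hpt (fibGen x) a₁ b₁ :=
  AddCommGroup.DirectLimit.lift _ _ _
    (fun W => (T.hom.ofNbd W.line a₁ b₁).comp (T.lineResPull W.lc a a₁ b b₁ ha hb))
    fun W W' h z => by
      refine Eq.trans ?_ (T.hom.ofNbd_res (Nbd.line_mono h) a₁ b₁ _)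
      exact congrArg (T.hom.ofNbd W'.line a₁ b₁) (T.lineResPull_res (Nbd.openIn h) a a₁ b b₁ ha hb z)

theorem pullPt_ofNbd {x : X.sch} (a a₁ b b₁ : ℤ) (ha : a₁ = a + 2) (hb : b₁ = b + 1) (W : Nbd x)
    (z : T.hom.H W.lc.red a b) : T.pullPt x a a₁ b b₁ ha hb (T.hom.ofNbd W a b z) =
      T.hom.ofNbd W.line a₁ b₁ (T.lineResPull W.lc a a₁ b b₁ ha hb z) :=
  AddCommGroup.DirectLimit.lift_of _ _ _ _ _

theorem germ_lineResPull (S : LC X) (x : X.sch) (a a₁ b b₁ : ℤ) (ha : a₁ = a + 2)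
    (hb : b₁ = b + 1) (z : T.hom.H S.red a b) :
    T.hom.germ S.line (fibGen x) a₁ b₁ (T.lineResPull S a a₁ b b₁ ha hb z) =
      T.pullPt x a a₁ b b₁ ha hb (T.hom.germ S x a b z) := by
  by_cases h : S.IsGen x
  · obtain ⟨W, hW⟩ := h
    rw [T.hom.germ_eq hW, pullPt_ofNbd, lineResPull_res]
    exact T.hom.germ_eq (W := W.line) hW.line a₁ b₁ _
  · rw [T.hom.germ_of_not_isGen h, map_zero, T.hom.germ_of_not_isGen]
    rwa [LC.isGen_line_fibGen]

/-- The generic point of the fibre of a point of dimension `p`. -/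
noncomputable def fibGenDim {p p₁ : ℤ} (hp : p₁ = p + 1) (x : {x : X.sch // HasDim x p}) :
    {y : X.line.sch // HasDim y p₁} := ⟨fibGen x.1, hp ▸ x.2.fibGen⟩

theorem exists_fibGenDim {p p₁ : ℤ} (hp : p₁ = p + 1) (y : {y : X.line.sch // HasDim y p₁})
    (hy : y.1 = fibGen (X.lineProj.hom y.1)) : ∃ x : {x : X.sch // HasDim x p},
      fibGenDim hp x = y := by
  obtain ⟨n, hn⟩ := exists_hasDim (X.lineProj.hom y.1)
  have h1 := hn.fibGen
  rw [← hy] at h1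
  have h2 := h1.unique y.2
  have h3 : (n : ℤ) = p := by omega
  exact ⟨⟨_, h3 ▸ hn⟩, Subtype.ext hy.symm⟩

theorem genGerms_line (S : LC X) (p p₁ a₁ b₁ : ℤ) (hp : p₁ = p + 1)
    (z : T.hom.H S.line.red a₁ b₁) : T.hom.genGerms S.line p₁ a₁ b₁ z =
      ∑ y ∈ TwistedHomologyTheory.gens S p, DirectSum.of
        (fun x : {x : X.line.sch // HasDim x p₁} => T.hom.Hpt x.1 a₁ b₁) (fibGenDim hp y)
        (T.hom.germ S.line (fibGenDim hp y).1 a₁ b₁ z) := by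
  rw [TwistedHomologyTheory.genGerms_apply]
  symm
  refine Finset.sum_bij (fun y _ => fibGenDim hp y) (fun y hy => ?_) (fun y _ y' _ h => ?_)
    (fun y hy => ?_) fun _ _ => rfl
  · rw [TwistedHomologyTheory.mem_gens] at hy ⊢
    exact LC.isGen_line_fibGen.mpr hy
  · exact Subtype.ext (fibGen_injective congr($(h).1))
  · rw [TwistedHomologyTheory.mem_gens] at hy
    obtain ⟨x, rfl⟩ := exists_fibGenDim hp y (LC.eq_fibGen_of_isGen_line hy)
    exact ⟨x, TwistedHomologyTheory.mem_gens.mpr (LC.isGen_line_fibGen.mp hy), rfl⟩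

/-- The line over a neighbourhood `W` of `x` has `fibGen x` as its only generic point, so the sum
over generic points in the definition collapses to one term. -/
theorem ptsPull_of (p p₁ a a₁ b b₁ : ℤ) (hp : p₁ = p + 1) (ha : a₁ = a + 2) (hb : b₁ = b + 1)
    (x : {x : X.sch // HasDim x p}) (h : T.hom.Hpt x.1 a b) :
    T.ptsPull X p p₁ a a₁ b b₁ ha hb (DirectSum.of
      (fun x : {x : X.sch // HasDim x p} => T.hom.Hpt x.1 a b) x h) =
      DirectSum.of (fun x : {x : X.line.sch // HasDim x p₁} => T.hom.Hpt x.1 a₁ b₁)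
        (fibGenDim hp x) (T.pullPt x.1 a a₁ b b₁ ha hb h) := by
  obtain ⟨W, -, z, rfl⟩ := T.hom.exists_ofNbd h (Nbd.top x.1)
  refine (DirectSum.toAddMonoid_of _ _ _).trans ?_
  refine (AddCommGroup.DirectLimit.lift_of _ _ _ _ _).trans ?_
  have hgen : ∀ y, W.lc.IsGen y ↔ y = x.1 := fun y =>
    ⟨LC.eq_of_isGen_nbd, by rintro rfl; exact ⟨W, Set.univ, isOpen_univ, (Set.univ_inter _).symm⟩⟩
  have hg : TwistedHomologyTheory.gens W.lc p = {x} := by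
    ext y
    rw [TwistedHomologyTheory.mem_gens, hgen, Finset.mem_singleton, Subtype.ext_iff]
  rw [AddMonoidHom.comp_apply, T.genGerms_line _ p p₁ _ _ hp, hg, Finset.sum_singleton]
  congr 1
  refine (T.germ_lineResPull W.lc x.1 a a₁ b b₁ ha hb z).trans ?_
  have hW : W.lc.OpenIn W.lc := ⟨Set.univ, isOpen_univ, (Set.univ_inter _).symm⟩
  rw [T.hom.germ_eq hW, T.hom.res_self]

theorem ptsPull_genGerms (S : LC X) (p p₁ a a₁ b b₁ : ℤ) (hp : p₁ = p + 1) (ha : a₁ = a + 2)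
    (hb : b₁ = b + 1) (z : T.hom.H S.red a b) :
    T.ptsPull X p p₁ a a₁ b b₁ ha hb (T.hom.genGerms S p a b z) =
      T.hom.genGerms S.line p₁ a₁ b₁ (T.lineResPull S a a₁ b b₁ ha hb z) := by
  rw [T.genGerms_line _ p p₁ _ _ hp, TwistedHomologyTheory.genGerms_apply, map_sum]
  refine Finset.sum_congr rfl fun y _ => ?_
  rw [T.ptsPull_of _ _ _ _ _ _ hp]
  congr 1
  exact (T.germ_lineResPull S y.1 a a₁ b b₁ ha hb z).symm

theorem split_line {C W S : LC X} (h : LC.Split C W S) : LC.Split C.line W.line S.line :=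
  ⟨LC.line_mono h.le, h.opn.line, congr(X.lineProj.hom ⁻¹' $(h.eq))⟩

theorem bdryLC_lineResPull {C W S : LC X} (h : LC.Split C W S) (a a' a₁ a₁' b b₁ : ℤ)
    (haa : a = a' + 1) (haa₁ : a₁ = a₁' + 1) (ha : a₁ = a + 2) (ha' : a₁' = a' + 2)
    (hb : b₁ = b + 1) (z : T.hom.H W.red a b) :
    T.hom.bdryLC (split_line h) a₁ a₁' b₁ haa₁ (T.lineResPull W a a₁ b b₁ ha hb z) =
      T.lineResPull C a' a₁' b b₁ ha' hb (T.hom.bdryLC h a a' b haa z) :=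
  T.flat_bdry (split_line h).pair h.pair S.lineRes C.lineRes W.lineRes 1 S.isFlatEquidim_lineRes
    C.isFlatEquidim_lineRes W.isFlatEquidim_lineRes (LC.isPullback_line_incl _)
    (LC.isPullback_line_incl _) a a' a₁ a₁' b b₁ haa haa₁ _ _ _ z

/-- The pull-back commutes with the differentials. -/
theorem ptsBdry_ptsPull (p p' p₁ p₁' a a' a₁ a₁' b b₁ : ℤ) (hpp : p = p' + 1)
    (hpp₁ : p₁ = p₁' + 1) (hp : p₁ = p + 1) (hp' : p₁' = p' + 1) (haa : a = a' + 1)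
    (haa₁ : a₁ = a₁' + 1) (ha : a₁ = a + 2) (ha' : a₁' = a' + 2) (hb : b₁ = b + 1)
    (c : T.hom.PtSum X p a b) :
    T.hom.ptsBdry X.line p₁ p₁' a₁ a₁' b₁ hpp₁ haa₁ (T.ptsPull X p p₁ a a₁ b b₁ ha hb c) =
      T.ptsPull X p' p₁' a' a₁' b b₁ ha' hb (T.hom.ptsBdry X p p' a a' b hpp haa c) := by
  induction c using DirectSum.induction_on with
  | zero => simp only [map_zero]
  | add c c' h h' => simp only [map_add, h, h']
  | of x h =>
    obtain ⟨W, -, z, rfl⟩ := T.hom.exists_ofNbd h (Nbd.top x.1)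
    rw [T.ptsPull_of _ _ _ _ _ _ hp, pullPt_ofNbd, TwistedHomologyTheory.ptsBdry_of,
      T.ptsPull_genGerms _ _ _ _ _ _ _ hp']
    refine DFinsupp.ext fun y => ?_
    -- These two subsets are equal. Treating one as open in the other lets the boundary be computed
    -- in the pulled-back decomposition without transporting homology along the equality.
    have hS : (cl x.1).line.OpenIn (cl (fibGen x.1)) := by
      rw [cl_line]; exact ⟨Set.univ, isOpen_univ, (Set.univ_inter _).symm⟩
    have h1 := T.hom.ptsBdry_of_component p₁ p₁' a₁ a₁' b₁ hpp₁ haa₁ (fibGenDim hp x) W.line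
      (T.lineResPull W.lc a a₁ b b₁ ha hb z) hS (split_line (LC.split_diff W.openIn_cl)) y
      fun hy => by
        have h2 : y.1 ∈ closure {fibGen x.1} := hy
        rwa [closure_fibGen] at h2
    refine h1.trans ?_
    rw [T.hom.genGerms_component]
    exact congrArg (T.hom.germ _ y.1 a₁' b₁) (T.bdryLC_lineResPull (LC.split_diff W.openIn_cl) a a' a₁
      a₁' b b₁ haa haa₁ ha ha' hb z)

end ExtendedPoincareDuality

/-! ### The differential squares to zero. -/

namespace AlgSch

variable {X : AlgSch k}

/-- The last member of a chain of length `n` has dimension at least `n`, and its generic point has a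
finite dimension. The dimension of a closed set can thus be bounded through its points. -/
theorem exists_hasDim_of_le_dim {F : Set X.sch} (hF : IsClosed F) {n : ℕ}
    (h : (n : WithBot ℕ∞) ≤ topologicalKrullDim F) : ∃ z ∈ F, ∃ m : ℕ, n ≤ m ∧ HasDim z m := by
  obtain ⟨l, hl⟩ := Order.le_krullDim_iff.mp h
  have hcl : ∀ C : IrreducibleCloseds F, IsClosed (Subtype.val '' (C : Set F)) := fun C =>
    hF.isClosedEmbedding_subtypeVal.isClosedMap _ C.isClosed
  have hirr : ∀ C : IrreducibleCloseds F, IsIrreducible (Subtype.val '' (C : Set F)) := fun C =>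
    C.2.image _ continuous_subtype_val.continuousOn
  have key : ∀ (n : ℕ) (l : LTSeries (IrreducibleCloseds F)), l.length = n →
      (n : WithBot ℕ∞) ≤ topologicalKrullDim (Subtype.val '' (l.last : Set F) : Set X.sch) := by
    intro n
    induction n with
    | zero =>
      intro l _
      have : Nonempty (Subtype.val '' (l.last : Set F) : Set X.sch) := (hirr l.last).1.to_subtype
      have : Nonempty (IrreducibleCloseds (Subtype.val '' (l.last : Set F) : Set X.sch)) :=
        ⟨⟨closure {this.some}, isIrreducible_singleton.closure, isClosed_closure⟩⟩
      exact_mod_cast Order.krullDim_nonneg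
    | succ n ih =>
      intro l hl
      have hlt : l.eraseLast.last < l.last := l.eraseLast_last_rel_last (by omega)
      refine succ_le_dim (hcl l.eraseLast.last) (hirr l.last) (Set.image_mono hlt.le) (fun e => ?_)
        n (ih l.eraseLast (by simp [hl]))
      exact hlt.ne (SetLike.coe_injective (Subtype.val_injective.image_injective e))
  have h1 := key n l hl
  have h2 := (hirr l.last).closure_genericPoint (hcl l.last)
  set z := (hirr l.last).genericPoint
  have hz : z ∈ Subtype.val '' (l.last : Set F) := h2.subset (subset_closure rfl)
  obtain ⟨m, m', hm, hz'⟩ := exists_hasDim z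
  obtain rfl : m' = m := by exact_mod_cast hm
  refine ⟨z, ?_, m', ?_, m', rfl, hz'⟩
  · obtain ⟨w, -, h⟩ := hz
    rw [← h]; exact w.2
  · rw [← h2, hz'] at h1
    exact_mod_cast h1

end AlgSch

namespace TwistedHomologyTheory

variable (T : TwistedHomologyTheory.{u, v} k) {X : AlgSch k}

/-- Let `W'` be the disjoint union of small neighbourhoods of the generic points of `Z` of dimension
`p`, and `F` its complement in `Z`. The class restricted to `W'` extends to `Z`, so its boundary in
`F` is zero. That boundary is also the sum of the boundaries of the pieces, which is the element
computed by `fromPts`. -/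
theorem fromPts_toPts_ofClosed (p p' a a' b : ℤ) (hp : p = p' + 1) (ha : a = a' + 1)
    (Z : ClosedLE X p) (v : T.H Z.1.red a b) :
    T.fromPts X p p' a a' b hp ha (T.toPts X p a b (T.ofClosed Z a b v)) = 0 := by
  have hfp := T.fromPts_of (X := X) p p' a a' b hp ha
  rw [toPts_ofClosed, genGerms_apply, map_sum]
  let ι := {y // y ∈ gens Z.1 p}
  choose W hW using fun i : ι => mem_gens.mp i.2
  have hyZ : ∀ i : ι, closure {i.1.1} ⊆ Z.1.1 := fun i =>
    closure_minimal (by simpa using (hW i).le (W i).mem) Z.2.1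
  have hdis : ∀ i j : ι, i ≠ j → Disjoint (W i).carrier (W j).carrier := fun i j hij =>
    LC.nbd_disjoint (hW i) (hW j) fun e => hij (Subtype.ext (Subtype.ext e))
  have hcl : ∀ i j : ι, ∀ z ∈ closure {i.1.1}, z ∈ (W j).carrier → z ∈ (W i).carrier := by
    intro i j z hz hzj
    by_cases hij : i = j
    · exact hij ▸ hzj
    · obtain ⟨O, hO, e⟩ := hW j
      have h1 : z ∈ O ∩ Z.1.1 := e.subset hzj
      have h2 : i.1.1 ∈ (W j).lc.1 := by
        rw [e]
        exact ⟨(specializes_iff_mem_closure.mpr hz).mem_open hO h1.1, hyZ i (subset_closure rfl)⟩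
      exact (Set.disjoint_left.mp (hdis i j hij) (W i).mem h2).elim
  have hWo : ∃ O : Set X.sch, IsOpen O ∧ (⋃ i, (W i).carrier) = O ∩ Z.1.1 := by
    choose O hO e using hW
    exact ⟨⋃ i, O i, isOpen_iUnion hO, by
      rw [Set.iUnion_inter]; exact Set.iUnion_congr fun i => e i⟩
  let W' : LC X := ⟨⋃ i, (W i).carrier, by
    obtain ⟨O, hO, e⟩ := hWo
    rw [e]; exact hO.isLocallyClosed.inter Z.1.2⟩
  have hW' : W'.OpenIn Z.1 := hWo
  let F₀ := Z.1.diff W' hW'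
  have hF₀ : IsClosed F₀.1 := by
    obtain ⟨O, hO, e⟩ := hWo
    change IsClosed (Z.1.1 \ ⋃ i, (W i).carrier)
    have : Z.1.1 \ (⋃ i, (W i).carrier) = Z.1.1 \ O := by rw [e, Set.sdiff_inter_self_eq_sdiff]
    rw [this]
    exact Z.2.1.sdiff hO
  -- A point of `F` of dimension above `p'` would have dimension exactly `p`. It would then be
  -- generic in `Z` and lie in one of the removed neighbourhoods.
  let F : ClosedLE X p' := ⟨F₀, hF₀, by
    intro n hn
    obtain ⟨z, hz, m, hm, hzm⟩ := exists_hasDim_of_le_dim hF₀ hn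
    by_contra hnp
    have h1 : (m : ℤ) ≤ p := by
      obtain ⟨m', hm', hd⟩ := hzm
      have hzZ : closure {z} ⊆ Z.1.1 := closure_minimal (by simpa using hz.1) Z.2.1
      refine hm' ▸ Z.2.2 m' ?_
      rw [← hd]
      exact (Topology.IsEmbedding.inclusion hzZ).isInducing.topologicalKrullDim_le
    have h2 : HasDim z p := by
      have : (m : ℤ) = p := by omega
      rwa [← this]
    have h3 : (⟨z, h2⟩ : {x : X.sch // HasDim x p}) ∈ gens Z.1 p :=
      mem_gens.mpr (LC.isGen_of_hasDim Z.2.1 Z.2.2 hz.1 h2)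
    exact hz.2 (Set.mem_iUnion.mpr ⟨⟨_, h3⟩, (W ⟨_, h3⟩).mem⟩)⟩
  have hWW' : ∀ i, (W i).lc.OpenIn W' := fun i =>
    (hW i).of_le (fun z hz => Set.mem_iUnion.mpr ⟨i, hz⟩) hW'.le
  -- Within the disjoint union each piece is the trace of the closure of its generic point, so it is
  -- closed as well as open.
  have hpW : ∀ i, IsProper (LC.incl (hWW' i).le).hom := fun i => by
    have := LC.isClosedImmersion_incl (hWW' i).le (by
      have : W'.ι.hom ⁻¹' (W i).lc.1 = W'.ι.hom ⁻¹' closure {i.1.1} := by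
        ext z
        refine ⟨fun hz => (W i).subset_closure hz, fun hz => ?_⟩
        obtain ⟨j, hj⟩ := Set.mem_iUnion.mp (LC.mem_ι z)
        exact hcl i j _ hz hj
      rw [this]
      exact isClosed_closure.preimage W'.ι.hom.continuous)
    infer_instance
  have hF : ∀ i, (W i).compl hp i.1.2 ≤ F := fun i z hz => by
    refine ⟨hyZ i hz.1, fun h => ?_⟩
    obtain ⟨j, hj⟩ := Set.mem_iUnion.mp h
    exact hz.2 (hcl i j z hz.1 hj)
  have h1 := T.eq_sum_pushLC_res Finset.univ (fun i => (W i).lc) W' hWW' hpW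
    (fun i _ j _ hij => hdis i j hij) (by simp [W', Nbd.lc]) a b (T.res hW' a b v)
  have h2 : T.bdryLC (LC.split_diff hW') a a' b ha (T.res hW' a b v) = 0 :=
    (T.exact_res_bdryLC (LC.split_diff hW') a a' b ha).apply_apply_eq_zero v
  rw [h1, map_sum] at h2
  have h3 := congrArg (T.ofClosed F a' b) h2
  rw [map_sum, map_zero] at h3
  rw [← h3, ← Finset.sum_coe_sort]
  refine Finset.sum_congr rfl fun i _ => ?_
  rw [T.germ_eq (hW i)]
  refine (hfp i.1 (W i) (T.res (hW i) a b v)).trans ?_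
  rw [T.res_res hW' (hWW' i) (hW i), T.bdryLC_pushLC (LC.split_diff (W i).openIn_cl)
    (LC.split_diff hW') (hyZ i) (LC.proper_incl _ isClosed_closure) (hF i)
    (LC.proper_incl _ ((W i).compl hp i.1.2).2.1) (hWW' i).le (hpW i) a a' b ha]
  exact (T.ofClosed_pushIncl (hF i) a' b _).symm

theorem fromPts_toPts (p p' a a' b : ℤ) (hp : p = p' + 1) (ha : a = a' + 1) (w : T.HZ X p a b) :
    T.fromPts X p p' a a' b hp ha (T.toPts X p a b w) = 0 := by
  have key : (T.fromPts X p p' a a' b hp ha).comp (T.toPts X p a b) = 0 := by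
    refine AddCommGroup.DirectLimit.hom_ext _ fun Z => AddMonoidHom.ext fun v => ?_
    exact T.fromPts_toPts_ofClosed p p' a a' b hp ha Z v
  exact DFunLike.congr_fun key w

theorem ptsBdry_ptsBdry (p p' p'' a a' a'' b : ℤ) (hp : p = p' + 1) (hp' : p' = p'' + 1)
    (ha : a = a' + 1) (ha' : a' = a'' + 1) (c : T.PtSum X p a b) :
    T.ptsBdry X p' p'' a' a'' b hp' ha' (T.ptsBdry X p p' a a' b hp ha c) = 0 := by
  simp only [ptsBdry, AddMonoidHom.comp_apply]
  rw [fromPts_toPts, map_zero]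

end TwistedHomologyTheory

/-! ### The exact sequence attached to a fibre of the affine line. -/

namespace ExtendedPoincareDuality

variable (T : ExtendedPoincareDuality.{u, v} k) {X : AlgSch k}

theorem res_inter_line {x : X.sch} {V : Nbd (fibGen x)} {W W' : Nbd x} (hW : W ≤ W') :
    (V.inter W'.line).lc.OpenIn (V.inter W.line).lc :=
  Nbd.openIn (W := V.inter W.line) (W' := V.inter W'.line)
    (Set.inter_subset_inter_right _ (Nbd.line_mono hW))

/-- The pull-back to the generic points of the fibres is injective. -/
theorem pullPt_injective [PerfectField k] (hT : T.coh.HomotopyInvariant) (x : X.sch)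
    (a a₁ b b₁ : ℤ) (ha : a₁ = a + 2) (hb : b₁ = b + 1) :
    Function.Injective (T.pullPt x a a₁ b b₁ ha hb) := by
  rw [injective_iff_map_eq_zero]
  intro h hh
  obtain ⟨W₁, -, z, rfl⟩ := T.hom.exists_ofNbd h (Nbd.top x)
  rw [pullPt_ofNbd] at hh
  obtain ⟨V, hV, hz⟩ := T.hom.exists_res_eq_zero hh
  -- The pulled-back class vanishes on `V`. Over a small affine `W`, what remains of the line is a
  -- disjoint union of pieces whose push-forward to the line is zero.
  obtain ⟨ι, _, y, hy, U, W₀, hne, hpart⟩ := V.exists_partition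
  choose K hK using fun i => exists_pushLC_over_eq_zero T.toTwistedPoincareDuality (hy i)
    (by rw [← hy i] at *; exact hne i) (U i)
  obtain ⟨W₂, hW₂, hKW⟩ := Nbd.exists_le_of_finite K (W₀.inter W₁)
  obtain ⟨W, hW, haff⟩ := W₂.exists_affine_ge
  obtain ⟨hop, hdis, hcov⟩ := hpart W (((Nbd.le_inter_left _ _).trans hW₂).trans hW)
  have hW₁ : W₁ ≤ W := ((Nbd.le_inter_right _ _).trans hW₂).trans hW
  have hsp := LC.split_diff (V.inter_line_openIn W)
  have h1 : T.hom.res hsp.opn a₁ b₁ (T.hom.res (Nbd.openIn hW₁).line a₁ b₁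
      (T.lineResPull W₁.lc a a₁ b b₁ ha hb z)) = 0 := by
    have h2 : (V.inter W.line).lc.OpenIn V.lc := Nbd.openIn (Nbd.le_inter_left V W.line)
    rw [T.hom.res_res _ _ (hsp.opn.trans (Nbd.openIn hW₁).line)]
    have h3 := T.hom.res_res (Nbd.openIn hV) h2 (hsp.opn.trans (Nbd.openIn hW₁).line) a₁ b₁
      (T.lineResPull W₁.lc a a₁ b b₁ ha hb z)
    exact h3.symm.trans ((congrArg (T.hom.res h2 a₁ b₁) hz).trans (map_zero _))
  -- By localization the pulled-back class over `W` is pushed forward from the complement of `V`.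
  -- Decomposing `c` over the pieces shows that it is zero, and part (i) over `W` then kills the
  -- original class.
  obtain ⟨c, hc⟩ := (T.hom.exact_pushLC_res hsp a₁ b₁ _).mp h1
  have hcl : ∀ i, IsClosedImmersion (LC.incl (hop i).le).hom := fun i => by
    have h2 := (hK i W ((hKW i).trans hW) haff).2.1
    rw [← LC.incl_comp (hop i).le hsp.le, comp_hom] at h2
    exact .of_comp _ (LC.incl hsp.le).hom
  have hp : ∀ i, IsProper (LC.incl (hop i).le).hom := fun i => by
    have := hcl i
    infer_instance
  have h2 : T.hom.pushLC hsp.le hsp.pair.proper a₁ b₁ c = 0 := by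
    rw [T.hom.eq_sum_pushLC_res Finset.univ _ _ hop hp (by simpa using hdis) (by simpa using hcov)
      a₁ b₁ c, map_sum]
    refine Finset.sum_eq_zero fun i _ => ?_
    obtain ⟨-, h3, h4⟩ := hK i W ((hKW i).trans hW) haff
    refine Eq.trans ?_ (h4 inferInstance a₁ b₁ (T.hom.res (hop i) a₁ b₁ c))
    have h5 := T.hom.push_comp (LC.incl (hop i).le) (LC.incl hsp.le) (hp i) hsp.pair.proper
      (by rw [LC.incl_comp]; infer_instance) a₁ b₁ (T.hom.res (hop i) a₁ b₁ c)
    exact h5.symm.trans (T.hom.push_congr (LC.incl_comp _ _) _ _ a₁ b₁ _)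
  have h3 : T.lineResPull W.lc a a₁ b b₁ ha hb (T.hom.res (Nbd.openIn hW₁) a b z) = 0 := by
    rw [lineResPull_res, ← hc, h2]
  have h4 := (T.lineResPull_bijective hT W.lc a a₁ b b₁ ha hb).1 (h3.trans (map_zero _).symm)
  rw [← T.hom.ofNbd_res hW₁, h4, map_zero]

/-- Every class at a point `y` of the affine line which is not generic in its fibre is, up to
classes at generic points of fibres, a boundary of a class at the generic point of the fibre. -/
theorem exists_ptsBdry_eq [PerfectField k] (p p₁ a a₁ b : ℤ) (hp : p₁ = p + 1) (ha : a₁ = a + 1)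
    (x : {x : X.sch // HasDim x p}) (y : {y : X.line.sch // HasDim y p})
    (hy : X.lineProj.hom y.1 = x.1) (hne : y.1 ≠ fibGen x.1) (v : T.hom.Hpt y.1 a b) :
    ∃ h : T.hom.Hpt (fibGen x.1) a₁ b, ∀ z : {z : X.line.sch // HasDim z p},
      z.1 ≠ fibGen (X.lineProj.hom z.1) →
        T.hom.ptsBdry X.line p₁ p a₁ a b hp ha (DirectSum.of
          (fun x : {x : X.line.sch // HasDim x p₁} => T.hom.Hpt x.1 a₁ b) (fibGenDim hp x) h) z =
        DirectSum.of (fun x : {x : X.line.sch // HasDim x p} => T.hom.Hpt x.1 a b) y v z := by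
  obtain ⟨U, -, v₀, rfl⟩ := T.hom.exists_ofNbd v (Nbd.top y.1)
  obtain ⟨K, hK⟩ := exists_pushLC_over_eq_zero T.toTwistedPoincareDuality hy hne U
  obtain ⟨W, hW, haff⟩ := K.exists_affine_ge
  obtain ⟨he, hci, hz⟩ := hK W hW haff
  have hle := U.over_le_line W hy
  have hfy : fibGen x.1 ∉ closure {y.1} := fun h => hne (eq_of_mem_closure
    (mem_closure_fibGen.mpr (by rw [hy]; exact subset_closure rfl)) h)
  -- Only the closure of `y` is removed from the line over `W`, so that a class on the complement
  -- can have boundary at `y` alone among the points closed in their fibre.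
  let V : Nbd (fibGen x.1) := ⟨W.lc.line.1 \ (U.over W hy).carrier,
    ⟨W.line.mem, fun h => hfy ((U.over W hy).subset_closure h)⟩, by
      obtain ⟨O, hO, e⟩ := W.line.exists_open
      refine ⟨O ∩ (closure {y.1})ᶜ, hO.inter isClosed_closure.isOpen_compl, ?_⟩
      have e' : W.lc.line.1 = O ∩ closure {fibGen x.1} := e
      rw [he, e']
      ext z
      simp only [Set.mem_sdiff, Set.mem_inter_iff, Set.mem_compl_iff]
      tauto⟩
  have hsp : LC.Split (U.over W hy).lc V.lc W.lc.line := by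
    refine ⟨hle, ⟨(closure {y.1})ᶜ, isClosed_closure.isOpen_compl, ?_⟩,
      (Set.sdiff_sdiff_cancel_left hle).symm⟩
    change W.lc.line.1 \ (U.over W hy).carrier = _
    rw [he]
    ext z
    simp only [Set.mem_sdiff, Set.mem_inter_iff, Set.mem_compl_iff]
    tauto
  -- The class at `y` pushes forward to zero in the line over `W`, so by exactness it is the
  -- boundary of a class on `V`.
  have h1 := hz hsp.pair.proper a b (T.hom.res (Nbd.openIn (U.le_over W hy)) a b v₀)
  obtain ⟨v', hv'⟩ := (T.hom.exact_bdryLC_pushLC hsp a₁ a b ha _).mp h1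
  refine ⟨T.hom.ofNbd V a₁ b v', fun z hzA => ?_⟩
  -- A point `z` closed in its fibre, of the dimension of `x` and in the closure of `fibGen x`, must
  -- lie above `x`. The boundary at `z` can therefore be computed over `W`.
  refine (T.hom.ptsBdry_of_component p₁ p a₁ a b hp ha (fibGenDim hp x) V v' (S := W.lc.line)
    W.line.openIn_cl hsp z fun hzc => ?_).trans ?_
  · change X.lineProj.hom z.1 ∈ W.carrier
    rw [lineProj_eq_of_hasDim hzA z.2 x.2 hzc]
    exact W.mem
  · refine (congrArg (T.hom.germ _ z.1 a b) hv').trans ?_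
    by_cases hzy : z = y
    · subst hzy
      rw [DirectSum.of_eq_same]
      have hself : (U.over W hy).lc.OpenIn (U.over W hy).lc := (U.over W hy).openIn_cl.of_self
      rw [T.hom.germ_eq hself, T.hom.res_self, T.hom.ofNbd_res]
      exact U.le_over W hy
    · rw [T.hom.germ_of_not_isGen fun h => hzy (Subtype.ext (LC.eq_of_isGen_nbd h)),
        DirectSum.of_eq_of_ne _ _ _ hzy]

/-- A class at the generic point of a fibre whose boundary is supported at generic points of
fibres is a pull-back. -/
theorem exists_pullPt_eq [PerfectField k] (hT : T.coh.HomotopyInvariant) (p p₁ a a₁ a₁' b b₁ : ℤ)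
    (hp : p₁ = p + 1) (ha : a₁ = a + 2) (hb : b₁ = b + 1) (haa : a₁ = a₁' + 1)
    (x : {x : X.sch // HasDim x p}) (h : T.hom.Hpt (fibGen x.1) a₁ b₁)
    (hh : ∀ z : {z : X.line.sch // HasDim z p}, X.lineProj.hom z.1 = x.1 →
      z.1 ≠ fibGen x.1 → T.hom.ptsBdry X.line p₁ p a₁ a₁' b₁ hp haa (DirectSum.of
          (fun x : {x : X.line.sch // HasDim x p₁} => T.hom.Hpt x.1 a₁ b₁) (fibGenDim hp x) h) z = 0) :
    ∃ c, T.pullPt x.1 a a₁ b b₁ ha hb c = h := by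
  obtain ⟨V, -, v, rfl⟩ := T.hom.exists_ofNbd h (Nbd.top _)
  obtain ⟨ι, _, y, hy, U, W₀, hne, hpart⟩ := V.exists_partition
  have hyA : ∀ i, y i ≠ fibGen (X.lineProj.hom (y i)) := fun i => by rw [hy]; exact hne i
  have hyd : ∀ i, HasDim (y i) p := fun i => HasDim.of_lineProj (hyA i) (by rw [hy]; exact x.2)
  have hVW : ∀ W : Nbd x.1, (V.inter W.line).lc.OpenIn V.lc := fun W =>
    Nbd.openIn (Nbd.le_inter_left V W.line)
  obtain ⟨hop, hdis, hcov⟩ := hpart W₀ le_rfl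
  have hsp := LC.split_diff (V.inter_line_openIn W₀)
  -- The germ at `y i` of the boundary of `v` is a component of the differential, zero by
  -- hypothesis. The boundary thus vanishes on a neighbourhood of `y i`, which may be smaller than
  -- the piece of the partition.
  have hgerm : ∀ i, ∃ (U' : Nbd (y i)) (hU' : (U i).over W₀ (hy i) ≤ U'),
      T.hom.res (Nbd.openIn hU') a₁' b₁ (T.hom.res (hop i) a₁' b₁
        (T.hom.bdryLC hsp a₁ a₁' b₁ haa (T.hom.res (hVW W₀) a₁ b₁ v))) = 0 := fun i => by
    refine T.hom.exists_res_eq_zero ?_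
    rw [← T.hom.germ_eq (hop i)]
    have h1 := hh ⟨y i, hyd i⟩ (hy i) (hne i)
    rw [← T.hom.ofNbd_res (Nbd.le_inter_left V W₀.line)] at h1
    refine (T.hom.ptsBdry_of_component p₁ p a₁ a₁' b₁ hp haa (fibGenDim hp x) (V.inter W₀.line)
      (T.hom.res (hVW W₀) a₁ b₁ v) (S := W₀.lc.line) W₀.line.openIn_cl hsp ⟨y i, hyd i⟩
      fun _ => ?_).symm.trans h1
    change X.lineProj.hom (y i) ∈ W₀.carrier
    rw [hy]; exact W₀.mem
  choose U' hU' hres using hgerm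
  -- Used for the equality of carriers: over small `W`, the shrunken `U' i` contains everything in
  -- the closure of `y i`, so the vanishing holds on the whole piece.
  choose K hK using fun i => exists_isFinite_smooth_over (hy i) (hne i) (U' i)
  obtain ⟨W, hW, hKW⟩ := Nbd.exists_le_of_finite K W₀
  obtain ⟨hop', hdis', hcov'⟩ := hpart W hW
  have hsp' := LC.split_diff (V.inter_line_openIn W)
  have hCC : (W.lc.line.diff _ (V.inter_line_openIn W)).OpenIn
      (W₀.lc.line.diff _ (V.inter_line_openIn W₀)) := by
    obtain ⟨O, hO, e⟩ := (Nbd.openIn hW).line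
    refine ⟨O, hO, ?_⟩
    have e' : X.lineProj.hom ⁻¹' W.carrier = O ∩ X.lineProj.hom ⁻¹' W₀.carrier := e
    change X.lineProj.hom ⁻¹' W.carrier \ (V.carrier ∩ X.lineProj.hom ⁻¹' W.carrier) =
      O ∩ (X.lineProj.hom ⁻¹' W₀.carrier \ (V.carrier ∩ X.lineProj.hom ⁻¹' W₀.carrier))
    rw [e']
    ext z
    simp only [Set.mem_sdiff, Set.mem_inter_iff]
    tauto
  have h1 := T.hom.res_bdryLC hsp hsp' (Nbd.openIn hW).line hCC (res_inter_line hW) a₁ a₁' b₁ haa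
    (T.hom.res (hVW W₀) a₁ b₁ v)
  rw [T.hom.res_res (hVW W₀) (res_inter_line hW) (hVW W)] at h1
  have h2 : T.hom.bdryLC hsp' a₁ a₁' b₁ haa (T.hom.res (hVW W) a₁ b₁ v) = 0 := by
    refine T.hom.eq_zero_of_res Finset.univ _ _ (fun i _ => hop' i) (by simpa using hdis')
      (by simpa using hcov') a₁' b₁ _ fun i _ => ?_
    have hle : ((U i).over W (hy i)).lc ≤ (U' i).lc := fun z hz => by
      have h3 : z ∈ ((U' i).over W (hy i)).carrier := by
        rw [(hK i W (hKW i)).1]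
        exact ⟨(U i).subset_closure hz.1, hz.2⟩
      exact h3.1
    have hoU : ((U i).over W (hy i)).lc.OpenIn (U' i).lc := Nbd.openIn hle
    rw [h1, T.hom.res_res hCC (hop' i) ((hop' i).trans hCC),
      ← T.hom.res_res ((Nbd.openIn (hU' i)).trans (hop i)) hoU,
      ← T.hom.res_res (hop i) (Nbd.openIn (hU' i)), hres, map_zero]
  -- With zero boundary on the complement, the class extends to the whole line over `W`, where part
  -- (i) makes it a pull-back.
  obtain ⟨w, hw⟩ := (T.hom.exact_res_bdryLC hsp' a₁ a₁' b₁ haa _).mp h2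
  obtain ⟨c, rfl⟩ := (T.lineResPull_bijective hT W.lc a a₁ b b₁ ha hb).2 w
  refine ⟨T.hom.ofNbd W a b c, ?_⟩
  rw [pullPt_ofNbd, ← T.hom.ofNbd_res (Nbd.le_inter_left V W.line)]
  refine (T.hom.ofNbd_res (Nbd.le_inter_right V W.line) a₁ b₁ _).symm.trans ?_
  exact congrArg (T.hom.ofNbd (V.inter W.line) a₁ b₁) hw

end ExtendedPoincareDuality

/-! ### Chains supported at generic points of fibres and the comparison on `E^2`. -/

theorem TwistedHomologyTheory.ptsBdry_of_eq_zero (T : TwistedHomologyTheory.{u, v} k) {X : AlgSch k}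
    (p p' a a' b : ℤ) (hp : p = p' + 1) (ha : a = a' + 1) (x : {x : X.sch // HasDim x p})
    (h : T.Hpt x.1 a b) (y : {x : X.sch // HasDim x p'}) (hy : y.1 ∉ closure {x.1}) :
    T.ptsBdry X p p' a a' b hp ha
      (DirectSum.of (fun x : {x : X.sch // HasDim x p} => T.Hpt x.1 a b) x h) y = 0 := by
  obtain ⟨W, -, z, rfl⟩ := T.exists_ofNbd h (Nbd.top x.1)
  rw [ptsBdry_of, genGerms_component]
  refine T.germ_of_not_isGen (fun h' => hy ?_) _ _ _
  exact h'.mem.1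

namespace ExtendedPoincareDuality

variable (T : ExtendedPoincareDuality.{u, v} k) {X : AlgSch k}

/-- The chain is supported at generic points of fibres of the projection from the affine line. -/
def IsFibGenSupported {p a b : ℤ} (c : T.hom.PtSum X.line p a b) : Prop :=
  ∀ z : {z : X.line.sch // HasDim z p}, z.1 ≠ fibGen (X.lineProj.hom z.1) → c z = 0

variable {T}

theorem IsFibGenSupported.add {p a b : ℤ} {c c' : T.hom.PtSum X.line p a b}
    (h : T.IsFibGenSupported c) (h' : T.IsFibGenSupported c') : T.IsFibGenSupported (c + c') :=
  fun z hz => by rw [DirectSum.add_apply, h z hz, h' z hz, add_zero]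

theorem isFibGenSupported_zero {p a b : ℤ} :
    T.IsFibGenSupported (0 : T.hom.PtSum X.line p a b) := fun _ _ => rfl

variable (T)

theorem isFibGenSupported_ptsPull (p p₁ a a₁ b b₁ : ℤ) (hp : p₁ = p + 1) (ha : a₁ = a + 2)
    (hb : b₁ = b + 1) (c : T.hom.PtSum X p a b) :
    T.IsFibGenSupported (T.ptsPull X p p₁ a a₁ b b₁ ha hb c) := by
  induction c using DirectSum.induction_on with
  | zero => rw [map_zero]; exact isFibGenSupported_zero
  | add c c' h h' => rw [map_add]; exact h.add h'
  | of x h =>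
    intro z hz
    rw [T.ptsPull_of _ _ _ _ _ _ hp]
    refine DirectSum.of_eq_of_ne _ _ _ fun e => hz ?_
    rw [e]
    change fibGen x.1 = fibGen (X.lineProj.hom (fibGen x.1))
    rw [lineProj_fibGen]

theorem ptsPull_component (p p₁ a a₁ b b₁ : ℤ) (hp : p₁ = p + 1) (ha : a₁ = a + 2)
    (hb : b₁ = b + 1) (c : T.hom.PtSum X p a b) (x : {x : X.sch // HasDim x p}) :
    T.ptsPull X p p₁ a a₁ b b₁ ha hb c (fibGenDim hp x) = T.pullPt x.1 a a₁ b b₁ ha hb (c x) := by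
  induction c using DirectSum.induction_on with
  | zero =>
    rw [map_zero, DirectSum.zero_apply, DirectSum.zero_apply, map_zero]
    rfl
  | add c c' h h' =>
    rw [map_add, DirectSum.add_apply, DirectSum.add_apply, map_add, h, h']
    rfl
  | of y h =>
    rw [T.ptsPull_of _ _ _ _ _ _ hp]
    by_cases e : x = y
    · subst e
      rw [DirectSum.of_eq_same (β := fun x : {x : X.sch // HasDim x p} => T.hom.Hpt x.1 a b) x h]
      exact DirectSum.of_eq_same _ _
    · rw [DirectSum.of_eq_of_ne _ _ _ e, map_zero]
      exact DirectSum.of_eq_of_ne _ _ _ fun e' =>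
        e (Subtype.ext (fibGen_injective congr($(e').1)))

theorem ptsPull_injective [PerfectField k] (hT : T.coh.HomotopyInvariant) (p p₁ a a₁ b b₁ : ℤ)
    (hp : p₁ = p + 1) (ha : a₁ = a + 2) (hb : b₁ = b + 1) :
    Function.Injective (T.ptsPull X p p₁ a a₁ b b₁ ha hb) := by
  rw [injective_iff_map_eq_zero]
  intro c hc
  refine DFinsupp.ext fun x => ?_
  refine T.pullPt_injective hT x.1 a a₁ b b₁ ha hb ?_
  rw [← T.ptsPull_component p p₁ a a₁ b b₁ hp ha hb c x, hc]
  exact (map_zero _).symm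

/-- Every chain on the affine line is homologous to one supported at generic points of fibres. -/
theorem exists_isFibGenSupported_sub [PerfectField k] (p p₁ a a₁ b : ℤ) (hp : p₁ = p + 1)
    (ha : a₁ = a + 1) (β : T.hom.PtSum X.line p a b) : ∃ α : T.hom.PtSum X.line p₁ a₁ b,
      T.IsFibGenSupported (β - T.hom.ptsBdry X.line p₁ p a₁ a b hp ha α) := by
  induction β using DirectSum.induction_on with
  | zero => exact ⟨0, by rw [map_zero, sub_zero]; exact isFibGenSupported_zero⟩
  | add β β' h h' =>
    obtain ⟨α, hα⟩ := h
    obtain ⟨α', hα'⟩ := h'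
    refine ⟨α + α', ?_⟩
    rw [map_add, add_sub_add_comm]
    exact hα.add hα'
  | of y v =>
    by_cases hy : y.1 = fibGen (X.lineProj.hom y.1)
    · refine ⟨0, fun z hz => ?_⟩
      rw [map_zero, sub_zero]
      exact DirectSum.of_eq_of_ne _ _ _ fun e => hz (e ▸ hy)
    · obtain ⟨h, hh⟩ := T.exists_ptsBdry_eq p p₁ a a₁ b hp ha
        ⟨X.lineProj.hom y.1, y.2.lineProj hy⟩ y rfl hy v
      refine ⟨DirectSum.of (fun x : {x : X.line.sch // HasDim x p₁} => T.hom.Hpt x.1 a₁ b)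
        (fibGenDim hp ⟨X.lineProj.hom y.1, y.2.lineProj hy⟩) h, fun z hz => ?_⟩
      rw [DirectSum.sub_apply, sub_eq_zero]
      exact (hh z hz).symm

/-- Summands at different fibres do not interact: at a point `z` closed in its fibre, only the
summand of the fibre containing `z` contributes to the boundary. The condition on the boundary
therefore holds summand by summand, and `exists_pullPt_eq` applies to each. -/
theorem exists_ptsPull_eq [PerfectField k] (hT : T.coh.HomotopyInvariant)
    (p p₁ a a₁ a₁' b b₁ : ℤ) (hp : p₁ = p + 1) (ha : a₁ = a + 2) (hb : b₁ = b + 1)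
    (haa : a₁ = a₁' + 1) (α : T.hom.PtSum X.line p₁ a₁ b₁) (hα : T.IsFibGenSupported α)
    (hα' : T.IsFibGenSupported (T.hom.ptsBdry X.line p₁ p a₁ a₁' b₁ hp haa α)) :
    ∃ c, T.ptsPull X p p₁ a a₁ b b₁ ha hb c = α := by
  change α ∈ (T.ptsPull X p p₁ a a₁ b b₁ ha hb).range
  have hsum := DirectSum.sum_support_of α
  rw [← hsum]
  refine AddSubgroup.sum_mem _ fun w hw => ?_
  have hsupp : ∀ w ∈ DFinsupp.support α, w.1 = fibGen (X.lineProj.hom w.1) := fun w hw => by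
    by_contra h
    exact DFinsupp.mem_support_iff.mp hw (hα w h)
  obtain ⟨x, rfl⟩ := exists_fibGenDim hp w (hsupp w hw)
  obtain ⟨c, hc⟩ := T.exists_pullPt_eq hT p p₁ a a₁ a₁' b b₁ hp ha hb haa x (α (fibGenDim hp x))
    fun z hz hzx => by
      have hzA : z.1 ≠ fibGen (X.lineProj.hom z.1) := by rwa [hz]
      have h1 := hα' z hzA
      rw [← hsum, map_sum, DFinsupp.finsetSum_apply, Finset.sum_eq_single (fibGenDim hp x)] at h1
      · exact h1
      · intro w hw' hwx
        obtain ⟨x', rfl⟩ := exists_fibGenDim hp w (hsupp w hw')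
        refine T.hom.ptsBdry_of_eq_zero _ _ _ _ _ _ _ _ _ _ fun hzc => hwx ?_
        have h2 : X.lineProj.hom z.1 = x'.1 := lineProj_eq_of_hasDim hzA z.2 x'.2 hzc
        rw [show x' = x from Subtype.ext (h2.symm.trans hz)]
      · exact fun h => (h hw).elim
  refine ⟨DirectSum.of (fun x : {x : X.sch // HasDim x p} => T.hom.Hpt x.1 a b) x c, ?_⟩
  rw [T.ptsPull_of _ _ _ _ _ _ hp, hc]

theorem pullE1Comm (X : AlgSch k) : T.PullE1Comm X :=
  fun p p' p₁ p₁' q q₁ b b₁ h h₁ hp hp' hq hb x =>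
    T.ptsBdry_ptsPull p p' p₁ p₁' (p + q) (p' + q) (p₁ + q₁) (p₁' + q₁) b b₁ h h₁ hp hp' (by omega)
      (by omega) (by omega) (by omega) hb x

theorem pullE2_bijective [PerfectField k] (hT : T.coh.HomotopyInvariant) (p q b : ℤ) :
    Function.Bijective (T.pullE2 (T.pullE1Comm X) p q b) := by
  have hd : ∀ (p p' p'' q b : ℤ) (h : p = p' + 1) (h' : p' = p'' + 1) (x : T.hom.E1 X.line p q b),
      T.hom.d1 X.line p' p'' q b h' (T.hom.d1 X.line p p' q b h x) = 0 := fun p p' p'' q b h h' x =>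
    T.hom.ptsBdry_ptsBdry p p' p'' (p + q) (p' + q) (p'' + q) b h h' (by omega) (by omega) x
  have hinj : ∀ (p p₁ q q₁ b b₁ : ℤ) (hp : p₁ = p + 1) (hq : q₁ = q + 1) (hb : b₁ = b + 1),
      Function.Injective (T.pullE1 X p p₁ q q₁ b b₁ hp hq hb) := fun p p₁ q q₁ b b₁ hp hq hb =>
    T.ptsPull_injective hT p p₁ (p + q) (p₁ + q₁) b b₁ hp (by omega) hb
  -- Modulo boundaries, a chain whose boundary is supported at generic points of fibres is a
  -- pull-back. Both halves of bijectivity follow from this.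
  have hred : ∀ (p p₁ p₁' p₂ q q₁ b b₁ : ℤ) (hp : p₁ = p + 1) (hq : q₁ = q + 1) (hb : b₁ = b + 1)
      (hp₂ : p₂ = p₁ + 1) (hp₁ : p₁ = p₁' + 1) (β : T.hom.E1 X.line p₁ q₁ b₁),
      T.IsFibGenSupported (T.hom.d1 X.line p₁ p₁' q₁ b₁ hp₁ β) →
      ∃ (c : T.hom.E1 X p q b) (α : T.hom.E1 X.line p₂ q₁ b₁),
        T.pullE1 X p p₁ q q₁ b b₁ hp hq hb c = β - T.hom.d1 X.line p₂ p₁ q₁ b₁ hp₂ α := by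
    intro p p₁ p₁' p₂ q q₁ b b₁ hp hq hb hp₂ hp₁ β hβ
    obtain ⟨α, hα⟩ := T.exists_isFibGenSupported_sub p₁ p₂ (p₁ + q₁) (p₂ + q₁) b₁ hp₂ (by omega) β
    -- The generic point of a fibre over a point of dimension `p` has dimension `p + 1`, so its
    -- boundary lives at points of dimension `p`, including the closed points of that fibre.
    obtain rfl : p₁' = p := by omega
    have h1 : T.IsFibGenSupported (T.hom.d1 X.line p₁ p₁' q₁ b₁ hp₁
        (β - T.hom.d1 X.line p₂ p₁ q₁ b₁ hp₂ α)) := by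
      rw [map_sub, hd, sub_zero]; exact hβ
    obtain ⟨c, hc⟩ := T.exists_ptsPull_eq hT p₁' p₁ (p₁' + q) (p₁ + q₁) (p₁' + q₁) b b₁ hp
      (by omega) hb (by omega) _ hα h1
    exact ⟨c, α, hc⟩
  constructor
  · rw [injective_iff_map_eq_zero]
    intro e he
    induction e using QuotientAddGroup.induction_on with
    | H x =>
      have h1 : T.pullCycles (T.pullE1Comm X) p q b x ∈ T.hom.boundaries X.line (p + 1) (q + 1) (b + 1) :=
        (QuotientAddGroup.eq_zero_iff _).mp he
      obtain ⟨β, hβ⟩ := AddSubgroup.mem_addSubgroupOf.mp h1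
      have hβ' : T.hom.d1 X.line (p + 1 + 1) (p + 1) (q + 1) (b + 1) rfl β =
        T.pullE1 X p (p + 1) q (q + 1) b (b + 1) rfl rfl rfl x := hβ
      -- The chain `β` bounds a pull-back, so it may be replaced by the pull-back of some `c` with
      -- the same boundary. Injectivity on `E^1` then shows that `c` bounds the original cycle.
      obtain ⟨c, α, hc⟩ := hred (p + 1) (p + 1 + 1) (p + 1) (p + 1 + 1 + 1) q (q + 1) b (b + 1) rfl
        rfl rfl rfl rfl β (by
          rw [hβ']
          exact T.isFibGenSupported_ptsPull _ _ _ _ _ _ rfl _ _ _)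
      refine (QuotientAddGroup.eq_zero_iff _).mpr (AddSubgroup.mem_addSubgroupOf.mpr ⟨c, ?_⟩)
      refine hinj p (p + 1) q (q + 1) b (b + 1) rfl rfl rfl ?_
      rw [← T.pullE1Comm X (p + 1) p (p + 1 + 1) (p + 1) q (q + 1) b (b + 1) rfl rfl rfl rfl rfl rfl,
        hc, map_sub, hd, sub_zero]
      exact hβ'
  · intro e
    induction e using QuotientAddGroup.induction_on with
    | H y =>
      have hy : T.hom.d1 X.line (p + 1) (p + 1 - 1) (q + 1) (b + 1) (sub_add_cancel (p + 1) 1).symm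
        y.1 = 0 := y.2
      obtain ⟨c, α, hc⟩ := hred p (p + 1) (p + 1 - 1) (p + 1 + 1) q (q + 1) b (b + 1) rfl rfl rfl
        rfl (sub_add_cancel (p + 1) 1).symm y.1 (by rw [hy]; exact isFibGenSupported_zero)
      -- The pull-back of `c` differs from a cycle by a boundary, so it is a cycle; injectivity on
      -- `E^1` one degree lower makes `c` itself a cycle.
      have hc' : T.hom.d1 X p (p - 1) q b (sub_add_cancel p 1).symm c = 0 := by
        refine hinj (p - 1) (p + 1 - 1) q (q + 1) b (b + 1) (by omega) rfl rfl ?_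
        rw [← T.pullE1Comm X p (p - 1) (p + 1) (p + 1 - 1) q (q + 1) b (b + 1)
          (sub_add_cancel p 1).symm (sub_add_cancel (p + 1) 1).symm rfl (by omega) rfl rfl, hc,
          map_sub, hd, hy, sub_zero, map_zero]
      refine ⟨QuotientAddGroup.mk ⟨c, hc'⟩, ?_⟩
      refine QuotientAddGroup.eq.mpr (AddSubgroup.mem_addSubgroupOf.mpr ⟨α, ?_⟩)
      change _ = -(T.pullE1 X p (p + 1) q (q + 1) b (b + 1) rfl rfl rfl c) + y.1
      rw [hc]
      abel

end ExtendedPoincareDuality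

end BlochOgus

theorem lemma5p5 {k : Type u} [Field k] [PerfectField k]
    (T : BlochOgus.ExtendedPoincareDuality.{u, v} k) (hT : T.coh.HomotopyInvariant)
    (X : BlochOgus.AlgSch k) :
    (∀ a b : ℤ, Function.Bijective (T.linePull X a b)) ∧
      ∃ h : T.PullE1Comm X, ∀ p q b : ℤ, Function.Bijective (T.pullE2 h p q b) :=
  ⟨T.linePull_bijective hT X, T.pullE1Comm X, fun p q b => T.pullE2_bijective hT p q b⟩
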